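/- **Setting.** Fix $q=e^{\lambda}$ with $\operatorname{Re}\lambda<0$ and write $q^s=e^{s\lambda}$; let $k,r\in\mathbb R$ with $k\neq-2$, $r>0$ and $r^*=r-k>0$; put $[s]=(q^s-q^{-s})/(q-q^{-1})$. Points are written $z=q^{2u}$, $w=q^{2v}$, with $\ln z=2u\lambda$, $z^s=e^{s\ln z}$, $\ln(q^\alpha z)=\ln z+\alpha\lambda$. Consider bosons with $[a_n,a_m]=\frac{[(k+2)n][2n]}{n}\delta_{n+m,0}$, $[b_n,b_m]=-\frac{[n]^2}{n}\delta_{n+m,0}$, $[c_n,c_m]=\frac{[n]^2}{n}\delta_{n+m,0}$ ($n,m\ne0$), $[p_a,q_a]=2(k+2)$, $[p_b,q_b]=-1$, $[p_c,q_c]=1$, $[\hat q,\hat p]=1$, all other commutators being zero. They act on the total Fock space $\bigoplus_{l,m_1,m_2,n\in\mathbb C}\mathcal F_{l,m_1,m_2}\otimes\mathcal F_n$, where the summand is generated by the modes $a_{-j},b_{-j},c_{-j}$ ($j>0$) from $e^{\frac{l\,q_a}{2(k+2)}+m_1q_b+m_2q_c+n\hat q}|\mathbf 0\rangle$, and $|\mathbf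 0\rangle$ is annihilated by $x_j$ ($j>0$), $p_x$ ($x=a,b,c$) and $\hat p$. Normal ordering $:\ :$ puts $x_j$ ($j>0$), $p_x$, $\hat p$ to the right. For $x=a,b,c$ let $$x(z;\alpha)=-\sum_{n\ne0}\tfrac{x_n}{[n]}q^{-\alpha|n|}z^{-n}+q_x+p_x\ln z,\quad x(z)=x(z;0),\quad x_\pm(z)=\pm\Big((q-q^{-1})\sum_{n>0}x_{\pm n}z^{\mp n}+p_x\ln q\Big),$$ $$x_+^*(z)=-\sum_{n>0}\tfrac{x_n}{[rn]}z^{-n},\qquad x_-^*(z)=\sum_{n>0}\tfrac{x_{-n}}{[r^*n]}z^n,$$ and let $$A_\pm(L_1,\dots,L_s;M_1,\dots,M_{s+1}|z;\alpha)=\sum_{n>0}\frac{[L_1n]\cdots[L_sn]}{[M_1n]\cdots[M_{s+1}n]}\,a_{\pm n}(q^\alpha z)^{\mp n},$$ $A_\pm(M|z;\alpha)$ being the case $s=0$; $B_\pm$ is the same with $b$ in place of $a$. Write $(b+c)(z)=b(z)+c(z)$. **Currents.** With $U^+(z)=\exp[a_-^*(q^{r^*+\frac k2-1}z)+b_-^*(q^{r^*}z)+b_-^*(q^{r^*-2}z)]$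 and $U^-(z)=\exp[a_+^*(q^{-(r-\frac k2-1)}z)+b_+^*(q^{-(r-k-2)}z)+b_+^*(q^{-(r-k)}z)]$, $$\psi_\pm(z)=:\exp[b_\pm(q^{\pm\frac k2}z)+a_\pm(q^{\pm1}z)+b_\pm(q^{\pm(\frac k2+2)}z)]:,$$ $$e^+(z)=\tfrac{-1}{(q-q^{-1})z}:\{e^{b_+(z)-(b+c)(qz)}-e^{b_-(z)-(b+c)(q^{-1}z)}\}:,$$ $$e^-(z)=\tfrac{-1}{(q-q^{-1})z}:\{e^{(b+c)(q^{-(k+1)}z)+a_-(q^{-\frac{k+2}2}z)+b_-(q^{-(k+2)}z)}-e^{(b+c)(q^{k+1}z)+a_+(q^{\frac{k+2}2}z)+b_+(q^{k+2}z)}\}:,$$ put $$H^\pm(z)=U^+(q^{\pm\frac k2}z)\psi_\pm(z)U^-(q^{\mp\frac k2}z)\,e^{2\hat q}(q^{\mp\frac k2}z)^{\frac{2p_b+p_a}r}(q^{\pm(r-\frac k2)}z)^{\frac{\hat p-1}r-\frac{\hat p-1}{r^*}},$$ $$E(z)=U^+(z)e^+(z)e^{2\hat q}z^{-\frac{\hat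 p-1}{r^*}},\qquad F(z)=e^-(z)U^-(z)z^{\frac{2p_b+p_a}r}z^{\frac{\hat p-1}r}.$$ **Screening currents.** Put $$S_I(z)=:\exp\{c(z)+\tfrac{q_a}2+q_b-r^*\hat q\}:,$$ $$S_{II}(z)=\tfrac{-1}{(q-q^{-1})z}:\exp\{A_+(k+2|z;\tfrac{k+2}2)-\tfrac{1}{k+2}(q_a+p_a\ln z)+A_-(-(k+2)|z;-\tfrac{k+2}2)\}\times\{e^{-b_-(z)-(b+c)(qz)}-e^{-b_+(z)-(b+c)(q^{-1}z)}\}:,$$ and $$\tilde s_1(z)=:\exp\{A_-(r^*|z;r-\tfrac k2-1)+\tfrac{q_a}2+B_-(-(r-k-2);r^*,1|z;-1)-p_b\ln z+B_+(1|z;-1)+(2-r^*)\hat q-\tfrac{\hat p-1}{r^*}\ln z\}:,$$ $$\tilde s_2(z)=:\exp\{A_-(-(k+2)|z;\tfrac{k+2}2)+A_+(r-k-2;k+2,r|z;\tfrac{k+2}2)-\tfrac1{k+2}(q_a+p_a\ln z)-B_+(2;1,r|z;-(r-k-1))+\tfrac{2p_b+p_a+\hat p-1}r\ln z\}:,$$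 $$\tilde s_3(z)=:\exp\{A_-(-(k+2)|z;-\tfrac{k+2}2)+A_+(k+2|z;\tfrac{k+2}2)+\tfrac1{2(k+2)}(kq_a-2p_a\ln z)-b(z;1)+q_b-r^*\hat q\}:.$$ Let ${}_n\partial_wX(w)=\dfrac{X(q^nw)-X(q^{-n}w)}{(q-q^{-1})w}$ and, for $\nu>0$, $\theta_\nu(u)=q^{u^2/\nu-u}\,\Theta_{q^{2\nu}}(q^{2u})/(q^{2\nu};q^{2\nu})_\infty^3$, where $\Theta_t(x)=(x;t)_\infty(tx^{-1};t)_\infty(t;t)_\infty$ and $(x;t)_\infty=\prod_{n\ge0}(1-xt^n)$. **Theorem.** Each matrix element, between Fock space basis vectors, of each product $X(z)Y(w)$ below (resp. $Y(w)X(z)$) converges absolutely for $|z|>R|w|$ (resp. $|w|>R|z|$), for some $R>0$ independent of the matrix element, and continues to a meromorphic function of $(u,v)\in\mathbb C^2$. In the sense of these continuations, $$H^\pm(z)S_I(w)=S_I(w)H^\pm(z)=O(1),$$ $$E(z)S_I(w)=-S_I(w)E(z)={}_1\partial_w\Big[\tfrac1{z-w}\tilde s_1(z)\Big]+O(1),$$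 $$F(z)S_I(w)=-S_I(w)F(z)=O(1),\qquad S_I(z)S_I(w)=-S_I(w)S_I(z)=O(1);$$ $$H^\pm(z)S_{II}(w)=S_{II}(w)H^\pm(z)=O(1),\qquad E(z)S_{II}(w)=S_{II}(w)E(z)=O(1),$$ $$F(z)S_{II}(w)=S_{II}(w)F(z)={}_{k+2}\partial_w\Big[\tfrac1{z-w}\tilde s_2(z)\Big]+O(1),$$ $$S_{II}(z)S_{II}(w)=\frac{\theta_{k+2}(u-v+1)}{\theta_{k+2}(u-v-1)}S_{II}(w)S_{II}(z)\qquad(\text{if }k>-2);$$ $$S_{II}(z)S_I(w)=-S_I(w)S_{II}(z)={}_1\partial_w\Big[\tfrac1{z-w}\tilde s_3(z)\Big]+O(1).$$ Here $O(1)$ denotes a term whose matrix elements are holomorphic functions of $(u,v)$ on $\mathbb C^2$; in the three relations with a total difference ${}_n\partial_w$ ($n=1$ or $k+2$), holomorphic at all $(u,v)\in\mathbb C^2$ except possibly those at which $w=q^{\pm n}z$ but $\ln w\ne\ln z\pm n\ln q$ (same sign). -/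

import Mathlib

/-!
Free field realization of the level `k` elliptic currents and their screening currents.

Conventions.  `q = exp (lnq)`, and a complex power `q ^ s` always means `exp (s * lnq)`.  A point
`z` is given by its additive coordinate `u`, with `z = q ^ (2 u)` and `ln z = 2 u lnq`; all complex
powers of `z` refer to this determination of the logarithm.  In this coordinate `q ^ α * z` is
`u + α / 2`.
-/

noncomputable section

namespace ScreeningCurrents

/-- The parameters: a logarithm `lnq` of `q`, the level `k`, and the elliptic parameter `r`
(so that `p = q ^ (2 r)`, `p* = q ^ (2 r*)`). -/
structure Params where
  lnq : ℂ
  k : ℝ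
  r : ℝ

/-- The three families of free bosons. -/
inductive Boson
  | a
  | b
  | c
  deriving DecidableEq

/-- The generators of the algebra of modes: the oscillators `x_n` (`n ≠ 0`), the zero modes `q_x`
and `p_x` of each boson `x`, the additional pair `q̂`, `p̂`, and the constant `1`. -/
inductive Gen
  | osc (x : Boson) (n : ℤ)
  | qz (x : Boson)
  | pz (x : Boson)
  | qhat
  | phat
  | one
  deriving DecidableEq

/-- Formal, possibly infinite, linear combinations of the generators. -/
abbrev Lin := Gen → ℂ

/-- The formal sum `∑_{n ≠ 0} f n • x_n`. -/
def oscSum (x : Boson) (f : ℤ → ℂ) : Lin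
  | .osc y n => if y = x ∧ n ≠ 0 then f n else 0
  | _ => 0

/-- The zero mode `q_x`. -/
def Q (x : Boson) : Lin := Pi.single (Gen.qz x) 1

/-- The zero mode `p_x`. -/
def Pm (x : Boson) : Lin := Pi.single (Gen.pz x) 1

/-- The generator `q̂`. -/
def Qhat : Lin := Pi.single Gen.qhat 1

/-- The generator `p̂`. -/
def Phat : Lin := Pi.single Gen.phat 1

/-- The constant `1`. -/
def One1 : Lin := Pi.single Gen.one 1

/-- The oscillators are labelled by a boson and a positive integer `n`; the label `(x, n)` stands
for the creation mode `x_{-n}` and for the annihilation mode `x_n`. -/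
abbrev Mode := Boson × ℕ+

/-- The oscillator part of a Fock space: polynomials in the creation modes `x_{-n}`. -/
abbrev Osc := MvPolynomial Mode ℂ

/-- Highest weights: `|l, m₁, m₂⟩ ⊗ |n⟩`. -/
@[ext] structure Weight where
  l : ℂ
  m₁ : ℂ
  m₂ : ℂ
  n : ℂ

/-- The basis of the total Fock space `⨁ F_{l, m₁, m₂} ⊗ F_n`: a monomial in the creation modes,
applied to the highest weight vector of the given weight. -/
abbrev FockIndex := Weight × (Mode →₀ ℕ)

/-- Operators from the Fock space to its completion, through their matrix elements: `X i j` is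
the coefficient of the basis vector `i` in the image of the basis vector `j`. -/
abbrev Op := FockIndex → FockIndex → ℂ

/-- The product of two operators. -/
def opMul (X Y : Op) : Op := fun i j => ∑' m, X i m * Y m j

namespace Params

variable (P : Params)

/-- `r* = r - k`. -/
def rs : ℝ := P.r - P.k

/-- `q ^ s`. -/
def qp (s : ℂ) : ℂ := Complex.exp (s * P.lnq)

/-- `ln z` at the coordinate `u`. -/
def lnz (u : ℂ) : ℂ := 2 * u * P.lnq

/-- `z = q ^ (2 u)`. -/
def z (u : ℂ) : ℂ := P.qp (2 * u)

/-- `z ^ s`. -/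
def zp (u s : ℂ) : ℂ := Complex.exp (s * P.lnz u)

/-- `q - q⁻¹`. -/
def dq : ℂ := P.qp 1 - P.qp (-1)

/-- `[s] = (q ^ s - q ^ (-s)) / (q - q⁻¹)`. -/
def br (s : ℂ) : ℂ := (P.qp s - P.qp (-s)) / P.dq

/-- The commutator `[x_n, x_{-n}]` for `n > 0`. -/
def kappa : Mode → ℂ
  | (.a, n) => P.br ((P.k + 2) * (n : ℕ)) * P.br (2 * (n : ℕ)) / (n : ℕ)
  | (.b, n) => -(P.br (n : ℕ) ^ 2 / (n : ℕ))
  | (.c, n) => P.br (n : ℕ) ^ 2 / (n : ℕ)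

/-! ### The action of exponentials on the Fock space -/

/-- The annihilation mode `x_n`, `n > 0`; the creation mode `x_{-n}` is multiplication by the
variable. -/
def annih (x : Mode) (f : Osc) : Osc := P.kappa x • MvPolynomial.pderiv x f

/-- The operator `∑ β_x x` over all annihilation modes; on each polynomial only finitely many
terms do not vanish. -/
def annihSum (β : Mode → ℂ) (f : Osc) : Osc := ∑ x ∈ f.vars, β x • P.annih x f

/-- `exp (∑ β_x x)` over all annihilation modes `x`: translation of the variables, by Taylor's
formula (see `expAnnih_eq`). -/
def expAnnih (β : Mode → ℂ) : Osc →ₐ[ℂ] Osc :=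
  MvPolynomial.aeval fun x => MvPolynomial.X x + MvPolynomial.C (β x * P.kappa x)

/-- The creation and annihilation modes satisfy the commutation relations of the bosons. -/
theorem annih_create (x y : Mode) (f : Osc) :
    P.annih x (MvPolynomial.X y * f) - MvPolynomial.X y * P.annih x f
      = if x = y then P.kappa x • f else 0 := by
  unfold annih
  rw [Derivation.leibniz, MvPolynomial.pderiv_X]
  by_cases h : x = y
  · subst h; simp [MvPolynomial.smul_eq_C_mul]; ring
  · simp [h, Ne.symm h, MvPolynomial.smul_eq_C_mul]; ring

theorem annihSum_eq (β : Mode → ℂ) (f : Osc) :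
    P.annihSum β f
      = MvPolynomial.mkDerivation ℂ (fun x => MvPolynomial.C (β x * P.kappa x) : Mode → Osc) f := by
  classical
  have h := MvPolynomial.derivation_eqOn_supported (f := f) (s := (f.vars : Set Mode))
    (D₁ := ∑ x ∈ f.vars, (β x * P.kappa x) • (MvPolynomial.pderiv x : Derivation ℂ Osc Osc))
    (D₂ := MvPolynomial.mkDerivation ℂ (fun x => MvPolynomial.C (β x * P.kappa x) : Mode → Osc))
    (by
      intro y hy
      have hy' : y ∈ f.vars := hy
      have hs : ∀ g : Mode → Derivation ℂ Osc Osc, ∀ t : Finset Mode, ∀ e : Osc,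
          (∑ x ∈ t, g x) e = ∑ x ∈ t, g x e := by
        intro g t e
        induction t using Finset.induction_on with
        | empty => simp
        | insert a t ha ih => simp [Finset.sum_insert ha, ih]
      simp only [Function.comp, hs, Derivation.smul_apply, MvPolynomial.mkDerivation_X]
      rw [Finset.sum_eq_single y]
      · simp [MvPolynomial.smul_eq_C_mul]
      · intro x _ hxy
        simp [MvPolynomial.pderiv_X, Ne.symm hxy]
      · intro h; exact absurd hy' h)
  have h2 := h (MvPolynomial.mem_supported_vars f)
  rw [← h2]
  have hs : ∀ g : Mode → Derivation ℂ Osc Osc, ∀ t : Finset Mode, ∀ e : Osc,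
      (∑ x ∈ t, g x) e = ∑ x ∈ t, g x e := by
    intro g t e
    induction t using Finset.induction_on with
    | empty => simp
    | insert a t ha ih => simp [Finset.sum_insert ha, ih]
  simp [annihSum, annih, hs, smul_smul]

/-- `expAnnih` is the exponential series of `annihSum`, which terminates on each polynomial. -/
theorem expAnnih_eq (β : Mode → ℂ) (f : Osc) :
    P.expAnnih β f
      = ∑ n ∈ Finset.range (f.totalDegree + 1),
          ((n.factorial : ℂ)⁻¹) • (P.annihSum β)^[n] f := by
  classical
  let c : Mode → ℂ := fun x => β x * P.kappa x
  let Φ : Osc →ₐ[ℂ] Polynomial Osc := MvPolynomial.aeval fun x =>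
    Polynomial.C (MvPolynomial.X x) + Polynomial.X * Polynomial.C (MvPolynomial.C (c x))
  let D := MvPolynomial.mkDerivation ℂ (fun x => MvPolynomial.C (c x) : Mode → Osc)
  have hD : P.annihSum β = D := by funext g; exact P.annihSum_eq β g
  have hC : ∀ a : ℂ, Φ (MvPolynomial.C a) = Polynomial.C (MvPolynomial.C a) := by
    intro a
    exact (MvPolynomial.aeval_C _ a).trans rfl
  have hX : ∀ x, Φ (MvPolynomial.X x)
      = Polynomial.C (MvPolynomial.X x) + Polynomial.X * Polynomial.C (MvPolynomial.C (c x)) :=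
    fun x => MvPolynomial.aeval_X _ x
  have hder : ∀ g, Polynomial.derivative (Φ g) = Φ (D g) := by
    intro g
    induction g using MvPolynomial.induction_on with
    | C a =>
      have : D (MvPolynomial.C a) = 0 := MvPolynomial.derivation_C _ a
      rw [hC, this]; simp
    | add p q hp hq => simp [hp, hq]
    | mul_X p x hp =>
      have hx : D (MvPolynomial.X x) = MvPolynomial.C (c x) := MvPolynomial.mkDerivation_X _ _ _
      rw [map_mul, Polynomial.derivative_mul, hp, Derivation.leibniz, hx, smul_eq_mul,
        smul_eq_mul, map_add, map_mul Φ p, hC, map_mul Φ (MvPolynomial.X x), hX]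
      simp
      ring
  have hiter : ∀ n g, Polynomial.derivative^[n] (Φ g) = Φ (D^[n] g) := by
    intro n
    induction n with
    | zero => intro g; rfl
    | succ n ih => intro g; rw [Function.iterate_succ_apply, Function.iterate_succ_apply, hder, ih]
  have h0 : ∀ g, (Φ g).coeff 0 = g := by
    intro g
    induction g using MvPolynomial.induction_on with
    | C a => rw [hC]; simp
    | add p q hp hq => simp [hp, hq]
    | mul_X p x hp => rw [map_mul, Polynomial.mul_coeff_zero, hp, hX]; simp
  have h1 : ∀ g, (Φ g).eval 1 = P.expAnnih β g := by
    intro g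
    induction g using MvPolynomial.induction_on with
    | C a => rw [hC]; simp [expAnnih]
    | add p q hp hq => simp [hp, hq]
    | mul_X p x hp => rw [map_mul, Polynomial.eval_mul, hp, hX]; simp [expAnnih, c]
  have hcoeff : ∀ n g, (Φ g).coeff n = ((n.factorial : ℂ)⁻¹) • D^[n] g := by
    intro n g
    have h := congrArg (fun p => Polynomial.coeff p 0) (hiter n g)
    simp only [h0, Polynomial.coeff_iterate_derivative, zero_add, Nat.descFactorial_self] at h
    rw [← h, ← Nat.cast_smul_eq_nsmul ℂ, smul_smul,
      inv_mul_cancel₀ (by exact_mod_cast n.factorial_ne_zero), one_smul]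
  have hdeg : (Φ f).natDegree ≤ f.totalDegree := by
    have hf : Φ f = ∑ m ∈ f.support, Φ (MvPolynomial.monomial m (f.coeff m)) := by
      conv_lhs => rw [f.as_sum, map_sum]
    rw [hf]
    apply Polynomial.natDegree_sum_le_of_forall_le
    intro m hm
    refine le_trans ?_ (MvPolynomial.le_totalDegree hm)
    have : Φ (MvPolynomial.monomial m (f.coeff m))
        = Polynomial.C (MvPolynomial.C (f.coeff m)) * m.prod fun x e =>
          (Polynomial.C (MvPolynomial.X x)
            + Polynomial.X * Polynomial.C (MvPolynomial.C (c x))) ^ e := by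
      rw [MvPolynomial.monomial_eq, map_mul, hC, Finsupp.prod, map_prod]
      simp only [map_pow, hX, Finsupp.prod]
    rw [this]
    refine (Polynomial.natDegree_C_mul_le _ _).trans ?_
    refine (Polynomial.natDegree_prod_le _ _).trans ?_
    refine Finset.sum_le_sum fun x _ => ?_
    refine Polynomial.natDegree_pow_le.trans ?_
    refine (Nat.mul_le_mul_left _ (?_ : _ ≤ 1)).trans (by simp)
    refine (Polynomial.natDegree_add_le _ _).trans ?_
    simp only [Polynomial.natDegree_C, zero_le, sup_of_le_right]
    refine (Polynomial.natDegree_mul_C_le _ _).trans ?_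
    simp
  rw [← h1, Polynomial.eval_eq_sum_range' (Nat.lt_succ_of_le hdeg), hD]
  simp [hcoeff]

/-- `exp (∑ α_x x)` over all creation modes `x`, as a power series in the creation modes. -/
def expCreate (α : Mode → ℂ) : MvPowerSeries Mode ℂ :=
  fun m => m.prod fun x e => α x ^ e / (e.factorial : ℂ)

/-- The weight of the image, under `exp X`, of a vector of weight `wt`:
`exp (s q_a)` adds `2 (k + 2) s` to `l`, while `exp (s q_b)`, `exp (s q_c)`, `exp (s q̂)` add `s`
to `m₁`, `m₂`, `n`. -/
def shift (X : Lin) (wt : Weight) : Weight where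
  l := wt.l + 2 * (P.k + 2) * X (.qz .a)
  m₁ := wt.m₁ + X (.qz .b)
  m₂ := wt.m₂ + X (.qz .c)
  n := wt.n + X .qhat

/-- The eigenvalue, on vectors of weight `wt`, of the part of `X` in `p_a`, `p_b`, `p_c`, `p̂`, `1`:
these have the eigenvalues `l`, `-m₁`, `m₂`, `-n`, `1`. -/
def momentum (X : Lin) (wt : Weight) : ℂ :=
  X (.pz .a) * wt.l - X (.pz .b) * wt.m₁ + X (.pz .c) * wt.m₂ - X .phat * wt.n + X .one

open Classical in
/-- The normal ordered exponential `:exp X:`, in which the annihilation modes and `p_x`, `p̂` act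
first, followed by the creation modes and `q_x`, `q̂`. -/
def nexp (X : Lin) : Op := fun i j =>
  if i.1 = P.shift X j.1 then
    Complex.exp (momentum X j.1) *
      MvPowerSeries.coeff i.2
        (expCreate (fun x => X (.osc x.1 (-(x.2 : ℤ)))) *
          (P.expAnnih (fun x => X (.osc x.1 (x.2 : ℤ))) (MvPolynomial.monomial j.2 1) :
            MvPowerSeries Mode ℂ))
  else 0

/-! ### Free fields -/

/-- `x(z; α) = -∑_{n ≠ 0} x_n / [n] q^{-α |n|} z^{-n} + q_x + p_x ln z`. -/
def field (x : Boson) (u α : ℂ) : Lin :=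
  -oscSum x (fun n => P.qp (-α * (|n| : ℤ)) * P.zp u (-n) / P.br n) + Q x + P.lnz u • Pm x

/-- `x_+(z) = (q - q⁻¹) ∑_{n > 0} x_n z^{-n} + p_x ln q`. -/
def fieldP (x : Boson) (u : ℂ) : Lin :=
  oscSum x (fun n => if 0 < n then P.dq * P.zp u (-n) else 0) + P.lnq • Pm x

/-- `x_-(z) = -((q - q⁻¹) ∑_{n > 0} x_{-n} z^n + p_x ln q)`. -/
def fieldM (x : Boson) (u : ℂ) : Lin :=
  -(oscSum x (fun n => if n < 0 then P.dq * P.zp u (-n) else 0) + P.lnq • Pm x)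

/-- `x_+^*(z) = -∑_{n > 0} x_n / [r n] z^{-n}`. -/
def twistP (x : Boson) (u : ℂ) : Lin :=
  -oscSum x (fun n => if 0 < n then P.zp u (-n) / P.br (P.r * n) else 0)

/-- `x_-^*(z) = ∑_{n > 0} x_{-n} / [r* n] z^n`. -/
def twistM (x : Boson) (u : ℂ) : Lin :=
  oscSum x (fun n => if n < 0 then P.zp u (-n) / P.br (P.rs * (-n)) else 0)

/-- `∑_{n > 0} ([L₁ n] ⋯ [L_s n]) / ([M₁ n] ⋯ [M_{s+1} n]) x_n (q^α z)^{-n}`. -/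
def genP (x : Boson) (L M : List ℝ) (u α : ℂ) : Lin :=
  oscSum x fun n =>
    if 0 < n then
      (L.map fun c => P.br (c * n)).prod / (M.map fun c => P.br (c * n)).prod *
        P.zp (u + α / 2) (-n)
    else 0

/-- `∑_{n > 0} ([L₁ n] ⋯ [L_s n]) / ([M₁ n] ⋯ [M_{s+1} n]) x_{-n} (q^α z)^n`; below, the index of
the mode is `n < 0`. -/
def genM (x : Boson) (L M : List ℝ) (u α : ℂ) : Lin :=
  oscSum x fun n =>
    if n < 0 then
      (L.map fun c => P.br (c * (-n))).prod / (M.map fun c => P.br (c * (-n))).prod *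
        P.zp (u + α / 2) (-n)
    else 0

/-- `(b + c)(z)`. -/
def bc (u : ℂ) : Lin := P.field .b u 0 + P.field .c u 0

/-! ### The currents -/

/-- `ψ_+(z)`. -/
def psiP (u : ℂ) : Op :=
  P.nexp (P.fieldP .b (u + P.k / 2 / 2) + P.fieldP .a (u + 1 / 2)
    + P.fieldP .b (u + (P.k / 2 + 2) / 2))

/-- `ψ_-(z)`. -/
def psiM (u : ℂ) : Op :=
  P.nexp (P.fieldM .b (u - P.k / 2 / 2) + P.fieldM .a (u - 1 / 2)
    + P.fieldM .b (u - (P.k / 2 + 2) / 2))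

/-- `e^+(z)`. -/
def eP (u : ℂ) : Op :=
  (-1 / (P.dq * P.z u)) •
    (P.nexp (P.fieldP .b u - P.bc (u + 1 / 2)) - P.nexp (P.fieldM .b u - P.bc (u - 1 / 2)))

/-- `e^-(z)`. -/
def eM (u : ℂ) : Op :=
  (-1 / (P.dq * P.z u)) •
    (P.nexp (P.bc (u - (P.k + 1) / 2) + P.fieldM .a (u - (P.k + 2) / 2 / 2)
        + P.fieldM .b (u - (P.k + 2) / 2))
      - P.nexp (P.bc (u + (P.k + 1) / 2) + P.fieldP .a (u + (P.k + 2) / 2 / 2)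
        + P.fieldP .b (u + (P.k + 2) / 2)))

/-- `U^+(z)`; the value of `b_-^*` at `q^{r* - 1} (q + q⁻¹) z` is the sum of its values at the two
points `q^{r*} z` and `q^{r* - 2} z`. -/
def UP (u : ℂ) : Op :=
  P.nexp (P.twistM .a (u + (P.rs + P.k / 2 - 1) / 2)
    + (P.twistM .b (u + P.rs / 2) + P.twistM .b (u + (P.rs - 2) / 2)))

/-- `U^-(z)`; the value of `b_+^*` at `q^{-(r - k - 1)} (q + q⁻¹) z` is the sum of its values at
the two points `q^{-(r - k - 1) + 1} z` and `q^{-(r - k - 1) - 1} z`. -/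
def UM (u : ℂ) : Op :=
  P.nexp (P.twistP .a (u - (P.r - P.k / 2 - 1) / 2)
    + (P.twistP .b (u + (-(P.r - P.k - 1) + 1) / 2)
      + P.twistP .b (u + (-(P.r - P.k - 1) - 1) / 2)))

/-- `Ψ^+(z)`. -/
def PsiP (u : ℂ) : Op :=
  opMul (opMul (P.UP (u + P.k / 2 / 2)) (P.psiP u)) (P.UM (u - P.k / 2 / 2))

/-- `Ψ^-(z)`. -/
def PsiM (u : ℂ) : Op :=
  opMul (opMul (P.UP (u - P.k / 2 / 2)) (P.psiM u)) (P.UM (u + P.k / 2 / 2))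

/-- `H^+(u) = Ψ^+(z) e^{2 q̂} (q^{-k/2} z)^{(2 p_b + p_a)/r}
(q^{r - k/2} z)^{(p̂ - 1)/r - (p̂ - 1)/r*}`. -/
def HP (u : ℂ) : Op :=
  opMul (P.PsiP u)
    (P.nexp ((2 : ℂ) • Qhat
      + (P.lnz (u - P.k / 2 / 2) / P.r) • ((2 : ℂ) • Pm .b + Pm .a)
      + (P.lnz (u + (P.r - P.k / 2) / 2) * (1 / P.r - 1 / P.rs)) • (Phat - One1)))

/-- `H^-(u) = Ψ^-(z) e^{2 q̂} (q^{k/2} z)^{(2 p_b + p_a)/r}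
(q^{-(r - k/2)} z)^{(p̂ - 1)/r - (p̂ - 1)/r*}`. -/
def HM (u : ℂ) : Op :=
  opMul (P.PsiM u)
    (P.nexp ((2 : ℂ) • Qhat
      + (P.lnz (u + P.k / 2 / 2) / P.r) • ((2 : ℂ) • Pm .b + Pm .a)
      + (P.lnz (u - (P.r - P.k / 2) / 2) * (1 / P.r - 1 / P.rs)) • (Phat - One1)))

/-- `E(u) = U^+(z) e^+(z) e^{2 q̂} z^{-(p̂ - 1)/r*}`. -/
def E (u : ℂ) : Op :=
  opMul (opMul (P.UP u) (P.eP u))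
    (P.nexp ((2 : ℂ) • Qhat - (P.lnz u / P.rs) • (Phat - One1)))

/-- `F(u) = e^-(z) U^-(z) z^{(2 p_b + p_a)/r} z^{(p̂ - 1)/r}`. -/
def F (u : ℂ) : Op :=
  opMul (opMul (P.eM u) (P.UM u))
    (P.nexp ((P.lnz u / P.r) • ((2 : ℂ) • Pm .b + Pm .a) + (P.lnz u / P.r) • (Phat - One1)))

/-! ### The screening currents -/

/-- `S_I(z)`. -/
def SI (u : ℂ) : Op :=
  P.nexp (P.field .c u 0 + (1 / 2 : ℂ) • Q .a + Q .b - (P.rs : ℂ) • Qhat)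

/-- The part of the exponent of `S_II(z)` in the boson `a`. -/
def SIIa (u : ℂ) : Lin :=
  P.genP .a [] [P.k + 2] u ((P.k + 2) / 2)
    - (1 / (P.k + 2) : ℂ) • (Q .a + P.lnz u • Pm .a)
    + P.genM .a [] [-(P.k + 2)] u (-((P.k + 2) / 2))

/-- `S_II(z)`. -/
def SII (u : ℂ) : Op :=
  (-1 / (P.dq * P.z u)) •
    (P.nexp (P.SIIa u + (-P.fieldM .b u - P.bc (u + 1 / 2)))
      - P.nexp (P.SIIa u + (-P.fieldP .b u - P.bc (u - 1 / 2))))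

/-- `s̃₁(z)`. -/
def s1 (u : ℂ) : Op :=
  P.nexp (P.genM .a [] [P.rs] u (P.r - P.k / 2 - 1) + (1 / 2 : ℂ) • Q .a
    + P.genM .b [-(P.r - P.k - 2)] [P.rs, 1] u (-1)
    - P.lnz u • Pm .b + P.genP .b [] [1] u (-1)
    + (2 - P.rs : ℂ) • Qhat - (P.lnz u / P.rs) • (Phat - One1))

/-- `s̃₂(z)`. -/
def s2 (u : ℂ) : Op :=
  P.nexp (P.genM .a [] [-(P.k + 2)] u ((P.k + 2) / 2)
    + P.genP .a [P.r - P.k - 2] [P.k + 2, P.r] u ((P.k + 2) / 2)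
    - (1 / (P.k + 2) : ℂ) • (Q .a + P.lnz u • Pm .a)
    - P.genP .b [2] [1, P.r] u (-(P.r - P.k - 1))
    + (P.lnz u / P.r) • ((2 : ℂ) • Pm .b + Pm .a + Phat - One1))

/-- `s̃₃(z)`. -/
def s3 (u : ℂ) : Op :=
  P.nexp (P.genM .a [] [-(P.k + 2)] u (-((P.k + 2) / 2))
    + P.genP .a [] [P.k + 2] u ((P.k + 2) / 2)
    + (1 / (2 * (P.k + 2)) : ℂ) • ((P.k : ℂ) • Q .a - (2 * P.lnz u) • Pm .a)
    - P.field .b u 1 + Q .b - (P.rs : ℂ) • Qhat)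

/-! ### Theta functions -/

/-- `(x; t)_∞`. -/
def qPoch (x t : ℂ) : ℂ := ∏' n : ℕ, (1 - x * t ^ n)

/-- `Θ_t(x)`. -/
def bigTheta (t x : ℂ) : ℂ := qPoch x t * qPoch (t * x⁻¹) t * qPoch t t

/-- `θ_ν(u) = q^{u²/ν - u} Θ_{q^{2ν}}(q^{2u}) / (q^{2ν}; q^{2ν})_∞³`. -/
def theta (ν : ℝ) (u : ℂ) : ℂ :=
  P.qp (u ^ 2 / ν - u) * bigTheta (P.qp (2 * ν)) (P.qp (2 * u))
    / qPoch (P.qp (2 * ν)) (P.qp (2 * ν)) ^ 3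

/-! ### Operator products -/

/-- The total `q`-difference `(f(q^n w) - f(q^{-n} w)) / ((q - q⁻¹) w)`, for a function of the
coordinate `v` of `w`. -/
def qDiff (n : ℝ) (f : ℂ → ℂ) (v : ℂ) : ℂ :=
  (f (v + n / 2) - f (v - n / 2)) / (P.dq * P.z v)

end Params

/-- Meromorphic functions on `ℂ²`, as quotients of entire functions. -/
structure Mero where
  num : ℂ × ℂ → ℂ
  den : ℂ × ℂ → ℂ
  num_entire : AnalyticOnNhd ℂ num Set.univ
  den_entire : AnalyticOnNhd ℂ den Set.univ
  den_ne_zero : ∃ p, den p ≠ 0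

/-- The value of a meromorphic function (where the denominator does not vanish). -/
def Mero.val (M : Mero) (p : ℂ × ℂ) : ℂ := M.num p / M.den p

namespace Params

variable (P : Params)

/-- In the region `|z| > R |w|` all the series for the matrix element `⟨i| X(z) Y(w) |j⟩`
converge absolutely, and their sum is (the restriction of) the meromorphic function `M` of the
coordinates `(u, v)` of `(z, w)`. -/
def LeftProduct (X Y : ℂ → Op) (R : ℝ) (i j : FockIndex) (M : Mero) : Prop :=
  ∀ u v : ℂ, R * ‖P.z v‖ < ‖P.z u‖ →
    ∃ s, HasSum (fun m => X u i m * Y v m j) s ∧ M.den (u, v) * s = M.num (u, v)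

/-- The same for `⟨i| Y(w) X(z) |j⟩` in the region `|w| > R |z|`. -/
def RightProduct (X Y : ℂ → Op) (R : ℝ) (i j : FockIndex) (M : Mero) : Prop :=
  ∀ u v : ℂ, R * ‖P.z u‖ < ‖P.z v‖ →
    ∃ s, HasSum (fun m => Y v i m * X u m j) s ∧ M.den (u, v) * s = M.num (u, v)

/-- `X(z) Y(w) = c(u, v) Y(w) X(z)`, as an identity between the meromorphic continuations of the
matrix elements. -/
def Exchange (X Y : ℂ → Op) (c : ℂ → ℂ → ℂ) (dom : Set (ℂ × ℂ)) : Prop :=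
  ∃ R : ℝ, 0 < R ∧ ∀ i j : FockIndex, ∃ M M' : Mero,
    P.LeftProduct X Y R i j M ∧ P.RightProduct X Y R i j M' ∧
    ∀ p ∈ dom, M.den p ≠ 0 → M'.den p ≠ 0 → M.val p = c p.1 p.2 * M'.val p

/-- `X(z) Y(w) = ε Y(w) X(z) = D(z, w) + O(1)`: the meromorphic continuations of the matrix
elements of `X(z) Y(w)` and of `ε Y(w) X(z)` are equal, and their difference with `D(z, w)` is
holomorphic on `reg`. -/
def OPE (X Y : ℂ → Op) (ε : ℂ) (D : ℂ → ℂ → Op) (reg : Set (ℂ × ℂ)) : Prop :=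
  ∃ R : ℝ, 0 < R ∧ ∀ i j : FockIndex, ∃ M M' : Mero,
    P.LeftProduct X Y R i j M ∧ P.RightProduct X Y R i j M' ∧
    (∀ p, M.den p ≠ 0 → M'.den p ≠ 0 → M.val p = ε * M'.val p) ∧
    ∃ G : ℂ × ℂ → ℂ, AnalyticOnNhd ℂ G reg ∧
      ∀ p ∈ reg, M.den p ≠ 0 → M.val p = D p.1 p.2 i j + G p

/-- `X(z) Y(w) = ε Y(w) X(z) = O(1)`: no singularity at all. -/
def RegularOPE (X Y : ℂ → Op) (ε : ℂ) : Prop := P.OPE X Y ε 0 Set.univ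

/-- The total `q`-difference `ₙ∂_w [(z - w)⁻¹ s(z)]`. -/
def totalDiff (n : ℝ) (s : ℂ → Op) (u v : ℂ) : Op := fun i j =>
  P.qDiff n (fun v' => (P.z u - P.z v')⁻¹ * s u i j) v

/-- All pairs `(u, v)` except those at which `w = q^{± n} z` holds but
`ln w = ln z ± n ln q` does not.  (The fields contain complex powers of `w`, and an expansion at
`w = q^{± n} z` refers to the determination `ln (q^{± n} z) = ln z ± n ln q`.) -/
def principal (n : ℝ) : Set (ℂ × ℂ) :=
  {p | (P.z p.2 = P.qp n * P.z p.1 → p.2 = p.1 + n / 2) ∧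
    (P.z p.2 = P.qp (-n) * P.z p.1 → p.2 = p.1 - n / 2)}

/-- `X(z) Y(w) = ε Y(w) X(z) = ₙ∂_w [(z - w)⁻¹ s(z)] + O(1)`. -/
def DiffOPE (X Y : ℂ → Op) (ε : ℂ) (n : ℝ) (s : ℂ → Op) : Prop :=
  P.OPE X Y ε (P.totalDiff n s) (P.principal n)

end Params

end ScreeningCurrents

end

open ScreeningCurrents

/-! Every current is a combination, with coefficients proportional to 1/z or constant, of one or two
normal ordered exponentials of linear forms in the modes, here called vertex operators (`Vtx`). The
whole theorem rests on Wick's formula `hasSum_nexp_mul`: the product of `:exp X:` and `:exp Y:` is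
`:exp (X + Y):` times the exponential of the contraction, that is, of the commutator of the
annihilation part of X with the creation part of Y. Since all q-numbers and their inverses grow at
most geometrically in n (`GeoBdd`), the contraction converges absolutely once |z| exceeds a multiple
of |w|; this gives a radius independent of the matrix element.

The normal ordered product is symmetric in its two factors and its matrix elements are exponential
polynomials in (u, v) (`isExpPoly_normalProduct`), so the two orders of a product differ only in a
scalar factor. For every pair except S_II with itself, the oscillator contraction is (α^n - β^n)/n
and the zero modes contribute an integral power of z, because the terms in 1/r, 1/r* and 1/(k+2)
cancel. The factor is then rational, of the form q^c z^l (z - βw)/(z - αw) (`exists_factor`), and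
reversing the order reproduces it up to the sign ε.

What remains is to examine the simple poles. There are none for H with S_I or S_II, for F with S_I,
and for S_I with itself. For E with S_II the pole at z = w cancels between the two mixed terms. For
E and S_II with S_I, and for F with S_II, there is one pole at w = q^n z and one at w = q^{-n} z.
There the exponents of the two factors add up to the exponent of a single vertex operator s̃(z)
(`Vtx.lin_add`), and the residues are those of the total difference of s̃(z)/(z - w). After
subtraction the numerator over each pole vanishes on the line v = u ± n/2, hence is divisible by v -
u ∓ n/2 (`exists_sub_eq_mul`), and the singularity along that line is removable. The fusion uses ln
w = ln z ± n ln q, which is why the other sheets of w = q^{±n} z are excluded.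

For S_II with itself the contraction has the denominator 1 - q^{2(k+2)n}. For k > -2 it sums to a
quotient of infinite products of base q^{2(k+2)} times a rational part that is antisymmetric up to
the factor z/w; comparing the two orders produces the quotient of theta functions
(`exchange_SII_SII`). -/

noncomputable section

namespace ScreeningCurrents

open Finset Filter Topology

/-! ### Divided powers and the multinomial formula -/

section DividedPowers

variable {ι : Type*} {A : Type*} [CommRing A] [Algebra ℂ A]

/-- The product of the divided powers `α x ^ e / e!`. -/
def divPow (α : ι → A) (n : ι →₀ ℕ) : A :=
  n.prod fun x e => ((e.factorial : ℂ)⁻¹) • α x ^ e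

theorem divPow_eq_prod (α : ι → A) {n : ι →₀ ℕ} {s : Finset ι} (h : n.support ⊆ s) :
    divPow α n = ∏ x ∈ s, (((n x).factorial : ℂ)⁻¹) • α x ^ (n x) :=
  Finsupp.prod_of_support_subset _ h _ (by simp)

theorem divPow_add_single (a b : A) (n : ℕ) :
    ((n.factorial : ℂ)⁻¹) • (a + b) ^ n
      = ∑ p ∈ antidiagonal n, (((p.1.factorial : ℂ)⁻¹) • a ^ p.1) *
          (((p.2.factorial : ℂ)⁻¹) • b ^ p.2) := by
  rw [(Commute.all a b).add_pow', smul_sum]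
  refine sum_congr rfl fun p hp => ?_
  rw [← HasAntidiagonal.mem_antidiagonal.1 hp, smul_mul_smul_comm, ← Nat.cast_smul_eq_nsmul ℂ, smul_smul]
  congr 1
  rw [← Nat.add_choose_mul_factorial_mul_factorial p.1 p.2]
  have h1 : ((p.1.factorial : ℕ) : ℂ) ≠ 0 := by exact_mod_cast p.1.factorial_ne_zero
  have h2 : ((p.2.factorial : ℕ) : ℂ) ≠ 0 := by exact_mod_cast p.2.factorial_ne_zero
  have h3 : (((p.1 + p.2).choose p.1 : ℕ) : ℂ) ≠ 0 := by
    exact_mod_cast (Nat.choose_pos (Nat.le_add_right _ _)).ne'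
  push_cast
  field_simp
  rw [Nat.choose_symm_add, div_self (by rwa [Nat.choose_symm_add] at h3)]

/-- The binomial theorem holds in each coordinate. Expanding the product over the support means
choosing a splitting of `n x` for every `x`, and such a choice is the same as a splitting of `n`
itself. -/
theorem divPow_add [DecidableEq ι] (α β : ι → A) (n : ι →₀ ℕ) :
    divPow (α + β) n = ∑ p ∈ antidiagonal n, divPow α p.1 * divPow β p.2 := by
  have hsub : ∀ p ∈ antidiagonal n, p.1.support ⊆ n.support ∧ p.2.support ⊆ n.support := by
    intro p hp
    have h := HasAntidiagonal.mem_antidiagonal.1 hp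
    constructor <;> intro x hx <;> rw [Finsupp.mem_support_iff] at * <;> rw [← h] <;>
      simp <;> omega
  rw [divPow_eq_prod _ (Subset.refl n.support)]
  simp only [Pi.add_apply, divPow_add_single]
  rw [prod_sum]
  symm
  refine sum_bij' (fun p _ => fun x _ => (p.1 x, p.2 x))
    (fun g hg => (Finsupp.onFinset n.support
        (fun x => if h : x ∈ n.support then (g x h).1 else 0) (by intro x hx; by_contra h; simp_all),
      Finsupp.onFinset n.support
        (fun x => if h : x ∈ n.support then (g x h).2 else 0) (by intro x hx; by_contra h; simp_all)))
    ?_ ?_ ?_ ?_ ?_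
  · intro p hp
    rw [Finset.mem_pi]
    intro x _
    rw [HasAntidiagonal.mem_antidiagonal, ← HasAntidiagonal.mem_antidiagonal.1 hp]; rfl
  · intro g hg
    rw [HasAntidiagonal.mem_antidiagonal]
    ext x
    rw [Finset.mem_pi] at hg
    by_cases h : x ∈ n.support
    · have := HasAntidiagonal.mem_antidiagonal.1 (hg x h)
      simp only [Finsupp.add_apply, Finsupp.onFinset_apply, dif_pos h, this]
    · simp only [Finsupp.add_apply, Finsupp.onFinset_apply, dif_neg h]
      simp at h; omega
  · intro p hp
    obtain ⟨h1, h2⟩ := hsub p hp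
    ext x
    · by_cases h : x ∈ n.support
      · simp only [Finsupp.onFinset_apply, dif_pos h]
      · simp only [Finsupp.onFinset_apply, dif_neg h]
        exact (Finsupp.notMem_support_iff.1 fun h' => h (h1 h')).symm
    · by_cases h : x ∈ n.support
      · simp only [Finsupp.onFinset_apply, dif_pos h]
      · simp only [Finsupp.onFinset_apply, dif_neg h]
        exact (Finsupp.notMem_support_iff.1 fun h' => h (h2 h')).symm
  · intro g hg
    funext x h
    simp only [Finsupp.onFinset_apply, dif_pos h]
  · intro p hp
    obtain ⟨h1, h2⟩ := hsub p hp
    rw [divPow_eq_prod _ h1, divPow_eq_prod _ h2, ← prod_mul_distrib,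
      ← prod_attach n.support]

end DividedPowers

/-! ### The exponential of a convergent sum of commuting variables -/

section ExpSeries

variable {ι : Type*}

/-- Induction on `T`: adjoining an index multiplies the sum by one more exponential series. The
field is a parameter because the real version, applied to norms, supplies the domination in
`hasSum_divPow`. -/
theorem hasSum_divPow_finset (𝕜 : Type*) [RCLike 𝕜] [DecidableEq ι] (c : ι → 𝕜) (T : Finset ι) :
    HasSum (fun k : ι →₀ ℕ => if k.support ⊆ T then k.prod fun x e => c x ^ e / (e.factorial : 𝕜)
      else 0) (NormedSpace.exp (∑ x ∈ T, c x)) := by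
  induction T using Finset.induction_on with
  | empty =>
    simp only [subset_empty, Finsupp.support_eq_empty, sum_empty, NormedSpace.exp_zero]
    convert hasSum_ite_eq (0 : ι →₀ ℕ) (1 : 𝕜) using 2 with k
    split_ifs with h
    · simp [h]
    · rfl
  | insert y T hy ih =>
    rw [sum_insert hy, NormedSpace.exp_add_of_commute (Commute.all _ _)]
    have h1 : HasSum (fun e : ℕ => c y ^ e / (e.factorial : 𝕜)) (NormedSpace.exp (c y)) :=
      NormedSpace.expSeries_div_hasSum_exp (c y)
    have hs := summable_mul_of_summable_norm h1.summable.norm ih.summable.norm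
    have hm := HasSum.mul h1 ih hs
    -- A pair (e, k) corresponds to the multi-index with value e at y and equal to k elsewhere. This
    -- is a bijection only where the summand is nonzero, since there k is supported in `T` and so
    -- vanishes at y.
    refine (hasSum_iff_hasSum_of_ne_zero_bij
      (fun p => Finsupp.single y p.1.1 + p.1.2) ?_ ?_ ?_).2 hm
    · have key : ∀ p : Function.support (fun x : ℕ × (ι →₀ ℕ) => c y ^ x.1 / (x.1.factorial : 𝕜) *
          if x.2.support ⊆ T then x.2.prod fun x e => c x ^ e / (e.factorial : 𝕜) else 0),
          p.1.2 y = 0 := by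
        intro p
        have hp := p.2
        rw [Function.mem_support] at hp
        by_contra h
        apply hp
        rw [if_neg, mul_zero]
        intro hs
        exact hy (hs (Finsupp.mem_support_iff.2 h))
      intro p p' h
      have hp := key p
      have hp' := key p'
      have e1 : p.1.1 = p'.1.1 := by
        have := DFunLike.congr_fun h y
        simpa [hp, hp'] using this
      have e2 : p.1.2 = p'.1.2 := by
        simpa [e1] using h
      exact Subtype.ext (Prod.ext e1 e2)
    · intro k hk
      rw [Function.mem_support] at hk
      have hs : k.support ⊆ insert y T := by
        by_contra h; exact hk (if_neg h)
      rw [if_pos hs] at hk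
      have hes : (k.erase y).support ⊆ T := by
        rw [Finsupp.support_erase]
        intro x hx
        rw [mem_erase] at hx
        exact (mem_insert.1 (hs hx.2)).resolve_left hx.1
      have hsplit := Finsupp.mul_prod_erase' k y (fun x e => c x ^ e / (e.factorial : 𝕜)) (by simp)
      refine ⟨⟨(k y, k.erase y), ?_⟩, Finsupp.single_add_erase y k⟩
      rw [Function.mem_support]
      simp only [if_pos hes]
      rwa [hsplit]
    · rintro ⟨⟨e, k⟩, hp⟩
      rw [Function.mem_support] at hp
      have hs : k.support ⊆ T := by
        by_contra h; apply hp; simp only [if_neg h, mul_zero]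
      have hky : k y = 0 := Finsupp.notMem_support_iff.1 fun h => hy (hs h)
      have hs' : (Finsupp.single y e + k).support ⊆ insert y T := by
        refine Finsupp.support_add.trans (union_subset ?_ (hs.trans (subset_insert _ _)))
        exact Finsupp.support_single_subset.trans (by simp)
      simp only [if_pos hs, if_pos hs']
      rw [← Finsupp.mul_prod_erase' (Finsupp.single y e + k) y
        (fun x e => c x ^ e / (e.factorial : 𝕜)) (by simp)]
      have : (Finsupp.single y e + k).erase y = k := by
        rw [Finsupp.erase_add, Finsupp.erase_single, zero_add]
        exact Finsupp.erase_of_notMem_support (Finsupp.notMem_support_iff.2 hky)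
      rw [this]
      simp [hky]

/-- The partial sums of norms are at most exp(∑ ‖c x‖), so the family is absolutely summable. By
dominated convergence its sum is the limit, over finite sets T, of the sums over multi-indices
supported in T, which are exp(∑_T c x). -/
theorem hasSum_divPow (c : ι → ℂ) (hc : Summable c) :
    HasSum (fun k : ι →₀ ℕ => k.prod fun x e => c x ^ e / (e.factorial : ℂ))
      (Complex.exp (∑' x, c x)) := by
  classical
  set f : (ι →₀ ℕ) → ℂ := fun k => k.prod fun x e => c x ^ e / (e.factorial : ℂ) with hf
  have hnorm : ∀ k, ‖f k‖ = k.prod fun x e => ‖c x‖ ^ e / (e.factorial : ℝ) := by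
    intro k
    simp [hf, Finsupp.prod, norm_prod]
  have hs : Summable fun k => ‖f k‖ := by
    refine summable_of_sum_le (c := NormedSpace.exp (∑' x, ‖c x‖)) (fun k => norm_nonneg _) ?_
    intro u
    set T : Finset ι := u.biUnion fun k => k.support
    have hT := hasSum_divPow_finset ℝ (fun x => ‖c x‖) T
    have hle : ∑ k ∈ u, ‖f k‖ ≤ NormedSpace.exp (∑ x ∈ T, ‖c x‖) := by
      refine le_trans (le_of_eq ?_) (sum_le_hasSum u ?_ hT)
      · refine sum_congr rfl fun k hk => ?_
        rw [hnorm, if_pos (subset_biUnion_of_mem (fun k : ι →₀ ℕ => k.support) hk)]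
      · intro k _
        split_ifs
        · exact prod_nonneg fun x _ => by positivity
        · exact le_rfl
    refine hle.trans ?_
    rw [← Real.exp_eq_exp_ℝ]
    exact Real.exp_le_exp.2 (hc.norm.sum_le_tsum T fun _ _ => norm_nonneg _)
  have h1 : Tendsto (fun T : Finset ι => ∑' k, if k.support ⊆ T then f k else 0) atTop
      (𝓝 (∑' k, f k)) := by
    refine tendsto_tsum_of_dominated_convergence hs ?_ ?_
    · intro k
      refine tendsto_const_nhds.congr' ?_
      filter_upwards [eventually_ge_atTop k.support] with T hT
      rw [if_pos hT]
    · refine Eventually.of_forall fun T k => ?_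
      split_ifs <;> simp
  have h2 : Tendsto (fun T : Finset ι => ∑' k, if k.support ⊆ T then f k else 0) atTop
      (𝓝 (Complex.exp (∑' x, c x))) := by
    have : (fun T : Finset ι => ∑' k, if k.support ⊆ T then f k else 0)
        = fun T => Complex.exp (∑ x ∈ T, c x) := by
      funext T
      rw [Complex.exp_eq_exp_ℂ]
      exact (hasSum_divPow_finset ℂ c T).tsum_eq
    rw [this]
    exact (Complex.continuous_exp.tendsto _).comp hc.hasSum
  rw [← tendsto_nhds_unique h1 h2]
  exact hs.of_norm.hasSum

end ExpSeries

end ScreeningCurrents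

end

noncomputable section

namespace ScreeningCurrents

open Finset

/-! ### Products of normal ordered exponentials -/

theorem hasSum_of_eq {ι : Type*} {f g : ι → ℂ} {a b : ℂ} (h : HasSum f a) (hf : ∀ x, g x = f x)
    (ha : b = a) : HasSum g b := by
  rw [ha, funext hf]
  exact h

namespace Params

theorem expCreate_apply (α : Mode → ℂ) (n : Mode →₀ ℕ) :
    MvPowerSeries.coeff n (expCreate α) = divPow α n := by
  rw [MvPowerSeries.coeff_apply]
  refine prod_congr rfl fun x _ => ?_
  simp only [smul_eq_mul, div_eq_inv_mul]

theorem expCreate_add (α β : Mode → ℂ) : expCreate (α + β) = expCreate α * expCreate β := by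
  classical
  ext n
  simp only [MvPowerSeries.coeff_mul, expCreate_apply, divPow_add]

end Params

theorem divPow_mul (c α : Mode → ℂ) (n : Mode →₀ ℕ) :
    n.prod (fun x e => (c x * α x) ^ e / (e.factorial : ℂ))
      = n.prod (fun x e => c x ^ e) * divPow α n := by
  rw [divPow, ← Finsupp.prod_mul]
  refine prod_congr rfl fun x _ => ?_
  simp only [smul_eq_mul, mul_pow]
  field_simp

theorem prod_pow_add (α : Mode → ℂ) (m n : Mode →₀ ℕ) :
    (m + n).prod (fun x e => α x ^ e) = m.prod (fun x e => α x ^ e) * n.prod fun x e => α x ^ e := by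
  classical
  exact Finsupp.prod_add_index' (by simp) (by simp [pow_add])

namespace Params

variable (P : Params)

theorem expAnnih_comp (β β' : Mode → ℂ) (f : Osc) :
    P.expAnnih β (P.expAnnih β' f) = P.expAnnih (β + β') f := by
  have : (P.expAnnih β).comp (P.expAnnih β') = P.expAnnih (β + β') := by
    refine MvPolynomial.algHom_ext fun x => ?_
    simp [expAnnih]
    ring
  exact DFunLike.congr_fun this f

/-- `expAnnih` translates the variables, so it sends x^n/n! to the divided power of a sum, which
`divPow_add` expands. Weighting by α^n prepares the summation over n. -/
theorem expAnnih_monomial (β α : Mode → ℂ) (n : Mode →₀ ℕ) :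
    divPow α n • P.expAnnih β (MvPolynomial.monomial n 1)
      = n.prod (fun x e => α x ^ e) • ∑ p ∈ antidiagonal n,
          MvPolynomial.monomial p.1 (divPow (1 : Mode → ℂ) p.1 *
            divPow (fun x => β x * P.kappa x) p.2) := by
  classical
  have h1 : ∀ (γ : Mode → ℂ) (m : Mode →₀ ℕ),
      divPow (fun x => (MvPolynomial.C (γ x) : Osc)) m = MvPolynomial.C (divPow γ m) := by
    intro γ m
    simp only [divPow, Finsupp.prod, map_prod, MvPolynomial.smul_eq_C_mul, smul_eq_mul, map_mul,
      map_pow]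
  have h2 : ∀ m : Mode →₀ ℕ, divPow (fun x => (MvPolynomial.X x : Osc)) m
      = MvPolynomial.monomial m (divPow (1 : Mode → ℂ) m) := by
    intro m
    rw [MvPolynomial.monomial_eq, divPow, divPow, Finsupp.prod, Finsupp.prod, Finsupp.prod,
      map_prod, ← prod_mul_distrib]
    refine prod_congr rfl fun x _ => ?_
    rw [MvPolynomial.smul_eq_C_mul]
    simp
  have h3 : divPow (1 : Mode → ℂ) n • P.expAnnih β (MvPolynomial.monomial n 1)
      = divPow ((fun x => (MvPolynomial.X x : Osc)) +
          fun x => MvPolynomial.C (β x * P.kappa x)) n := by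
    rw [MvPolynomial.monomial_eq, map_one, one_mul, Finsupp.prod, map_prod, divPow, divPow,
      Finsupp.prod, Finsupp.prod, ← prod_smul]
    refine prod_congr rfl fun x _ => ?_
    simp [expAnnih]
  have h4 : divPow α n = n.prod (fun x e => α x ^ e) * divPow (1 : Mode → ℂ) n := by
    simp only [divPow, ← Finsupp.prod_mul]
    refine prod_congr rfl fun x _ => ?_
    simp [mul_comm]
  rw [h4, mul_smul, h3, divPow_add]
  congr 1
  refine sum_congr rfl fun p _ => ?_
  rw [h1, h2, mul_comm, MvPolynomial.C_mul_monomial, mul_comm]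

/-- Coefficientwise form of exp(β·annihilation) exp(α·creation) = exp(βκα) exp(α·creation). Only n ≥
i contributes, with the term α^i/i! · (βκα)^(n-i)/(n-i)!, so the sum over n - i is an exponential
series. -/
theorem hasSum_expAnnih_monomial (β α : Mode → ℂ) (h : Summable fun x => β x * P.kappa x * α x)
    (i : Mode →₀ ℕ) :
    HasSum (fun n => MvPolynomial.coeff i (P.expAnnih β (MvPolynomial.monomial n 1)) * divPow α n)
      (Complex.exp (∑' x, β x * P.kappa x * α x) * divPow α i) := by
  classical
  set c : Mode → ℂ := fun x => β x * P.kappa x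
  have hterm : ∀ n, MvPolynomial.coeff i (P.expAnnih β (MvPolynomial.monomial n 1)) * divPow α n
      = if i ≤ n then divPow α i * (n - i).prod (fun x e => (c x * α x) ^ e / (e.factorial : ℂ))
        else 0 := by
    intro n
    rw [mul_comm, ← smul_eq_mul, ← MvPolynomial.coeff_smul, P.expAnnih_monomial,
      MvPolynomial.coeff_smul, MvPolynomial.coeff_sum]
    simp only [MvPolynomial.coeff_monomial]
    have hval : ∀ p ∈ antidiagonal n, (if p.1 = i then divPow (1 : Mode → ℂ) p.1 * divPow c p.2
        else 0) = if p = (i, n - i) then divPow (1 : Mode → ℂ) i * divPow c (n - i) else 0 := by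
      rintro ⟨a, b⟩ hp
      have hab := HasAntidiagonal.mem_antidiagonal.1 hp
      by_cases ha : a = i
      · subst ha
        have : b = n - a := by rw [← hab]; simp
        simp [this]
      · rw [if_neg ha, if_neg]
        intro h; exact ha (Prod.ext_iff.1 h).1
    rw [sum_congr rfl hval, sum_ite_eq']
    by_cases hin : i ≤ n
    · have hn : i + (n - i) = n := add_tsub_cancel_of_le hin
      rw [if_pos (HasAntidiagonal.mem_antidiagonal.2 hn), if_pos hin]
      conv_lhs => rw [← hn]
      rw [prod_pow_add, add_tsub_cancel_left, smul_eq_mul]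
      have e1 : divPow α i = i.prod (fun x e => α x ^ e) * divPow (1 : Mode → ℂ) i := by
        simp only [divPow, ← Finsupp.prod_mul]
        refine prod_congr rfl fun x _ => ?_
        simp [mul_comm]
      have e2 := divPow_mul α c (n - i)
      simp only [mul_comm (α _)] at e2
      rw [e1, e2]
      ring
    · rw [if_neg, if_neg hin, smul_zero]
      intro h
      exact hin (by rw [← HasAntidiagonal.mem_antidiagonal.1 h]; exact le_self_add)
  simp only [hterm]
  refine ((add_right_injective i).hasSum_iff ?_).1 ?_
  · intro n hn
    rw [if_neg]
    intro h
    exact hn ⟨n - i, add_tsub_cancel_of_le h⟩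
  · have := (hasSum_divPow (fun x => c x * α x) h).mul_left (divPow α i)
    rw [mul_comm (divPow α i)] at this
    refine this.congr_fun ?_ 
    intro k
    simp

/-- The commutator of the zero modes of the left factor with those of the right factor. -/
def zeroPair (X Y : Lin) : ℂ :=
  2 * (P.k + 2) * X (.pz .a) * Y (.qz .a) - X (.pz .b) * Y (.qz .b) + X (.pz .c) * Y (.qz .c)
    - X .phat * Y .qhat

theorem shift_add (X Y : Lin) (w : Weight) : P.shift (X + Y) w = P.shift X (P.shift Y w) := by
  ext <;> simp [shift] <;> ring

/-- The zero modes p of X act on a weight already shifted by Y; the resulting surplus is `zeroPair`.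
-/
theorem momentum_add (X Y : Lin) (w : Weight) :
    momentum (X + Y) w + P.zeroPair X Y = momentum X (P.shift Y w) + momentum Y w := by
  simp [momentum, zeroPair, shift]
  ring

/-- The oscillator part of the matrix elements of a normal ordered exponential. -/
def oscElt (P : Params) (X : Lin) (i j : Mode →₀ ℕ) : ℂ :=
  MvPowerSeries.coeff i
    (expCreate (fun x => X (.osc x.1 (-(x.2 : ℤ)))) *
      (P.expAnnih (fun x => X (.osc x.1 (x.2 : ℤ))) (MvPolynomial.monomial j 1) :
        MvPowerSeries Mode ℂ))

/-- Wick's formula for the oscillators: the annihilation part of X is moved past the creation part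
of Y at the cost of the exponential of their commutator. The series over intermediate states is
reduced to `hasSum_expAnnih_monomial` by finitely many convolutions. -/
theorem hasSum_oscElt_mul (X Y : Lin)
    (h : Summable fun x : Mode => X (.osc x.1 (x.2 : ℤ)) * P.kappa x * Y (.osc x.1 (-(x.2 : ℤ))))
    (i j : Mode →₀ ℕ) :
    HasSum (fun m => P.oscElt X i m * P.oscElt Y m j)
      (Complex.exp (∑' x : Mode, X (.osc x.1 (x.2 : ℤ)) * P.kappa x * Y (.osc x.1 (-(x.2 : ℤ))))
        * P.oscElt (X + Y) i j) := by
  classical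
  set S := Complex.exp (∑' x : Mode, X (.osc x.1 (x.2 : ℤ)) * P.kappa x *
    Y (.osc x.1 (-(x.2 : ℤ))))
  set β : Mode → ℂ := fun x => X (.osc x.1 (x.2 : ℤ))
  set α : Mode → ℂ := fun x => Y (.osc x.1 (-(x.2 : ℤ)))
  set α' : Mode → ℂ := fun x => X (.osc x.1 (-(x.2 : ℤ)))
  set β' : Mode → ℂ := fun x => Y (.osc x.1 (x.2 : ℤ))
  have hXY : P.oscElt (X + Y) i j = MvPowerSeries.coeff i (expCreate α' *
      (expCreate α * (P.expAnnih β (P.expAnnih β' (MvPolynomial.monomial j 1)) :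
        MvPowerSeries Mode ℂ))) := by
    rw [← mul_assoc, ← expCreate_add, expAnnih_comp]
    rfl
  rw [hXY]
  change HasSum (fun m => P.oscElt X i m * MvPowerSeries.coeff m (expCreate α *
    (P.expAnnih β' (MvPolynomial.monomial j 1) : MvPowerSeries Mode ℂ))) _
  -- Both sides are linear in the polynomial left after the annihilation part of Y has acted, so it
  -- suffices to treat a monomial.
  generalize P.expAnnih β' (MvPolynomial.monomial j 1) = p
  induction p using MvPolynomial.induction_on' with
  | monomial e a =>
    have h1 : ∀ m, MvPowerSeries.coeff m (expCreate α *
        ((MvPolynomial.monomial e a : Osc) : MvPowerSeries Mode ℂ))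
        = if e ≤ m then divPow α (m - e) * a else 0 := by
      intro m
      rw [MvPolynomial.coe_monomial, MvPowerSeries.coeff_mul_monomial, expCreate_apply]
    simp only [h1]
    refine ((add_left_injective e).hasSum_iff ?_).1 ?_
    · intro m hm
      rw [if_neg, mul_zero]
      intro h
      exact hm ⟨m - e, tsub_add_cancel_of_le h⟩
    -- An intermediate monomial is the fixed monomial e times a monomial n created by Y. Translation
    -- of variables is multiplicative, so only the factor n enters the infinite sum.
    have h2 : ∀ n, P.oscElt X i (n + e) = ∑ q ∈ antidiagonal i,
        MvPowerSeries.coeff q.1 (expCreate α' *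
          (P.expAnnih β (MvPolynomial.monomial e 1) : MvPowerSeries Mode ℂ)) *
        MvPolynomial.coeff q.2 (P.expAnnih β (MvPolynomial.monomial n 1)) := by
      intro n
      have : (MvPolynomial.monomial (n + e) 1 : Osc)
          = MvPolynomial.monomial e 1 * MvPolynomial.monomial n 1 := by
        rw [MvPolynomial.monomial_mul, add_comm, one_mul]
      rw [oscElt, this, map_mul (P.expAnnih _), MvPolynomial.coe_mul, ← mul_assoc,
        MvPowerSeries.coeff_mul]
      rfl
    have h3 : MvPowerSeries.coeff i (expCreate α' * (expCreate α *
        (P.expAnnih β (MvPolynomial.monomial e a) : MvPowerSeries Mode ℂ)))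
        = ∑ q ∈ antidiagonal i, MvPowerSeries.coeff q.1 (expCreate α' *
          (P.expAnnih β (MvPolynomial.monomial e 1) : MvPowerSeries Mode ℂ)) *
          (a * divPow α q.2) := by
      have : (MvPolynomial.monomial e a : Osc) = a • MvPolynomial.monomial e 1 := by
        rw [MvPolynomial.smul_monomial, smul_eq_mul, mul_one]
      rw [this, map_smul, MvPolynomial.coe_smul, mul_smul_comm, mul_smul_comm,
        MvPowerSeries.coeff_smul, mul_comm (expCreate α), ← mul_assoc, MvPowerSeries.coeff_mul,
        mul_sum]
      refine sum_congr rfl fun q _ => ?_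
      rw [expCreate_apply]
      ring
    rw [h3, mul_sum]
    simp only [Function.comp_def, h2, sum_mul, le_add_iff_nonneg_left, zero_le, if_true,
      add_tsub_cancel_right]
    refine hasSum_sum fun q _ => ?_
    have h4 := ((P.hasSum_expAnnih_monomial β α h q.2).mul_left
      (MvPowerSeries.coeff q.1 (expCreate α' *
          (P.expAnnih β (MvPolynomial.monomial e 1) : MvPowerSeries Mode ℂ)))).mul_right a
    refine hasSum_of_eq h4 (fun n => by ring) ?_
    simp only [S, β, α]
    ring
  | add p q hp hq =>
    have := hp.add hq
    simp only [MvPolynomial.coe_add, mul_add, map_add]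
    exact this

open Classical in
theorem nexp_apply (X : Lin) (i j : FockIndex) :
    P.nexp X i j = if i.1 = P.shift X j.1 then
      Complex.exp (momentum X j.1) * P.oscElt X i.2 j.2 else 0 := by
  unfold nexp oscElt
  split_ifs <;> rfl

/-- Wick's formula with the zero modes included: every operator product in the theorem is computed
from it. -/
theorem hasSum_nexp_mul (X Y : Lin)
    (h : Summable fun x : Mode => X (.osc x.1 (x.2 : ℤ)) * P.kappa x * Y (.osc x.1 (-(x.2 : ℤ))))
    (i j : FockIndex) :
    HasSum (fun m => P.nexp X i m * P.nexp Y m j)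
      (Complex.exp (P.zeroPair X Y +
          ∑' x : Mode, X (.osc x.1 (x.2 : ℤ)) * P.kappa x * Y (.osc x.1 (-(x.2 : ℤ))))
        * P.nexp (X + Y) i j) := by
  -- Only intermediate vectors of the single weight `P.shift Y j.1` contribute, so the sum over the
  -- Fock basis is a sum over oscillator monomials.
  have hinj : Function.Injective fun m : Mode →₀ ℕ => ((P.shift Y j.1, m) : FockIndex) :=
    fun a b hab => (Prod.ext_iff.1 hab).2
  refine (hinj.hasSum_iff ?_).1 ?_
  · intro m hm
    rw [P.nexp_apply Y, if_neg, mul_zero]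
    intro h
    exact hm ⟨m.2, Prod.ext h.symm rfl⟩
  · by_cases hi : i.1 = P.shift (X + Y) j.1
    · have hi' := hi
      rw [shift_add] at hi'
      have := (P.hasSum_oscElt_mul X Y h i.2 j.2).mul_left
        (Complex.exp (momentum X (P.shift Y j.1)) * Complex.exp (momentum Y j.1))
      refine hasSum_of_eq this (fun m => ?_) ?_
      · simp only [Function.comp_apply, nexp_apply, if_pos hi', if_true]
        ring
      · rw [nexp_apply, if_pos hi, ← Complex.exp_add (momentum X _), ← momentum_add,
          Complex.exp_add, Complex.exp_add]
        ring
    · have hi' := hi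
      rw [shift_add] at hi'
      rw [P.nexp_apply (X + Y), if_neg hi, mul_zero]
      convert hasSum_zero using 2 with m
      simp only [Function.comp_def]
      rw [P.nexp_apply X, if_neg hi', zero_mul]

/-- No contraction between the annihilation modes of `X` and the creation modes of `Y`. -/
def NoContr (X Y : Lin) : Prop :=
  ∀ x : Mode, X (.osc x.1 (x.2 : ℤ)) * Y (.osc x.1 (-(x.2 : ℤ))) = 0

theorem hasSum_nexp_mul_of_noContr {X Y : Lin} (h : P.zeroPair X Y = 0) (h' : NoContr X Y)
    (i j : FockIndex) :
    HasSum (fun m => P.nexp X i m * P.nexp Y m j) (P.nexp (X + Y) i j) := by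
  have h0 : ∀ x : Mode, X (.osc x.1 (x.2 : ℤ)) * P.kappa x * Y (.osc x.1 (-(x.2 : ℤ))) = 0 := by
    intro x
    rw [mul_right_comm, h' x, zero_mul]
  have := P.hasSum_nexp_mul X Y (by simp only [h0]; exact summable_zero) i j
  simpa [h, h0] using this

/-- Without a contraction the product is already normal ordered. This is what fuses the several
factors in the definitions of H, E and F. -/
theorem opMul_nexp {X Y : Lin} (h : P.zeroPair X Y = 0) (h' : NoContr X Y) :
    opMul (P.nexp X) (P.nexp Y) = P.nexp (X + Y) := by
  funext i j
  exact (P.hasSum_nexp_mul_of_noContr h h' i j).tsum_eq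

theorem opMul_nexp_sub {X Y Z : Lin} (c : ℂ) (h : P.zeroPair X Y = 0) (h' : NoContr X Y)
    (g : P.zeroPair X Z = 0) (g' : NoContr X Z) :
    opMul (P.nexp X) (c • (P.nexp Y - P.nexp Z)) = c • (P.nexp (X + Y) - P.nexp (X + Z)) := by
  funext i j
  have := ((P.hasSum_nexp_mul_of_noContr h h' i j).sub
    (P.hasSum_nexp_mul_of_noContr g g' i j)).mul_left c
  refine HasSum.tsum_eq ?_
  refine hasSum_of_eq this (fun m => ?_) rfl
  simp only [Pi.smul_apply, Pi.sub_apply, smul_eq_mul]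
  ring

theorem opMul_sub_nexp {X Y Z : Lin} (c : ℂ) (h : P.zeroPair Y X = 0) (h' : NoContr Y X)
    (g : P.zeroPair Z X = 0) (g' : NoContr Z X) :
    opMul (c • (P.nexp Y - P.nexp Z)) (P.nexp X) = c • (P.nexp (Y + X) - P.nexp (Z + X)) := by
  funext i j
  have := ((P.hasSum_nexp_mul_of_noContr h h' i j).sub
    (P.hasSum_nexp_mul_of_noContr g g' i j)).mul_left c
  refine HasSum.tsum_eq ?_
  refine hasSum_of_eq this (fun m => ?_) rfl
  simp only [Pi.smul_apply, Pi.sub_apply, smul_eq_mul]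
  ring

end Params

end ScreeningCurrents

end

noncomputable section

namespace ScreeningCurrents

open Finset

/-! ### Exponential polynomials in two variables -/

@[fun_prop]
theorem analyticAt_fst_fun (p : ℂ × ℂ) : AnalyticAt ℂ (fun q : ℂ × ℂ => q.1) p := analyticAt_fst

@[fun_prop]
theorem analyticAt_snd_fun (p : ℂ × ℂ) : AnalyticAt ℂ (fun q : ℂ × ℂ => q.2) p := analyticAt_snd

/-- The algebra of functions on `ℂ²` spanned by the exponentials of linear forms. -/
def expAlg : Subalgebra ℂ (ℂ × ℂ → ℂ) :=
  Algebra.adjoin ℂ {f | ∃ a b : ℂ, f = fun p => Complex.exp (a * p.1 + b * p.2)}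

/-- Exponential polynomials on `ℂ²`. -/
@[fun_prop]
def IsExpPoly (f : ℂ × ℂ → ℂ) : Prop := f ∈ expAlg

namespace IsExpPoly

variable {f g : ℂ × ℂ → ℂ}

@[fun_prop]
theorem const (c : ℂ) : IsExpPoly fun _ => c := expAlg.algebraMap_mem c

@[fun_prop]
theorem add (hf : IsExpPoly f) (hg : IsExpPoly g) : IsExpPoly fun p => f p + g p :=
  expAlg.add_mem hf hg

@[fun_prop]
theorem sub (hf : IsExpPoly f) (hg : IsExpPoly g) : IsExpPoly fun p => f p - g p :=
  expAlg.sub_mem hf hg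

@[fun_prop]
theorem neg (hf : IsExpPoly f) : IsExpPoly fun p => -f p := expAlg.neg_mem hf

@[fun_prop]
theorem mul (hf : IsExpPoly f) (hg : IsExpPoly g) : IsExpPoly fun p => f p * g p :=
  expAlg.mul_mem hf hg

@[fun_prop]
theorem pow (hf : IsExpPoly f) (n : ℕ) : IsExpPoly fun p => f p ^ n := expAlg.pow_mem hf n

theorem sum {ι : Type*} (s : Finset ι) {f : ι → ℂ × ℂ → ℂ} (hf : ∀ i ∈ s, IsExpPoly (f i)) :
    IsExpPoly fun p => ∑ i ∈ s, f i p := by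
  have := expAlg.sum_mem hf
  rwa [Finset.sum_fn] at this

theorem prod {ι : Type*} (s : Finset ι) {f : ι → ℂ × ℂ → ℂ} (hf : ∀ i ∈ s, IsExpPoly (f i)) :
    IsExpPoly fun p => ∏ i ∈ s, f i p := by
  have := expAlg.prod_mem hf
  rwa [Finset.prod_fn] at this

theorem exp_affine (c a b : ℂ) : IsExpPoly fun p => Complex.exp (c + a * p.1 + b * p.2) := by
  have h : IsExpPoly fun p => Complex.exp (a * p.1 + b * p.2) :=
    Algebra.subset_adjoin ⟨a, b, rfl⟩
  have := (const (Complex.exp c)).mul h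
  simpa only [← Complex.exp_add, ← add_assoc] using this

theorem analyticOnNhd (hf : IsExpPoly f) : AnalyticOnNhd ℂ f Set.univ := by
  induction hf using Algebra.adjoin_induction with
  | mem f hf =>
    obtain ⟨a, b, rfl⟩ := hf
    intro p _
    fun_prop
  | algebraMap c => exact analyticOnNhd_const
  | add f g _ _ hf hg => exact hf.add hg
  | mul f g _ _ hf hg => exact hf.mul hg

/-- Division by v - u - h with remainder the restriction to the line v = u + h. It is enough to
divide the generating exponentials, because the functions divisible in this way form an algebra; no
division theorem in two variables is needed. -/
theorem exists_sub_eq_mul (hf : IsExpPoly f) (h : ℂ) :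
    ∃ g : ℂ × ℂ → ℂ, AnalyticOnNhd ℂ g Set.univ ∧
      ∀ p, f p = f (p.1, p.1 + h) + (p.2 - p.1 - h) * g p := by
  have haff : ∀ f : ℂ × ℂ → ℂ, AnalyticOnNhd ℂ f Set.univ →
      AnalyticOnNhd ℂ (fun p : ℂ × ℂ => f (p.1, p.1 + h)) Set.univ := by
    intro f hf p _
    exact (hf (p.1, p.1 + h) trivial).comp_of_eq (g := f)
      (f := fun p : ℂ × ℂ => (p.1, p.1 + h)) (by fun_prop) rfl
  induction hf using Algebra.adjoin_induction with
  | mem f hf =>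
    obtain ⟨a, b, rfl⟩ := hf
    set e : ℂ → ℂ := fun t => Complex.exp (b * t)
    have hd : Differentiable ℂ (dslope e 0) := by
      rw [← differentiableOn_univ, Complex.differentiableOn_dslope Filter.univ_mem]
      exact (by fun_prop : Differentiable ℂ e).differentiableOn
    have hda : AnalyticOnNhd ℂ (dslope e 0) Set.univ := fun x _ => hd.analyticAt x
    refine ⟨fun p => Complex.exp (a * p.1 + b * (p.1 + h)) * dslope e 0 (p.2 - p.1 - h), ?_, ?_⟩
    · intro p _
      refine AnalyticAt.mul (by fun_prop) ?_
      exact (hda (p.2 - p.1 - h) trivial).comp_of_eq (f := fun p : ℂ × ℂ => p.2 - p.1 - h)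
        (by fun_prop) rfl
    · intro p
      have h1 := sub_smul_dslope e 0 (p.2 - p.1 - h)
      simp only [sub_zero, smul_eq_mul, e, mul_zero, Complex.exp_zero] at h1
      have h2 : Complex.exp (a * p.1 + b * p.2)
          = Complex.exp (a * p.1 + b * (p.1 + h)) * Complex.exp (b * (p.2 - p.1 - h)) := by
        rw [← Complex.exp_add]; congr 1; ring
      simp only [h2, e]
      linear_combination -Complex.exp (a * p.1 + b * (p.1 + h)) * h1
  | algebraMap c => exact ⟨0, analyticOnNhd_const, fun p => by simp⟩
  | add f₁ f₂ _ _ h₁ h₂ =>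
    obtain ⟨g₁, hg₁, e₁⟩ := h₁
    obtain ⟨g₂, hg₂, e₂⟩ := h₂
    refine ⟨g₁ + g₂, hg₁.add hg₂, fun p => ?_⟩
    simp only [Pi.add_apply]
    linear_combination e₁ p + e₂ p
  | mul f₁ f₂ m₁ m₂ h₁ h₂ =>
    obtain ⟨g₁, hg₁, e₁⟩ := h₁
    obtain ⟨g₂, hg₂, e₂⟩ := h₂
    refine ⟨fun p => g₁ p * f₂ p + f₁ (p.1, p.1 + h) * g₂ p,
      (hg₁.mul (IsExpPoly.analyticOnNhd m₂)).add
        ((haff f₁ (IsExpPoly.analyticOnNhd m₁)).mul hg₂), fun p => ?_⟩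
    simp only [Pi.mul_apply]
    linear_combination f₂ p * e₁ p + f₁ (p.1, p.1 + h) * e₂ p

end IsExpPoly

/-! ### Matrix elements as exponential polynomials -/

section

variable (P : Params)

theorem isExpPoly_coeff_expAnnih {β : Mode → ℂ × ℂ → ℂ} (hβ : ∀ x, IsExpPoly (β x))
    (i j : Mode →₀ ℕ) : IsExpPoly fun p =>
      MvPolynomial.coeff i (P.expAnnih (fun x => β x p) (MvPolynomial.monomial j 1)) := by
  classical
  have hmul : ∀ f g : ℂ × ℂ → Osc, (∀ i, IsExpPoly fun p => MvPolynomial.coeff i (f p)) →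
      (∀ i, IsExpPoly fun p => MvPolynomial.coeff i (g p)) →
      ∀ i, IsExpPoly fun p => MvPolynomial.coeff i (f p * g p) := by
    intro f g hf hg i
    simp only [MvPolynomial.coeff_mul]
    exact IsExpPoly.sum _ fun q _ => (hf q.1).mul (hg q.2)
  have hone : ∀ i, IsExpPoly fun _ => MvPolynomial.coeff i (1 : Osc) := fun i => .const _
  induction j using Finsupp.induction generalizing i with
  | zero =>
    have : (MvPolynomial.monomial 0 1 : Osc) = 1 := rfl
    simp only [this, map_one]
    exact hone i
  | single_add x e f hx he ih =>
    have : (MvPolynomial.monomial (Finsupp.single x e + f) 1 : Osc)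
        = MvPolynomial.X x ^ e * MvPolynomial.monomial f 1 := by
      rw [MvPolynomial.X_pow_eq_monomial, MvPolynomial.monomial_mul, one_mul]
    simp only [this, map_mul, map_pow]
    refine hmul _ _ ?_ ih i
    clear * - hβ hmul hone
    induction e with
    | zero => simpa only [pow_zero] using hone
    | succ e ih =>
      simp only [pow_succ]
      refine hmul _ _ ih fun i => ?_
      simp only [Params.expAnnih, MvPolynomial.aeval_X, MvPolynomial.coeff_add,
        MvPolynomial.coeff_C]
      refine IsExpPoly.add (.const _) ?_
      split_ifs
      · exact (hβ x).mul (.const _)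
      · exact .const _

theorem isExpPoly_oscElt {X : ℂ × ℂ → Lin} (hX : ∀ x n, IsExpPoly fun p => X p (.osc x n))
    (i j : Mode →₀ ℕ) : IsExpPoly fun p => P.oscElt (X p) i j := by
  classical
  unfold Params.oscElt
  simp only [MvPowerSeries.coeff_mul, Params.expCreate_apply, MvPolynomial.coeff_coe]
  refine IsExpPoly.sum _ fun q _ => IsExpPoly.mul ?_ (isExpPoly_coeff_expAnnih P (fun x => hX _ _) _ _)
  unfold divPow
  refine IsExpPoly.prod _ fun x _ => ?_
  simp only [smul_eq_mul]
  exact (IsExpPoly.const _).mul ((hX _ _).pow _)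

/-- The weight condition must not depend on the point, and the zero modes must act through an
exponent affine in (u, v); each oscillator matrix element is a polynomial in finitely many mode
coefficients. -/
theorem isExpPoly_nexp {X : ℂ × ℂ → Lin} (hX : ∀ x n, IsExpPoly fun p => X p (.osc x n))
    (hq : ∀ p wt, P.shift (X p) wt = P.shift (X 0) wt)
    (hp : ∀ wt, ∃ c a b : ℂ, ∀ p, Params.momentum (X p) wt = c + a * p.1 + b * p.2)
    (i j : FockIndex) : IsExpPoly fun p => P.nexp (X p) i j := by
  classical
  simp only [Params.nexp_apply, hq]
  split_ifs
  · obtain ⟨c, a, b, h⟩ := hp j.1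
    simp only [h]
    exact (IsExpPoly.exp_affine c a b).mul (isExpPoly_oscElt P hX _ _)
  · exact .const _

end

end ScreeningCurrents

end

noncomputable section

namespace ScreeningCurrents

open Finset

/-! ### Geometrically bounded sequences -/

/-- Sequences that grow at most geometrically. -/
def GeoBdd (f : ℕ → ℂ) : Prop :=
  ∃ C ρ : ℝ, 0 ≤ C ∧ 0 ≤ ρ ∧ ∀ n, 0 < n → ‖f n‖ ≤ C * ρ ^ n

namespace GeoBdd

variable {f g : ℕ → ℂ}

theorem const (c : ℂ) : GeoBdd fun _ => c :=
  ⟨‖c‖, 1, norm_nonneg _, zero_le_one, fun n _ => by simp⟩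

theorem pow_seq (c : ℂ) : GeoBdd fun n => c ^ n :=
  ⟨1, ‖c‖, zero_le_one, norm_nonneg _, fun n _ => by simp⟩

theorem mul (hf : GeoBdd f) (hg : GeoBdd g) : GeoBdd fun n => f n * g n := by
  obtain ⟨C, ρ, hC, hρ, h⟩ := hf
  obtain ⟨C', ρ', hC', hρ', h'⟩ := hg
  refine ⟨C * C', ρ * ρ', by positivity, by positivity, fun n hn => ?_⟩
  rw [norm_mul, mul_pow, mul_mul_mul_comm]
  exact mul_le_mul (h n hn) (h' n hn) (norm_nonneg _) (by positivity)

theorem neg (hf : GeoBdd f) : GeoBdd fun n => -f n := by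
  obtain ⟨C, ρ, hC, hρ, h⟩ := hf
  exact ⟨C, ρ, hC, hρ, fun n hn => by rw [norm_neg]; exact h n hn⟩

theorem add (hf : GeoBdd f) (hg : GeoBdd g) : GeoBdd fun n => f n + g n := by
  obtain ⟨C, ρ, hC, hρ, h⟩ := hf
  obtain ⟨C', ρ', hC', hρ', h'⟩ := hg
  refine ⟨C + C', max ρ ρ', by positivity, le_max_of_le_left hρ, fun n hn => ?_⟩
  refine (norm_add_le _ _).trans ?_
  rw [add_mul]
  refine add_le_add ((h n hn).trans ?_) ((h' n hn).trans ?_)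
  · gcongr; exact le_max_left _ _
  · gcongr; exact le_max_right _ _

theorem sub (hf : GeoBdd f) (hg : GeoBdd g) : GeoBdd fun n => f n - g n := by
  simpa only [sub_eq_add_neg] using hf.add hg.neg

theorem div (hf : GeoBdd f) (hg : GeoBdd fun n => (g n)⁻¹) : GeoBdd fun n => f n / g n := by
  simpa only [div_eq_mul_inv] using hf.mul hg

theorem inv_mul (hf : GeoBdd fun n => (f n)⁻¹) (hg : GeoBdd fun n => (g n)⁻¹) :
    GeoBdd fun n => (f n * g n)⁻¹ := by
  simpa only [mul_inv] using hf.mul hg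

theorem inv_natCast : GeoBdd fun n => (n : ℂ)⁻¹ := by
  refine ⟨1, 1, zero_le_one, zero_le_one, fun n hn => ?_⟩
  rw [norm_inv, Complex.norm_natCast, one_pow, mul_one]
  exact inv_le_one_of_one_le₀ (by exact_mod_cast hn)

end GeoBdd

/-! ### Elementary properties of `q`-numbers -/

namespace Params

variable (P : Params)

theorem qp_add (s t : ℂ) : P.qp (s + t) = P.qp s * P.qp t := by
  rw [qp, add_mul, Complex.exp_add]; rfl

theorem qp_neg (s : ℂ) : P.qp (-s) = (P.qp s)⁻¹ := by
  rw [qp, neg_mul, Complex.exp_neg]; rfl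

theorem qp_sub (s t : ℂ) : P.qp (s - t) = P.qp s / P.qp t := by
  rw [sub_eq_add_neg, qp_add, qp_neg, div_eq_mul_inv]

theorem qp_ne_zero (s : ℂ) : P.qp s ≠ 0 := Complex.exp_ne_zero _

theorem qp_mul_natCast (s : ℂ) (n : ℕ) : P.qp (s * n) = P.qp s ^ n := by
  rw [qp, qp, ← Complex.exp_nat_mul]; congr 1; ring

theorem qp_zero : P.qp 0 = 1 := by simp [qp]

theorem br_mul_natCast (s : ℂ) (n : ℕ) :
    P.br (s * n) = (P.qp s ^ n - ((P.qp s)⁻¹) ^ n) / P.dq := by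
  rw [br, qp_mul_natCast, ← neg_mul, qp_mul_natCast, qp_neg]

theorem br_neg (s : ℂ) : P.br (-s) = -P.br s := by
  rw [br, br, neg_neg, ← neg_div, neg_sub]

theorem z_ne_zero (u : ℂ) : P.z u ≠ 0 := Complex.exp_ne_zero _

theorem z_add_half (u s : ℂ) : P.z (u + s / 2) = P.qp s * P.z u := by
  rw [z, z, ← qp_add]; congr 1; ring

theorem z_sub_half (u s : ℂ) : P.z (u - s / 2) = (P.qp s)⁻¹ * P.z u := by
  rw [z, z, ← qp_neg, ← qp_add]; congr 1; ring

theorem lnz_add_half (u s : ℂ) : P.lnz (u + s / 2) = P.lnz u + s * P.lnq := by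
  rw [lnz, lnz]; ring

theorem exp_lnz (u : ℂ) : Complex.exp (P.lnz u) = P.z u := rfl

theorem norm_qp_lt_one {s : ℝ} (hq : P.lnq.re < 0) (hs : 0 < s) : ‖P.qp s‖ < 1 := by
  rw [qp, Complex.norm_exp, Real.exp_lt_one_iff, Complex.re_ofReal_mul]
  exact mul_neg_of_pos_of_neg hs hq

/-- The two powers have moduli on opposite sides of 1, since Re λ < 0. -/
theorem qp_pow_sub_inv_ne_zero (hq : P.lnq.re < 0) {s : ℝ} (hs : s ≠ 0) {n : ℕ} (hn : 0 < n) :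
    P.qp s ^ n - ((P.qp s)⁻¹) ^ n ≠ 0 := by
  wlog h : 0 < s generalizing s
  · have := this (s := -s) (neg_ne_zero.2 hs) (by
      rcases lt_trichotomy s 0 with h' | h' | h'
      · linarith
      · exact absurd h' hs
      · exact absurd h' h)
    rw [Complex.ofReal_neg, qp_neg, inv_inv] at this
    intro h0
    apply this
    linear_combination -h0
  · intro h0
    have h1 : ‖P.qp s‖ ^ n < 1 := pow_lt_one₀ (norm_nonneg _) (P.norm_qp_lt_one hq h) hn.ne'
    have h2 := congrArg norm (sub_eq_zero.1 h0)
    rw [norm_pow, norm_pow, norm_inv, inv_pow] at h2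
    have h3 : 0 < ‖P.qp s‖ ^ n := pow_pos (norm_pos_iff.2 (P.qp_ne_zero _)) _
    rw [h2] at h1 h3
    have h4 := one_lt_inv_iff₀.2 ⟨inv_pos.1 h3, by rw [← h2] at h1; exact h1⟩
    linarith

theorem dq_ne_zero (hq : P.lnq.re < 0) : P.dq ≠ 0 := by
  have := P.qp_pow_sub_inv_ne_zero hq (s := 1) one_ne_zero one_pos
  rwa [pow_one, pow_one, ← qp_neg, Complex.ofReal_one] at this

theorem br_ne_zero (hq : P.lnq.re < 0) {s : ℝ} (hs : s ≠ 0) {n : ℕ} (hn : 0 < n) :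
    P.br (s * n) ≠ 0 := by
  rw [br_mul_natCast]
  exact div_ne_zero (P.qp_pow_sub_inv_ne_zero hq hs hn) (P.dq_ne_zero hq)

theorem geoBdd_br (s : ℂ) : GeoBdd fun n => P.br (s * n) := by
  simp only [br_mul_natCast, div_eq_mul_inv]
  exact ((GeoBdd.pow_seq _).sub (.pow_seq _)).mul (.const _)

/-- For s > 0 and y = |q^s| < 1, one has |q^{-sn}| ≥ 1 and |q^{sn}| ≤ y, so |[sn]| is bounded below
by (1 - y)/|q - q⁻¹|. The case s < 0 follows by oddness. -/
theorem geoBdd_inv_br (hq : P.lnq.re < 0) {s : ℝ} (hs : s ≠ 0) :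
    GeoBdd fun n => (P.br (s * n))⁻¹ := by
  wlog h : 0 < s generalizing s
  · have := (this (s := -s) (neg_ne_zero.2 hs) (by
      rcases lt_trichotomy s 0 with h' | h' | h'
      · linarith
      · exact absurd h' hs
      · exact absurd h' h)).neg
    simpa only [Complex.ofReal_neg, neg_mul, br_neg, inv_neg, neg_neg] using this
  · set y := ‖P.qp s‖ with hy
    have hy1 : y < 1 := P.norm_qp_lt_one hq h
    have hy0 : 0 < y := norm_pos_iff.2 (P.qp_ne_zero _)
    refine ⟨‖P.dq‖ / (1 - y), 1, div_nonneg (norm_nonneg _) (by linarith), zero_le_one,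
      fun n hn => ?_⟩
    beta_reduce
    rw [br_mul_natCast, inv_div, norm_div, one_pow, mul_one]
    refine div_le_div_of_nonneg_left (norm_nonneg _) (by linarith) ?_
    have h1 := norm_sub_norm_le ((P.qp s)⁻¹ ^ n) (P.qp s ^ n)
    rw [norm_sub_rev, norm_pow, norm_pow, norm_inv, ← hy] at h1
    have h2 : y ^ n ≤ y := pow_le_of_le_one hy0.le hy1.le hn.ne'
    have h3 : 1 ≤ y⁻¹ ^ n := one_le_pow₀ ((one_le_inv₀ hy0).2 hy1.le)
    linarith

/-- The commutator `[x_n, x_{-n}]`, as a function of `n`. -/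
def comm : Boson → ℕ → ℂ
  | .a, n => P.br ((P.k + 2) * n) * P.br (2 * n) / n
  | .b, n => -(P.br (1 * n) ^ 2 / n)
  | .c, n => P.br (1 * n) ^ 2 / n

theorem kappa_eq (x : Boson) (n : ℕ+) : P.kappa (x, n) = P.comm x n := by
  cases x <;> simp [kappa, comm]

theorem geoBdd_comm (x : Boson) : GeoBdd (P.comm x) := by
  have h1 : GeoBdd fun n => P.br (1 * n) ^ 2 / n := by
    simp only [sq, div_eq_mul_inv]
    exact ((P.geoBdd_br _).mul (P.geoBdd_br _)).mul .inv_natCast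
  cases x
  · exact ((P.geoBdd_br _).mul (P.geoBdd_br _)).mul .inv_natCast
  · exact h1.neg
  · exact h1

end Params

/-! ### Vertex operators -/

/-- The data of a family of normal ordered exponentials: in the exponent at the point `z`, the mode
`x_n` has the coefficient `ann x n * z ^ (-n)` and the mode `x_{-n}` the coefficient
`cre x n * z ^ n`; the `q`'s have constant coefficients, and the `p`'s and `p̂ - 1` have
coefficients of the form `s + t * ln z`. -/
structure Vtx where
  ann : Boson → ℕ → ℂ
  cre : Boson → ℕ → ℂ
  q : Boson → ℂ
  qh : ℂ
  p : Boson → ℂ × ℂ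
  ph : ℂ × ℂ

instance : Fintype Boson := ⟨{.a, .b, .c}, fun x => by cases x <;> simp⟩

theorem Boson.sum_univ (f : Boson → ℂ) : ∑ x, f x = f .a + f .b + f .c := by
  change ∑ x ∈ ({.a, .b, .c} : Finset Boson), f x = _
  simp [add_assoc]

namespace Vtx

variable (P : Params)

/-- The exponent of the vertex operator at the coordinate `u`. -/
def lin (V : Vtx) (u : ℂ) : Lin
  | .osc x n => if 0 < n then V.ann x n.natAbs * (P.z u ^ n.natAbs)⁻¹
      else if n < 0 then V.cre x n.natAbs * P.z u ^ n.natAbs else 0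
  | .qz x => V.q x
  | .pz x => (V.p x).1 + (V.p x).2 * P.lnz u
  | .qhat => V.qh
  | .phat => V.ph.1 + V.ph.2 * P.lnz u
  | .one => -(V.ph.1 + V.ph.2 * P.lnz u)

theorem lin_osc_pos (V : Vtx) (u : ℂ) (x : Boson) (n : ℕ+) :
    V.lin P u (.osc x (n : ℤ)) = V.ann x n * (P.z u ^ (n : ℕ))⁻¹ := by
  have : (0 : ℤ) < (n : ℕ) := by exact_mod_cast n.pos
  simp [lin]

theorem lin_osc_neg (V : Vtx) (u : ℂ) (x : Boson) (n : ℕ+) :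
    V.lin P u (.osc x (-(n : ℤ))) = V.cre x n * P.z u ^ (n : ℕ) := by
  have : (0 : ℤ) < (n : ℕ) := by exact_mod_cast n.pos
  simp [lin]

/-- The coefficients of the oscillators grow at most geometrically. -/
def Adm (V : Vtx) : Prop := ∀ x, GeoBdd (V.ann x) ∧ GeoBdd (V.cre x)

/-- The commutator of the annihilation modes of `V` with the creation modes of `W`. -/
def contr (V W : Vtx) (n : ℕ) : ℂ := ∑ x, V.ann x n * P.comm x n * W.cre x n

/-- The commutator of the zero modes of `V` and `W`. -/
def zeroContr (V W : Vtx) (u : ℂ) : ℂ :=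
  2 * (P.k + 2) * ((V.p .a).1 + (V.p .a).2 * P.lnz u) * W.q .a
    - ((V.p .b).1 + (V.p .b).2 * P.lnz u) * W.q .b + ((V.p .c).1 + (V.p .c).2 * P.lnz u) * W.q .c
    - (V.ph.1 + V.ph.2 * P.lnz u) * W.qh

/-- Geometric growth of the coefficients makes the contraction a power series in w/z with a positive
radius of convergence. The radius does not involve i and j, which gives the uniform R of the
theorem. -/
theorem exists_hasSum_mul {V W : Vtx} (hV : V.Adm) (hW : W.Adm) :
    ∃ R : ℝ, 0 < R ∧ ∀ u v, R * ‖P.z v‖ < ‖P.z u‖ → ∀ i j,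
      HasSum (fun m => P.nexp (V.lin P u) i m * P.nexp (W.lin P v) m j)
        (Complex.exp (V.zeroContr P W u) *
          Complex.exp (∑' n : ℕ+, V.contr P W n * (P.z v / P.z u) ^ (n : ℕ)) *
          P.nexp (V.lin P u + W.lin P v) i j) := by
  have hb : ∀ x, GeoBdd fun n => V.ann x n * P.comm x n * W.cre x n := fun x =>
    ((hV x).1.mul (P.geoBdd_comm x)).mul (hW x).2
  choose C ρ hC hρ h using hb
  -- This exceeds the growth rate of each of the three bosons; the added 1 makes it positive.
  refine ⟨∑ x, ρ x + 1, by have := sum_nonneg fun x (_ : x ∈ univ) => hρ x; linarith,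
    fun u v huv i j => ?_⟩
  set t := P.z v / P.z u with ht
  have hzu : 0 < ‖P.z u‖ := norm_pos_iff.2 (P.z_ne_zero u)
  have hrt : ∀ x, ρ x * ‖t‖ < 1 := by
    intro x
    rw [ht, norm_div, ← mul_div_assoc, div_lt_one hzu]
    refine lt_of_le_of_lt ?_ huv
    gcongr
    have := single_le_sum (fun x (_ : x ∈ univ) => hρ x) (mem_univ x)
    linarith
  have hsum : ∀ x, Summable fun n : ℕ+ => V.ann x n * P.comm x n * W.cre x n * t ^ (n : ℕ) := by
    intro x
    have hg := ((summable_geometric_of_lt_one (mul_nonneg (hρ x) (norm_nonneg t)) (hrt x)).mul_left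
      (C x)).comp_injective PNat.coe_injective
    refine Summable.of_norm_bounded hg fun n => ?_
    rw [norm_mul, norm_pow, Function.comp_apply, mul_pow, ← mul_assoc]
    gcongr
    exact h x n n.pos
  set f : Mode → ℂ := fun x =>
    V.lin P u (.osc x.1 (x.2 : ℤ)) * P.kappa x * W.lin P v (.osc x.1 (-(x.2 : ℤ))) with hf
  have hfx : ∀ x n, f (x, n) = V.ann x n * P.comm x n * W.cre x n * t ^ (n : ℕ) := by
    intro x n
    simp only [hf, lin_osc_pos, lin_osc_neg, P.kappa_eq, ht, div_pow]
    ring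
  have hF : HasSum f (∑ x, ∑' n : ℕ+, V.ann x n * P.comm x n * W.cre x n * t ^ (n : ℕ)) := by
    have h1 : ∀ x ∈ (univ : Finset Boson), HasSum (fun m : Mode => if m.1 = x then f m else 0)
        (∑' n : ℕ+, V.ann x n * P.comm x n * W.cre x n * t ^ (n : ℕ)) := by
      intro x _
      have hinj : Function.Injective fun n : ℕ+ => ((x, n) : Mode) :=
        fun a b hab => (Prod.ext_iff.1 hab).2
      refine (hinj.hasSum_iff ?_).1 ?_
      · rintro ⟨y, n⟩ hm
        rw [if_neg]
        rintro rfl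
        exact hm ⟨n, rfl⟩
      · refine hasSum_of_eq (hsum x).hasSum (fun n => ?_) rfl
        simp [hfx]
    have h2 := hasSum_sum h1
    refine hasSum_of_eq h2 (fun m => ?_) rfl
    simp
  have hval : ∑' x, f x = ∑' n : ℕ+, V.contr P W n * t ^ (n : ℕ) := by
    rw [hF.tsum_eq, ← Summable.tsum_finsetSum fun x _ => hsum x]
    simp only [contr, sum_mul]
  have := P.hasSum_nexp_mul (V.lin P u) (W.lin P v) hF.summable i j
  change HasSum _ (Complex.exp (_ + ∑' x, f x) * _) at this
  rw [hval, Complex.exp_add] at this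
  exact this

/-- In the region `|z| > R |w|`, the product of the two vertex operators is `φ` times their normal
ordered product. -/
def Factor (V W : Vtx) (R : ℝ) (φ : ℂ × ℂ → ℂ) : Prop :=
  ∀ u v, R * ‖P.z v‖ < ‖P.z u‖ → ∀ i j,
    HasSum (fun m => P.nexp (V.lin P u) i m * P.nexp (W.lin P v) m j)
      (φ (u, v) * P.nexp (V.lin P u + W.lin P v) i j)

theorem Factor.mono {V W : Vtx} {R R' : ℝ} {φ : ℂ × ℂ → ℂ} (h : V.Factor P W R φ) (hR : R ≤ R') :
    V.Factor P W R' φ := fun u v huv =>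
  h u v (lt_of_le_of_lt (mul_le_mul_of_nonneg_right hR (norm_nonneg _)) huv)

theorem hasSum_pow_div_pnat {x : ℂ} (hx : ‖x‖ < 1) :
    HasSum (fun n : ℕ+ => x ^ (n : ℕ) / (n : ℕ)) (-Complex.log (1 - x)) := by
  refine (PNat.coe_injective.hasSum_iff (f := fun n : ℕ => x ^ n / n) ?_).2
    (Complex.hasSum_taylorSeries_neg_log hx)
  intro n hn
  have : n = 0 := by
    by_contra h
    exact hn ⟨⟨n, Nat.pos_of_ne_zero h⟩, rfl⟩
  simp [this]

/-- The contraction series is log(1 - βw/z) - log(1 - αw/z), so its exponential is rational.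
Integrality of `l` in `hz` makes the zero mode factor a single-valued power of z. -/
theorem exists_factor {V W : Vtx} (hV : V.Adm) (hW : W.Adm) {α β : ℂ}
    (h : ∀ n : ℕ+, V.contr P W n = (α ^ (n : ℕ) - β ^ (n : ℕ)) / (n : ℕ)) {c : ℂ} {l : ℤ}
    (hz : ∀ u, V.zeroContr P W u = c * P.lnq + l * P.lnz u) :
    ∃ R : ℝ, 0 < R ∧ V.Factor P W R fun p => P.qp c * P.z p.1 ^ l *
      ((P.z p.1 - β * P.z p.2) / (P.z p.1 - α * P.z p.2)) := by
  obtain ⟨R, hR, H⟩ := exists_hasSum_mul P hV hW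
  -- Enlarging R by the moduli of α and β puts αw/z and βw/z inside the unit disc, where the
  -- logarithmic series converge.
  refine ⟨max R (max ‖α‖ ‖β‖), lt_max_of_lt_left hR, fun u v huv i j => ?_⟩
  have hlt : ∀ c : ℂ, ‖c‖ ≤ max R (max ‖α‖ ‖β‖) → ‖c * (P.z v / P.z u)‖ < 1 := by
    intro c hc
    rw [norm_mul, norm_div, ← mul_div_assoc, div_lt_one (norm_pos_iff.2 (P.z_ne_zero u))]
    exact lt_of_le_of_lt (mul_le_mul_of_nonneg_right hc (norm_nonneg _)) huv
  have hα := hlt α (by simp)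
  have hβ := hlt β (by simp)
  have key := H u v (lt_of_le_of_lt (mul_le_mul_of_nonneg_right (le_max_left _ _)
    (norm_nonneg _)) huv) i j
  have hs := (hasSum_pow_div_pnat hα).sub (hasSum_pow_div_pnat hβ)
  have hne : ∀ c : ℂ, ‖c‖ < 1 → 1 - c ≠ 0 := by
    intro c hc h0
    rw [← sub_eq_zero.1 h0, norm_one] at hc
    exact lt_irrefl _ hc
  have hval : ∑' n : ℕ+, V.contr P W n * (P.z v / P.z u) ^ (n : ℕ)
      = -Complex.log (1 - α * (P.z v / P.z u)) - -Complex.log (1 - β * (P.z v / P.z u)) := by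
    rw [← hs.tsum_eq]
    refine tsum_congr fun n => ?_
    rw [h n, mul_pow, mul_pow]
    ring
  rw [hval, Complex.exp_sub, Complex.exp_neg, Complex.exp_neg, Complex.exp_log (hne _ hα),
    Complex.exp_log (hne _ hβ)] at key
  rw [hz, Complex.exp_add, Complex.exp_int_mul] at key
  have hzu := P.z_ne_zero u
  have e : ∀ c : ℂ, P.z u - c * P.z v = P.z u * (1 - c * (P.z v / P.z u)) := by
    intro c; field_simp
  have e' : (P.z u - β * P.z v) / (P.z u - α * P.z v)
      = (1 - α * (P.z v / P.z u))⁻¹ / (1 - β * (P.z v / P.z u))⁻¹ := by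
    rw [e, e, mul_div_mul_left _ _ hzu, inv_div_inv]
  beta_reduce
  rw [e']
  exact key

theorem exists_factor_of_contr_eq_zero {V W : Vtx} (hV : V.Adm) (hW : W.Adm)
    (h : ∀ n : ℕ+, V.contr P W n = 0) {c : ℂ} {l : ℤ}
    (hz : ∀ u, V.zeroContr P W u = c * P.lnq + l * P.lnz u) :
    ∃ R : ℝ, 0 < R ∧ V.Factor P W R fun p => P.qp c * P.z p.1 ^ l := by
  have := exists_factor P hV hW (α := 0) (β := 0) (fun n => by simp [h n]) hz
  simpa [P.z_ne_zero] using this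

/-! ### Matrix elements of normal ordered products -/

theorem isExpPoly_z_fst : IsExpPoly fun p => P.z p.1 := by
  have := IsExpPoly.exp_affine 0 (2 * P.lnq) 0
  convert this using 2 with p
  rw [Params.z, Params.qp]; ring_nf

theorem isExpPoly_z_snd : IsExpPoly fun p => P.z p.2 := by
  have := IsExpPoly.exp_affine 0 0 (2 * P.lnq)
  convert this using 2 with p
  rw [Params.z, Params.qp]; ring_nf

theorem isExpPoly_inv_z_fst : IsExpPoly fun p => (P.z p.1)⁻¹ := by
  have := IsExpPoly.exp_affine 0 (-(2 * P.lnq)) 0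
  convert this using 2 with p
  rw [Params.z, ← P.qp_neg, Params.qp]; ring_nf

theorem isExpPoly_inv_z_snd : IsExpPoly fun p => (P.z p.2)⁻¹ := by
  have := IsExpPoly.exp_affine 0 0 (-(2 * P.lnq))
  convert this using 2 with p
  rw [Params.z, ← P.qp_neg, Params.qp]; ring_nf

theorem isExpPoly_normalProduct (V W : Vtx) (i j : FockIndex) :
    IsExpPoly fun p => P.nexp (V.lin P p.1 + W.lin P p.2) i j := by
  refine isExpPoly_nexp P (fun x n => ?_) (fun p wt => ?_) (fun wt => ?_) i j
  · simp only [Pi.add_apply, lin]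
    have h1 := isExpPoly_z_fst P
    have h2 := isExpPoly_z_snd P
    have h3 := isExpPoly_inv_z_fst P
    have h4 := isExpPoly_inv_z_snd P
    split_ifs <;> (try simp only [← inv_pow]) <;> fun_prop
  · simp [Params.shift, lin]
  · set f : ℂ × ℂ → ℂ := fun p => Params.momentum (V.lin P p.1 + W.lin P p.2) wt with hf
    -- An affine function is determined by its values at the origin and at the two unit vectors.
    refine ⟨f 0, f (1, 0) - f 0, f (0, 1) - f 0, fun p => ?_⟩
    change f p = _
    simp only [hf, Params.momentum, Pi.add_apply, lin, Params.lnz, Prod.fst_zero, Prod.snd_zero]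
    ring

theorem isExpPoly_single (V : Vtx) (i j : FockIndex) :
    IsExpPoly fun p => P.nexp (V.lin P p.1) i j := by
  -- The second factor is the trivial vertex operator, whose exponent is zero.
  have := isExpPoly_normalProduct P V ⟨0, 0, 0, 0, 0, 0⟩ i j
  convert this using 4 with p
  ext g
  cases g <;> simp [lin]

end Vtx

end ScreeningCurrents

end

noncomputable section

namespace ScreeningCurrents

open Finset

/-! ### Removable singularities -/

section Removable

variable (P : Params)

/-- The zero of e^{lt} - 1 at the origin is simple, and the divided difference has no zeros besides
the nonzero roots of e^{lt} = 1. -/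
theorem dslope_exp_ne_zero {l : ℂ} (hl : l ≠ 0) {t : ℂ} (h : Complex.exp (l * t) = 1 → t = 0) :
    dslope (fun t => Complex.exp (l * t)) 0 t ≠ 0 := by
  by_cases ht : t = 0
  · subst ht
    have : HasDerivAt (fun t => Complex.exp (l * t)) (Complex.exp (l * 0) * (l * 1)) 0 :=
      ((hasDerivAt_id (0 : ℂ)).const_mul l).cexp
    rw [dslope_same, this.deriv]
    simpa using hl
  · intro h0
    have h1 := sub_smul_dslope (fun t => Complex.exp (l * t)) 0 t
    rw [h0, smul_zero, mul_zero, Complex.exp_zero] at h1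
    exact ht (h (sub_eq_zero.1 h1.symm))

theorem analyticAt_dslope_exp (l t : ℂ) :
    AnalyticAt ℂ (dslope (fun t => Complex.exp (l * t)) 0) t := by
  have hd : Differentiable ℂ (dslope (fun t => Complex.exp (l * t)) 0) := by
    rw [← differentiableOn_univ, Complex.differentiableOn_dslope Filter.univ_mem]
    exact (by fun_prop : Differentiable ℂ fun t => Complex.exp (l * t)).differentiableOn
  exact hd.analyticAt t

theorem z_eq_exp_mul (u v h : ℂ) :
    P.z v = Complex.exp (2 * P.lnq * (v - u - h)) * (P.qp (2 * h) * P.z u) := by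
  simp only [Params.z, Params.qp, ← Complex.exp_add]
  congr 1; ring

theorem analyticAt_z_fst (p : ℂ × ℂ) : AnalyticAt ℂ (fun p : ℂ × ℂ => P.z p.1) p :=
  (Vtx.isExpPoly_z_fst P).analyticOnNhd p trivial

theorem analyticAt_z_snd (p : ℂ × ℂ) : AnalyticAt ℂ (fun p : ℂ × ℂ => P.z p.2) p :=
  (Vtx.isExpPoly_z_snd P).analyticOnNhd p trivial

/-- The denominator is -(v - u - h) z times the divided difference of an exponential, and the
numerator is divisible by the same linear factor. The divided difference vanishes exactly on the
other sheets of w = q^{2h} z, which are excluded from the domain of analyticity. -/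
theorem exists_analytic_div (hq : P.lnq ≠ 0) {f : ℂ × ℂ → ℂ} (hf : IsExpPoly f) (h : ℂ)
    (h0 : ∀ u, f (u, u + h) = 0) :
    ∃ G : ℂ × ℂ → ℂ,
      AnalyticOnNhd ℂ G {p | P.z p.2 = P.qp (2 * h) * P.z p.1 → p.2 = p.1 + h} ∧
      ∀ p, P.z p.1 - P.qp (-(2 * h)) * P.z p.2 ≠ 0 →
        f p / (P.z p.1 - P.qp (-(2 * h)) * P.z p.2) = G p := by
  obtain ⟨g, hg, e⟩ := hf.exists_sub_eq_mul h
  have hl : 2 * P.lnq ≠ 0 := mul_ne_zero two_ne_zero hq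
  refine ⟨fun p => -g p / (P.z p.1 *
    dslope (fun t => Complex.exp (2 * P.lnq * t)) 0 (p.2 - p.1 - h)), ?_, ?_⟩
  · intro p hp
    have h1 : AnalyticAt ℂ (fun p : ℂ × ℂ =>
        dslope (fun t => Complex.exp (2 * P.lnq * t)) 0 (p.2 - p.1 - h)) p :=
      (analyticAt_dslope_exp (2 * P.lnq) (p.2 - p.1 - h)).comp_of_eq
        (f := fun p : ℂ × ℂ => p.2 - p.1 - h) (by fun_prop) rfl
    refine (hg p trivial).neg.div ((analyticAt_z_fst P p).mul h1)
      (mul_ne_zero (P.z_ne_zero _) (dslope_exp_ne_zero hl fun h2 => ?_))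
    have h3 := z_eq_exp_mul P p.1 p.2 h
    rw [h2, one_mul] at h3
    rw [hp h3]; ring
  · intro p hp
    have h1 := sub_smul_dslope (fun t => Complex.exp (2 * P.lnq * t)) 0 (p.2 - p.1 - h)
    rw [smul_eq_mul, sub_zero, mul_zero, Complex.exp_zero] at h1
    have h2 : P.z p.1 - P.qp (-(2 * h)) * P.z p.2
        = -((p.2 - p.1 - h) *
          (P.z p.1 * dslope (fun t => Complex.exp (2 * P.lnq * t)) 0 (p.2 - p.1 - h))) := by
      rw [z_eq_exp_mul P p.1 p.2 h, P.qp_neg]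
      have := P.qp_ne_zero (2 * h)
      field_simp
      linear_combination P.z p.1 * h1
    rw [h2] at hp ⊢
    have h3 := left_ne_zero_of_mul (neg_ne_zero.1 hp)
    have h4 := right_ne_zero_of_mul (neg_ne_zero.1 hp)
    rw [e p, h0, zero_add, div_neg, ← neg_div, ← mul_neg, mul_div_mul_left _ _ h3]

/-- Here the numerator vanishes on every sheet v = u + h with q^{2h} = 1, so the quotients supplied
by `exists_analytic_div` for the separate sheets glue to an entire function. -/
theorem exists_analytic_div_sub (hq : P.lnq ≠ 0) {f : ℂ × ℂ → ℂ} (hf : IsExpPoly f)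
    (h0 : ∀ u v, P.z u = P.z v → f (u, v) = 0) :
    ∃ G : ℂ × ℂ → ℂ, AnalyticOnNhd ℂ G Set.univ ∧
      ∀ p, P.z p.1 - P.z p.2 ≠ 0 → f p / (P.z p.1 - P.z p.2) = G p := by
  classical
  have hl : 2 * P.lnq ≠ 0 := mul_ne_zero two_ne_zero hq
  have hex : ∀ h : ℂ, ∃ G : ℂ × ℂ → ℂ, P.qp (2 * h) = 1 →
      AnalyticOnNhd ℂ G {p | P.z p.2 = P.qp (2 * h) * P.z p.1 → p.2 = p.1 + h} ∧
      ∀ p, P.z p.1 - P.qp (-(2 * h)) * P.z p.2 ≠ 0 →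
        f p / (P.z p.1 - P.qp (-(2 * h)) * P.z p.2) = G p := by
    intro h
    by_cases hh : P.qp (2 * h) = 1
    · obtain ⟨G, hG⟩ := exists_analytic_div P hq hf h fun u => h0 _ _ (by
        rw [z_eq_exp_mul P u (u + h) h, hh]; simp)
      exact ⟨G, fun _ => hG⟩
    · exact ⟨0, fun h' => absurd h' hh⟩
  choose g hg using hex
  refine ⟨fun p => if P.z p.1 - P.z p.2 = 0 then g (p.2 - p.1) p else f p / (P.z p.1 - P.z p.2),
    ?_, fun p hp => (if_neg hp).symm⟩
  intro p _
  have hsub : AnalyticAt ℂ (fun p : ℂ × ℂ => P.z p.1 - P.z p.2) p :=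
    (analyticAt_z_fst P p).sub (analyticAt_z_snd P p)
  by_cases hp : P.z p.1 - P.z p.2 = 0
  · set h := p.2 - p.1 with hh
    have hqh : P.qp (2 * h) = 1 := by
      have h1 := z_eq_exp_mul P p.1 p.2 h
      rw [← hh, sub_self, mul_zero, Complex.exp_zero, one_mul, ← sub_eq_zero.1 hp] at h1
      exact (mul_eq_right₀ (P.z_ne_zero _)).1 h1.symm
    obtain ⟨hA, hE⟩ := hg h hqh
    have hAp := hA p (fun _ => by rw [hh]; ring)
    refine hAp.congr ?_
    have hcont : ContinuousAt (fun p : ℂ × ℂ =>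
        dslope (fun t => Complex.exp (2 * P.lnq * t)) 0 (p.2 - p.1 - h)) p :=
      ((analyticAt_dslope_exp (2 * P.lnq) (p.2 - p.1 - h)).comp_of_eq
        (f := fun p : ℂ × ℂ => p.2 - p.1 - h) (by fun_prop) rfl).continuousAt
    have hne : dslope (fun t => Complex.exp (2 * P.lnq * t)) 0 (p.2 - p.1 - h) ≠ 0 :=
      dslope_exp_ne_zero hl fun _ => by rw [hh]; ring
    -- Close to a point of one sheet, z = w forces v - u to be the same h, so the locally defined
    -- quotient agrees with the piecewise one.
    filter_upwards [hcont.eventually_ne hne] with p' hp'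
    split_ifs with hz
    · have h1 := z_eq_exp_mul P p'.1 p'.2 h
      rw [hqh, one_mul, ← sub_eq_zero.1 hz] at h1
      have h2 := (mul_eq_right₀ (P.z_ne_zero _)).1 h1.symm
      have h3 := sub_smul_dslope (fun t => Complex.exp (2 * P.lnq * t)) 0 (p'.2 - p'.1 - h)
      rw [smul_eq_mul, sub_zero, mul_zero, Complex.exp_zero, h2, sub_self] at h3
      have h4 := (mul_eq_zero.1 h3).resolve_right hp'
      rw [sub_eq_zero.1 h4]
    · have := hE p'
      rw [P.qp_neg, hqh, inv_one, one_mul] at this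
      exact (this hz).symm
  · refine ((hf.analyticOnNhd p trivial).div hsub hp).congr ?_
    filter_upwards [hsub.continuousAt.eventually_ne hp] with p' hp'
    rw [if_neg hp']
    rfl

end Removable

/-! ### Operator product expansions of combinations of vertex operators -/

namespace Params

variable (P : Params)

/-- A finite linear combination of vertex operators. -/
def comb {ι : Type} [Fintype ι] (c : ι → ℂ → ℂ) (V : ι → Vtx) (u : ℂ) : Op := fun i j =>
  ∑ a, c a u * P.nexp ((V a).lin P u) i j

/-- The matrix elements of the normal ordered product of two vertex operators. -/
def normalElt (V W : Vtx) (i j : FockIndex) (p : ℂ × ℂ) : ℂ :=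
  P.nexp (V.lin P p.1 + W.lin P p.2) i j

theorem isExpPoly_normalElt (V W : Vtx) (i j : FockIndex) : IsExpPoly (P.normalElt V W i j) :=
  Vtx.isExpPoly_normalProduct P V W i j

variable {ι κ : Type} [Fintype ι] [Fintype κ]

theorem hasSum_comb_mul {c : ι → ℂ → ℂ} {V : ι → Vtx} {d : κ → ℂ → ℂ} {W : κ → Vtx}
    {φ : ι → κ → ℂ × ℂ → ℂ} (hφ : ∀ a b, ∃ R : ℝ, 0 < R ∧ (V a).Factor P (W b) R (φ a b)) :
    ∃ R : ℝ, 0 < R ∧ ∀ u v, R * ‖P.z v‖ < ‖P.z u‖ → ∀ i j,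
      HasSum (fun m => P.comb c V u i m * P.comb d W v m j)
        (∑ a, ∑ b, c a u * d b v * φ a b (u, v) * P.normalElt (V a) (W b) i j (u, v)) := by
  choose R hR hφ using hφ
  refine ⟨∑ a, ∑ b, R a b + 1, ?_, fun u v huv i j => ?_⟩
  · have : 0 ≤ ∑ a, ∑ b, R a b := sum_nonneg fun a _ => sum_nonneg fun b _ => (hR a b).le
    linarith
  · have hle : ∀ a b, R a b ≤ ∑ a, ∑ b, R a b + 1 := by
      intro a b
      have h1 := single_le_sum (f := fun b => R a b) (fun b _ => (hR a b).le) (mem_univ b)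
      have h2 := single_le_sum (f := fun a => ∑ b, R a b)
        (fun a _ => sum_nonneg fun b _ => (hR a b).le) (mem_univ a)
      linarith
    have hs := hasSum_sum (s := univ) fun a (_ : a ∈ univ) => hasSum_sum (s := univ)
      fun b (_ : b ∈ univ) =>
        (((hφ a b).mono P (hle a b)) u v huv i j).mul_left (c a u * d b v)
    refine hasSum_of_eq hs (fun m => ?_) ?_
    · simp only [comb, sum_mul_sum]
      exact sum_congr rfl fun a _ => sum_congr rfl fun b _ => by ring
    · exact sum_congr rfl fun a _ => sum_congr rfl fun b _ => by rw [normalElt]; ring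

theorem exists_z_eq (hq : P.lnq ≠ 0) {x : ℂ} (hx : x ≠ 0) : ∃ u, P.z u = x := by
  refine ⟨Complex.log x / (2 * P.lnq), ?_⟩
  rw [z, qp]
  have : 2 * (Complex.log x / (2 * P.lnq)) * P.lnq = Complex.log x := by field_simp
  rw [this, Complex.exp_log hx]

/-- Both orders are continued by the same numerator over the same denominator, up to ε. The
hypotheses isolate what must be checked for each pair: the scalar factors of the two orders (`e₁`,
`e₂`), nonvanishing of the denominator in the two regions, and the behaviour at the poles (`hG`). -/
theorem ope_of_factor (hq : P.lnq ≠ 0) {c : ι → ℂ → ℂ} {V : ι → Vtx} {d : κ → ℂ → ℂ} {W : κ → Vtx}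
    {φ ψ : ι → κ → ℂ × ℂ → ℂ} {ε : ℂ} {D : ℂ → ℂ → Op} {reg : Set (ℂ × ℂ)}
    {k : ι → κ → ℂ × ℂ → ℂ} {den : ℂ × ℂ → ℂ} {R₀ : ℝ}
    (hφ : ∀ a b, ∃ R : ℝ, 0 < R ∧ (V a).Factor P (W b) R (φ a b))
    (hψ : ∀ a b, ∃ R : ℝ, 0 < R ∧ (W b).Factor P (V a) R (ψ a b))
    (hε : ε * ε = 1) (hk : ∀ a b, IsExpPoly (k a b)) (hden : IsExpPoly den)
    (hR₀ : 0 < R₀) (hd₁ : ∀ u v, R₀ * ‖P.z v‖ < ‖P.z u‖ → den (u, v) ≠ 0)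
    (hd₂ : ∀ u v, R₀ * ‖P.z u‖ < ‖P.z v‖ → den (u, v) ≠ 0)
    (e₁ : ∀ a b u v, den (u, v) ≠ 0 → c a u * d b v * φ a b (u, v) = k a b (u, v) / den (u, v))
    (e₂ : ∀ a b u v, den (u, v) ≠ 0 →
      c a u * d b v * ψ a b (v, u) = ε * (k a b (u, v) / den (u, v)))
    (hG : ∀ i j, ∃ G : ℂ × ℂ → ℂ, AnalyticOnNhd ℂ G reg ∧ ∀ p ∈ reg, den p ≠ 0 →
      (∑ a, ∑ b, k a b p * P.normalElt (V a) (W b) i j p) / den p = D p.1 p.2 i j + G p) :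
    P.OPE (P.comb c V) (P.comb d W) ε D reg := by
  obtain ⟨R₁, hR₁, h₁⟩ := P.hasSum_comb_mul (c := c) (d := d) hφ
  obtain ⟨R₂, hR₂, h₂⟩ := P.hasSum_comb_mul (c := d) (d := c) (V := W) (W := V)
    (φ := fun b a => ψ a b) fun b a => hψ a b
  have hmono : ∀ {R R' x y : ℝ}, 0 ≤ x → R' ≤ R → R * x < y → R' * x < y := fun hx h h' =>
    lt_of_le_of_lt (mul_le_mul_of_nonneg_right h hx) h'
  -- A point with |z| = R₀ + 1 and |w| = 1 lies in the region where the denominator is known not to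
  -- vanish.
  have hne : ∃ p, den p ≠ 0 := by
    obtain ⟨u, hu⟩ := P.exists_z_eq hq (x := ((R₀ + 1 : ℝ) : ℂ)) (by
      rw [Ne, Complex.ofReal_eq_zero]; linarith)
    obtain ⟨v, hv⟩ := P.exists_z_eq hq (x := 1) one_ne_zero
    refine ⟨(u, v), hd₁ u v ?_⟩
    rw [hu, hv, norm_one, Complex.norm_real, Real.norm_of_nonneg (by linarith)]
    linarith
  have hnum : ∀ i j, IsExpPoly fun p => ∑ a, ∑ b, k a b p * P.normalElt (V a) (W b) i j p :=
    fun i j => .sum _ fun a _ => .sum _ fun b _ => (hk a b).mul (P.isExpPoly_normalElt _ _ _ _)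
  refine ⟨max R₀ (max R₁ R₂), lt_max_of_lt_left hR₀, fun i j => ?_⟩
  refine ⟨⟨_, den, (hnum i j).analyticOnNhd, hden.analyticOnNhd, hne⟩,
    ⟨_, den, ((IsExpPoly.const ε).mul (hnum i j)).analyticOnNhd, hden.analyticOnNhd, hne⟩,
    ?_, ?_, ?_, ?_⟩
  · intro u v huv
    have hd := hd₁ u v (hmono (norm_nonneg _) (by simp) huv)
    refine ⟨_, h₁ u v (hmono (norm_nonneg _) (by simp) huv) i j, ?_⟩
    simp only [mul_sum]
    refine sum_congr rfl fun a _ => sum_congr rfl fun b _ => ?_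
    rw [e₁ a b u v hd]
    field_simp
  · intro u v huv
    have hd := hd₂ u v (hmono (norm_nonneg _) (by simp) huv)
    refine ⟨_, h₂ v u (hmono (norm_nonneg _) (by simp) huv) i j, ?_⟩
    rw [sum_comm]
    simp only [mul_sum]
    refine sum_congr rfl fun a _ => sum_congr rfl fun b _ => ?_
    rw [mul_comm (d b v), e₂ a b u v hd]
    -- Normal ordering makes the order of the two factors irrelevant.
    have : P.normalElt (W b) (V a) i j (v, u) = P.normalElt (V a) (W b) i j (u, v) := by
      rw [normalElt, normalElt, add_comm]
    rw [this]
    field_simp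
  · intro p _ _
    simp only [Mero.val]
    rw [mul_div_assoc, ← mul_assoc, hε, one_mul]
  · obtain ⟨G, hG, h⟩ := hG i j
    exact ⟨G, hG, fun p hp hd => h p hp hd⟩

theorem regularOPE_of_factor (hq : P.lnq ≠ 0) {c : ι → ℂ → ℂ} {V : ι → Vtx} {d : κ → ℂ → ℂ}
    {W : κ → Vtx} {φ ψ : ι → κ → ℂ × ℂ → ℂ} {ε : ℂ} {k : ι → κ → ℂ × ℂ → ℂ}
    (hφ : ∀ a b, ∃ R : ℝ, 0 < R ∧ (V a).Factor P (W b) R (φ a b))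
    (hψ : ∀ a b, ∃ R : ℝ, 0 < R ∧ (W b).Factor P (V a) R (ψ a b))
    (hε : ε * ε = 1) (hk : ∀ a b, IsExpPoly (k a b))
    (e₁ : ∀ a b u v, c a u * d b v * φ a b (u, v) = k a b (u, v))
    (e₂ : ∀ a b u v, c a u * d b v * ψ a b (v, u) = ε * k a b (u, v)) :
    P.RegularOPE (P.comb c V) (P.comb d W) ε := by
  refine P.ope_of_factor hq (den := fun _ => 1) (R₀ := 1) hφ hψ hε hk (.const _) one_pos
    (fun _ _ _ => one_ne_zero) (fun _ _ _ => one_ne_zero) (fun a b u v _ => by rw [e₁, div_one])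
    (fun a b u v _ => by rw [e₂, div_one]) fun i j => ?_
  refine ⟨fun p => ∑ a, ∑ b, k a b p * P.normalElt (V a) (W b) i j p, ?_, fun p _ _ => ?_⟩
  · exact IsExpPoly.analyticOnNhd (.sum _ fun a _ => .sum _ fun b _ =>
      (hk a b).mul (P.isExpPoly_normalElt _ _ _ _))
  · simp

theorem z_sub_ne_zero {c : ℂ} {u v : ℂ} (h : ‖c‖ * ‖P.z v‖ < ‖P.z u‖) : P.z u - c * P.z v ≠ 0 := by
  intro h0
  rw [sub_eq_zero.1 h0, norm_mul] at h
  exact lt_irrefl _ h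

/-- The individual terms may have a pole at z = w; `hres` says that their numerators cancel in the
sum, on all sheets. -/
theorem regularOPE_of_factor_sub (hq : P.lnq ≠ 0) {c : ι → ℂ → ℂ} {V : ι → Vtx} {d : κ → ℂ → ℂ}
    {W : κ → Vtx} {φ ψ : ι → κ → ℂ × ℂ → ℂ} {ε : ℂ} {k : ι → κ → ℂ × ℂ → ℂ}
    (hφ : ∀ a b, ∃ R : ℝ, 0 < R ∧ (V a).Factor P (W b) R (φ a b))
    (hψ : ∀ a b, ∃ R : ℝ, 0 < R ∧ (W b).Factor P (V a) R (ψ a b))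
    (hε : ε * ε = 1) (hk : ∀ a b, IsExpPoly (k a b))
    (e₁ : ∀ a b u v, P.z u - P.z v ≠ 0 →
      c a u * d b v * φ a b (u, v) = k a b (u, v) / (P.z u - P.z v))
    (e₂ : ∀ a b u v, P.z u - P.z v ≠ 0 →
      c a u * d b v * ψ a b (v, u) = ε * (k a b (u, v) / (P.z u - P.z v)))
    (hres : ∀ i j u v, P.z u = P.z v →
      ∑ a, ∑ b, k a b (u, v) * P.normalElt (V a) (W b) i j (u, v) = 0) :
    P.RegularOPE (P.comb c V) (P.comb d W) ε := by
  refine P.ope_of_factor hq (den := fun p => P.z p.1 - P.z p.2) (R₀ := 1) hφ hψ hε hk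
    ((Vtx.isExpPoly_z_fst P).sub (Vtx.isExpPoly_z_snd P)) one_pos
    (fun u v h => ?_) (fun u v h => ?_) e₁ e₂ fun i j => ?_
  · have := P.z_sub_ne_zero (c := 1) (u := u) (v := v) (by rwa [norm_one])
    rwa [one_mul] at this
  · have := P.z_sub_ne_zero (c := 1) (u := v) (v := u) (by rwa [norm_one])
    rw [one_mul] at this
    exact sub_ne_zero.2 (sub_ne_zero.1 this).symm
  · obtain ⟨G, hG, h⟩ := exists_analytic_div_sub P hq
      (f := fun p => ∑ a, ∑ b, k a b p * P.normalElt (V a) (W b) i j p)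
      (.sum _ fun a _ => .sum _ fun b _ => (hk a b).mul (P.isExpPoly_normalElt _ _ _ _))
      (hres i j)
    refine ⟨G, hG, fun p _ hp => ?_⟩
    rw [h p hp]
    simp

/-- With T = s(z)/((q - q⁻¹)w), the total difference is T/(z - q^n w) - T/(z - q^{-n} w). The
conditions `hres₁` and `hres₂` say that ±T matches the numerators of the two poles on the principal
lines v = u ∓ n/2, so the differences are divisible there. -/
theorem diffOPE_of_factor (hq : P.lnq ≠ 0) {c : ι → ℂ → ℂ} {V : ι → Vtx} {d : κ → ℂ → ℂ}
    {W : κ → Vtx} {φ ψ : ι → κ → ℂ × ℂ → ℂ} {ε : ℂ} {n : ℝ} {S : Vtx}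
    {k₀ k₁ k₂ : ι → κ → ℂ × ℂ → ℂ}
    (hφ : ∀ a b, ∃ R : ℝ, 0 < R ∧ (V a).Factor P (W b) R (φ a b))
    (hψ : ∀ a b, ∃ R : ℝ, 0 < R ∧ (W b).Factor P (V a) R (ψ a b))
    (hε : ε * ε = 1) (hk₀ : ∀ a b, IsExpPoly (k₀ a b)) (hk₁ : ∀ a b, IsExpPoly (k₁ a b))
    (hk₂ : ∀ a b, IsExpPoly (k₂ a b))
    (e₁ : ∀ a b u v, P.z u - P.qp n * P.z v ≠ 0 → P.z u - P.qp (-n) * P.z v ≠ 0 →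
      c a u * d b v * φ a b (u, v) = k₀ a b (u, v) + k₁ a b (u, v) / (P.z u - P.qp n * P.z v)
        + k₂ a b (u, v) / (P.z u - P.qp (-n) * P.z v))
    (e₂ : ∀ a b u v, P.z u - P.qp n * P.z v ≠ 0 → P.z u - P.qp (-n) * P.z v ≠ 0 →
      c a u * d b v * ψ a b (v, u) = ε * (k₀ a b (u, v)
        + k₁ a b (u, v) / (P.z u - P.qp n * P.z v)
        + k₂ a b (u, v) / (P.z u - P.qp (-n) * P.z v)))
    (hres₁ : ∀ i j u, ∑ a, ∑ b, k₁ a b (u, u - n / 2) *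
      P.normalElt (V a) (W b) i j (u, u - n / 2)
        = (P.dq)⁻¹ * (P.z (u - n / 2))⁻¹ * P.nexp (S.lin P u) i j)
    (hres₂ : ∀ i j u, ∑ a, ∑ b, k₂ a b (u, u + n / 2) *
      P.normalElt (V a) (W b) i j (u, u + n / 2)
        = -((P.dq)⁻¹ * (P.z (u + n / 2))⁻¹ * P.nexp (S.lin P u) i j)) :
    P.DiffOPE (P.comb c V) (P.comb d W) ε n fun u => P.nexp (S.lin P u) := by
  have hz₁ := Vtx.isExpPoly_z_fst P
  have hz₂ := Vtx.isExpPoly_z_snd P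
  set A : ℂ × ℂ → ℂ := fun p => P.z p.1 - P.qp n * P.z p.2 with hA
  set B : ℂ × ℂ → ℂ := fun p => P.z p.1 - P.qp (-n) * P.z p.2 with hB
  have hAe : IsExpPoly A := by fun_prop
  have hBe : IsExpPoly B := by fun_prop
  -- The regular part and the two simple fractions are put over the common denominator A·B.
  refine P.ope_of_factor hq (den := fun p => A p * B p)
    (R₀ := ‖P.qp n‖ + ‖P.qp (-n)‖) (k := fun a b p => k₀ a b p * (A p * B p) + k₁ a b p * B p
      + k₂ a b p * A p) hφ hψ hε (fun a b => ?_) (hAe.mul hBe) ?_ ?_ ?_ ?_ ?_ fun i j => ?_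
  · have h0 := hk₀ a b
    have h1 := hk₁ a b
    have h2 := hk₂ a b
    fun_prop
  · have := norm_pos_iff.2 (P.qp_ne_zero n)
    positivity
  · intro u v h
    refine mul_ne_zero (P.z_sub_ne_zero ?_) (P.z_sub_ne_zero ?_) <;>
    · refine lt_of_le_of_lt ?_ h
      gcongr
      simp
  · intro u v h
    -- In the opposite region the linear factors are rewritten so that w is the dominant variable.
    have e1 : A (u, v) = -P.qp n * (P.z v - P.qp (-n) * P.z u) := by
      simp only [hA, P.qp_neg]; have := P.qp_ne_zero n; field_simp; ring
    have e2 : B (u, v) = -P.qp (-n) * (P.z v - P.qp n * P.z u) := by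
      simp only [hB, P.qp_neg]; have := P.qp_ne_zero n; field_simp; ring
    rw [e1, e2]
    refine mul_ne_zero (mul_ne_zero (neg_ne_zero.2 (P.qp_ne_zero _)) (P.z_sub_ne_zero ?_))
      (mul_ne_zero (neg_ne_zero.2 (P.qp_ne_zero _)) (P.z_sub_ne_zero ?_)) <;>
    · refine lt_of_le_of_lt ?_ h
      gcongr
      simp
  · intro a b u v h
    have ha := left_ne_zero_of_mul h
    have hb := right_ne_zero_of_mul h
    rw [e₁ a b u v ha hb]
    change _ + _ / A (u, v) + _ / B (u, v) = _
    field_simp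
  · intro a b u v h
    have ha := left_ne_zero_of_mul h
    have hb := right_ne_zero_of_mul h
    rw [e₂ a b u v ha hb]
    change ε * (_ + _ / A (u, v) + _ / B (u, v)) = _
    field_simp
  · have hs := Vtx.isExpPoly_single P S i j
    have hw := Vtx.isExpPoly_inv_z_snd P
    have hN : ∀ k : ι → κ → ℂ × ℂ → ℂ, (∀ a b, IsExpPoly (k a b)) →
        IsExpPoly fun p => ∑ a, ∑ b, k a b p * P.normalElt (V a) (W b) i j p := fun k hk =>
      .sum _ fun a _ => .sum _ fun b _ => (hk a b).mul (P.isExpPoly_normalElt _ _ _ _)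
    have hT : IsExpPoly fun p => (P.dq)⁻¹ * (P.z p.2)⁻¹ * P.nexp (S.lin P p.1) i j := by fun_prop
    -- The pole z = q^n w lies at v = u - n/2, and the pole z = q^{-n} w at v = u + n/2; hence the
    -- two opposite values of h.
    obtain ⟨G₁, hG₁, h₁⟩ := exists_analytic_div P hq ((hN k₁ hk₁).sub hT) (-(n / 2)) (by
      intro u
      rw [← sub_eq_add_neg, hres₁, sub_self])
    obtain ⟨G₂, hG₂, h₂⟩ := exists_analytic_div P hq ((hN k₂ hk₂).add hT) (n / 2) (by
      intro u
      rw [hres₂, neg_add_cancel])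
    have en : (2 * ((n : ℂ) / 2)) = n := by ring
    simp only [mul_neg, neg_neg, en] at hG₁ h₁ hG₂ h₂
    refine ⟨fun p => ∑ a, ∑ b, k₀ a b p * P.normalElt (V a) (W b) i j p + G₁ p + G₂ p, ?_, ?_⟩
    · refine (((hN k₀ hk₀).analyticOnNhd.mono (Set.subset_univ _)).add (hG₁.mono ?_)).add
        (hG₂.mono ?_)
      · intro p hp h
        rw [← sub_eq_add_neg]
        exact hp.2 h
      · intro p hp h
        exact hp.1 h
    · intro p _ hp
      have ha : A p ≠ 0 := left_ne_zero_of_mul hp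
      have hb : B p ≠ 0 := right_ne_zero_of_mul hp
      beta_reduce
      rw [← h₁ p ha, ← h₂ p hb]
      simp only [totalDiff, qDiff, P.z_add_half, P.z_sub_half, ← P.qp_neg]
      change _ = ((A p)⁻¹ * _ - (B p)⁻¹ * _) / _ + (_ + _ / A p + _ / B p)
      simp only [add_mul, sum_add_distrib, mul_right_comm _ (A p * B p),
        mul_right_comm _ (A p), mul_right_comm _ (B p), ← sum_mul]
      generalize P.nexp (S.lin P p.1) i j = s
      rw [div_eq_mul_inv _ (P.dq * P.z p.2), mul_inv P.dq]
      field_simp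
      ring

end Params

end ScreeningCurrents

end

/-! ### Reduction of all q-numbers to the three bases q, q^h and q^r -/

noncomputable section

namespace ScreeningCurrents

namespace Params

variable (P : Params)

/-- Half of `k + 2`. -/
def h : ℂ := (P.k + 2) / 2

/-- With h = (k + 2)/2 the fixed oscillator shifts in the fields become integral combinations of 1,
h and r, so their powers become Laurent monomials in q, q^h and q^r. -/
theorem half_k : (P.k : ℂ) / 2 = P.h - 1 := by rw [h]; ring

theorem half_k_add_two : ((P.k : ℂ) + 2) / 2 = P.h := rfl

theorem k_eq : (P.k : ℂ) = 2 * P.h - 2 := by rw [h]; ring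

theorem rs_eq : (P.rs : ℂ) = P.r - 2 * P.h + 2 := by
  rw [rs, Complex.ofReal_sub, k_eq]; ring

theorem qp_two_mul (s : ℂ) : P.qp (2 * s) = P.qp s ^ 2 := by
  rw [two_mul, qp_add, sq]

theorem qp_two : P.qp 2 = P.qp 1 ^ 2 := by
  rw [← qp_two_mul, mul_one]

/-! ### The `q`-numbers in the denominators -/

/-- The `q`-number `[n]`. -/
def d1 (n : ℕ) : ℂ := P.br (1 * n)

/-- The `q`-number `[(k + 2) n]`. -/
def dk (n : ℕ) : ℂ := P.br ((P.k + 2) * n)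

/-- The `q`-number `[r n]`. -/
def dr (n : ℕ) : ℂ := P.br (P.r * n)

/-- The `q`-number `[r* n]`. -/
def ds (n : ℕ) : ℂ := P.br (P.rs * n)

/-- These expansions are applied only after the q-numbers, treated as nonzero atoms, have been
cleared from the denominators. What is left is an identity of polynomials in q^n, q^{hn} and q^{rn}.
-/
theorem d1_eq (n : ℕ) : P.d1 n = (P.qp 1 ^ n - (P.qp 1 ^ n)⁻¹) / P.dq := by
  rw [d1, br_mul_natCast, inv_pow]

theorem dk_eq (n : ℕ) : P.dk n = ((P.qp P.h ^ n) ^ 2 - ((P.qp P.h ^ n) ^ 2)⁻¹) / P.dq := by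
  have : (P.k + 2 : ℂ) = 2 * P.h := by rw [h]; ring
  rw [dk, this, br_mul_natCast, qp_two_mul, inv_pow, pow_right_comm]

theorem dr_eq (n : ℕ) : P.dr n = (P.qp P.r ^ n - (P.qp P.r ^ n)⁻¹) / P.dq := by
  rw [dr, br_mul_natCast, inv_pow]

theorem ds_eq (n : ℕ) : P.ds n = (P.qp P.r ^ n * (P.qp 1 ^ n) ^ 2 / (P.qp P.h ^ n) ^ 2 -
    (P.qp P.h ^ n) ^ 2 / (P.qp P.r ^ n * (P.qp 1 ^ n) ^ 2)) / P.dq := by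
  rw [ds, rs_eq, br_mul_natCast, qp_add, qp_sub, qp_two_mul, qp_two]
  simp only [inv_pow, mul_pow, div_pow, mul_inv, inv_div, pow_right_comm _ 2 n]
  congr 2
  · ring
  · rw [div_mul_eq_div_div, div_eq_mul_inv _ ((P.qp 1 ^ n) ^ 2)]

theorem br_two_eq (n : ℕ) :
    P.br (2 * n) = ((P.qp 1 ^ n) ^ 2 - ((P.qp 1 ^ n) ^ 2)⁻¹) / P.dq := by
  rw [br_mul_natCast, qp_two, inv_pow, pow_right_comm]

theorem br_r_sub_eq (n : ℕ) : P.br ((P.r - 2 * P.h) * n)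
    = (P.qp P.r ^ n / (P.qp P.h ^ n) ^ 2 - (P.qp P.h ^ n) ^ 2 / P.qp P.r ^ n) / P.dq := by
  rw [br_mul_natCast, qp_sub, qp_two_mul, inv_div]
  simp only [div_pow, pow_right_comm _ 2 n]

theorem br_cast_one (n : ℕ) : P.br (((1 : ℝ) : ℂ) * n) = P.d1 n := by
  rw [Complex.ofReal_one]; rfl

theorem br_cast_two (n : ℕ) : P.br (((2 : ℝ) : ℂ) * n) = P.br (2 * n) := by
  rw [Complex.ofReal_ofNat]

theorem br_cast_k (n : ℕ) : P.br (((P.k + 2 : ℝ) : ℂ) * n) = P.dk n := by push_cast; rfl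

theorem br_cast_neg_k (n : ℕ) : P.br (((-(P.k + 2) : ℝ) : ℂ) * n) = -P.dk n := by
  rw [Complex.ofReal_neg, neg_mul, br_neg, br_cast_k]

theorem br_cast_r (n : ℕ) : P.br ((P.r : ℂ) * n) = P.dr n := rfl

theorem br_cast_rs (n : ℕ) : P.br ((P.rs : ℂ) * n) = P.ds n := rfl

theorem br_cast_r_sub (n : ℕ) :
    P.br (((P.r - P.k - 2 : ℝ) : ℂ) * n) = P.br ((P.r - 2 * P.h) * n) := by
  push_cast
  rw [k_eq]; congr 2; ring

theorem br_cast_neg_r_sub (n : ℕ) :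
    P.br (((-(P.r - P.k - 2) : ℝ) : ℂ) * n) = -P.br ((P.r - 2 * P.h) * n) := by
  rw [Complex.ofReal_neg, neg_mul, br_neg, br_cast_r_sub]

/-- The parameters are generic: all the denominators are nonzero. -/
structure Generic : Prop where
  lnq_re : P.lnq.re < 0
  r_pos : 0 < P.r
  rs_pos : 0 < P.rs
  k_ne : P.k ≠ -2

namespace Generic

variable {P}

theorem dq_ne (hP : P.Generic) : P.dq ≠ 0 := P.dq_ne_zero hP.lnq_re

theorem r_ne (hP : P.Generic) : (P.r : ℂ) ≠ 0 := by exact_mod_cast hP.r_pos.ne'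

theorem rs_ne (hP : P.Generic) : (P.rs : ℂ) ≠ 0 := by exact_mod_cast hP.rs_pos.ne'

theorem k_add_two_ne (hP : P.Generic) : (P.k + 2 : ℂ) ≠ 0 := by
  have : P.k + 2 ≠ 0 := fun h => hP.k_ne (by linarith)
  exact_mod_cast this

theorem d1_ne (hP : P.Generic) (n : ℕ+) : P.d1 n ≠ 0 := by
  have := P.br_ne_zero hP.lnq_re (s := 1) one_ne_zero n.pos
  rwa [Complex.ofReal_one] at this

theorem dr_ne (hP : P.Generic) (n : ℕ+) : P.dr n ≠ 0 := P.br_ne_zero hP.lnq_re hP.r_pos.ne' n.pos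

theorem ds_ne (hP : P.Generic) (n : ℕ+) : P.ds n ≠ 0 := P.br_ne_zero hP.lnq_re hP.rs_pos.ne' n.pos

theorem dk_ne (hP : P.Generic) (n : ℕ+) : P.dk n ≠ 0 := by
  have := P.br_ne_zero hP.lnq_re (s := P.k + 2) (fun h => hP.k_ne (by linarith)) n.pos
  rwa [Complex.ofReal_add, Complex.ofReal_ofNat] at this

end Generic

theorem z_add_h (u : ℂ) : P.z (u + P.h) = P.qp P.h ^ 2 * P.z u := by
  rw [← qp_two_mul, ← z_add_half, mul_div_cancel_left₀ _ two_ne_zero]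

theorem z_sub_h (u : ℂ) : P.z (u - P.h) = (P.qp P.h ^ 2)⁻¹ * P.z u := by
  rw [← qp_two_mul, ← z_sub_half, mul_div_cancel_left₀ _ two_ne_zero]

/-! ### Coefficients of the free fields -/

theorem zp_pos (u : ℂ) (n : ℕ+) : P.zp u (-((n : ℤ) : ℂ)) = (P.z u ^ (n : ℕ))⁻¹ := by
  rw [← exp_lnz, ← Complex.exp_nat_mul, ← Complex.exp_neg, zp]
  push_cast
  congr 1; ring

theorem zp_neg (u : ℂ) (n : ℕ+) : P.zp u (-((-(n : ℤ) : ℤ) : ℂ)) = P.z u ^ (n : ℕ) := by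
  rw [← exp_lnz, ← Complex.exp_nat_mul, zp]
  push_cast
  congr 1; ring

theorem pnat_pos (n : ℕ+) : (0 : ℤ) < (n : ℕ) := by exact_mod_cast n.pos

theorem oscSum_pos (x y : Boson) (f : ℤ → ℂ) (n : ℕ+) :
    oscSum x f (.osc y (n : ℤ)) = if y = x then f n else 0 := by
  have := (pnat_pos n).ne'
  simp [oscSum]

theorem oscSum_neg (x y : Boson) (f : ℤ → ℂ) (n : ℕ+) :
    oscSum x f (.osc y (-(n : ℤ))) = if y = x then f (-(n : ℤ)) else 0 := by
  have := (pnat_pos n).ne'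
  simp [oscSum]

theorem field_pos (x y : Boson) (u α : ℂ) (n : ℕ+) :
    P.field x u α (.osc y (n : ℤ))
      = if y = x then -((P.qp α)⁻¹ ^ (n : ℕ) * (P.z u ^ (n : ℕ))⁻¹ / P.d1 n) else 0 := by
  simp only [field, Pi.add_apply, Pi.neg_apply, Pi.smul_apply, oscSum_pos, zp_pos, Q, Pm, d1, one_mul]
  have : P.qp (-α * ((|((n : ℕ) : ℤ)| : ℤ) : ℂ)) = (P.qp α)⁻¹ ^ (n : ℕ) := by
    rw [abs_of_pos (pnat_pos n), ← qp_neg, ← qp_mul_natCast]; simp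
  rw [this]
  split_ifs <;> simp

theorem field_neg (x y : Boson) (u α : ℂ) (n : ℕ+) :
    P.field x u α (.osc y (-(n : ℤ)))
      = if y = x then (P.qp α)⁻¹ ^ (n : ℕ) * P.z u ^ (n : ℕ) / P.d1 n else 0 := by
  simp only [field, Pi.add_apply, Pi.neg_apply, Pi.smul_apply, oscSum_neg, zp_neg, Q, Pm]
  have : P.qp (-α * ((|(-((n : ℕ) : ℤ))| : ℤ) : ℂ)) = (P.qp α)⁻¹ ^ (n : ℕ) := by
    rw [abs_neg, abs_of_pos (pnat_pos n), ← qp_neg, ← qp_mul_natCast]; simp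
  rw [this]
  have h2 : P.br ((-((n : ℕ) : ℤ) : ℤ) : ℂ) = -P.d1 n := by
    rw [d1, ← br_neg]; simp
  rw [h2]
  split_ifs <;> simp [div_neg]

theorem fieldP_pos (x y : Boson) (u : ℂ) (n : ℕ+) :
    P.fieldP x u (.osc y (n : ℤ)) = if y = x then P.dq * (P.z u ^ (n : ℕ))⁻¹ else 0 := by
  simp only [fieldP, Pi.add_apply, Pi.smul_apply, oscSum_pos, zp_pos, Pm]
  simp

theorem fieldP_neg (x y : Boson) (u : ℂ) (n : ℕ+) :
    P.fieldP x u (.osc y (-(n : ℤ))) = 0 := by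
  simp only [fieldP, Pi.add_apply, Pi.smul_apply, oscSum_neg, zp_neg, Pm]
  simp

theorem fieldM_pos (x y : Boson) (u : ℂ) (n : ℕ+) :
    P.fieldM x u (.osc y (n : ℤ)) = 0 := by
  simp only [fieldM, Pi.add_apply, Pi.smul_apply, Pi.neg_apply, oscSum_pos, zp_pos, Pm]
  simp

theorem fieldM_neg (x y : Boson) (u : ℂ) (n : ℕ+) :
    P.fieldM x u (.osc y (-(n : ℤ))) = if y = x then -(P.dq * P.z u ^ (n : ℕ)) else 0 := by
  simp only [fieldM, Pi.add_apply, Pi.smul_apply, Pi.neg_apply, oscSum_neg, zp_neg, Pm]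
  split_ifs <;> simp_all

theorem twistP_pos (x y : Boson) (u : ℂ) (n : ℕ+) :
    P.twistP x u (.osc y (n : ℤ))
      = if y = x then -((P.z u ^ (n : ℕ))⁻¹ / P.dr n) else 0 := by
  simp only [twistP, Pi.neg_apply, oscSum_pos, zp_pos, dr]
  split_ifs <;> simp_all

theorem twistP_neg (x y : Boson) (u : ℂ) (n : ℕ+) :
    P.twistP x u (.osc y (-(n : ℤ))) = 0 := by
  simp only [twistP, Pi.neg_apply, oscSum_neg, zp_neg]
  simp

theorem twistM_pos (x y : Boson) (u : ℂ) (n : ℕ+) :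
    P.twistM x u (.osc y (n : ℤ)) = 0 := by
  simp only [twistM, oscSum_pos, zp_pos]
  simp

theorem twistM_neg (x y : Boson) (u : ℂ) (n : ℕ+) :
    P.twistM x u (.osc y (-(n : ℤ)))
      = if y = x then P.z u ^ (n : ℕ) / P.ds n else 0 := by
  simp only [twistM, oscSum_neg, zp_neg, ds]
  simp

theorem genP_pos (x y : Boson) (L M : List ℝ) (u α : ℂ) (n : ℕ+) :
    P.genP x L M u α (.osc y (n : ℤ))
      = if y = x then (L.map fun c : ℝ => P.br (c * (n : ℕ))).prod /
          (M.map fun c : ℝ => P.br (c * (n : ℕ))).prod * (P.z (u + α / 2) ^ (n : ℕ))⁻¹ else 0 := by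
  simp only [genP, oscSum_pos, zp_pos]
  simp [← List.map_eq_flatMap, List.map_map, Function.comp_def]

theorem genP_neg (x y : Boson) (L M : List ℝ) (u α : ℂ) (n : ℕ+) :
    P.genP x L M u α (.osc y (-(n : ℤ))) = 0 := by
  simp only [genP, oscSum_neg, zp_neg]
  simp

theorem genM_pos (x y : Boson) (L M : List ℝ) (u α : ℂ) (n : ℕ+) :
    P.genM x L M u α (.osc y (n : ℤ)) = 0 := by
  simp only [genM, oscSum_pos, zp_pos]
  simp

theorem genM_neg (x y : Boson) (L M : List ℝ) (u α : ℂ) (n : ℕ+) :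
    P.genM x L M u α (.osc y (-(n : ℤ)))
      = if y = x then (L.map fun c : ℝ => P.br (c * (n : ℕ))).prod /
          (M.map fun c : ℝ => P.br (c * (n : ℕ))).prod * P.z (u + α / 2) ^ (n : ℕ) else 0 := by
  simp only [genM, oscSum_neg, zp_neg]
  simp [← List.map_eq_flatMap, List.map_map, Function.comp_def]

theorem Q_osc (x y : Boson) (n : ℤ) : Q x (.osc y n) = 0 := by simp [Q]

theorem Pm_osc (x y : Boson) (n : ℤ) : Pm x (.osc y n) = 0 := by simp [Pm]

theorem Qhat_osc (y : Boson) (n : ℤ) : Qhat (.osc y n) = 0 := by simp [Qhat]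

theorem Phat_osc (y : Boson) (n : ℤ) : Phat (.osc y n) = 0 := by simp [Phat]

theorem One1_osc (y : Boson) (n : ℤ) : One1 (.osc y n) = 0 := by simp [One1]

end Params

theorem Vtx.lin_eq (P : Params) {V : Vtx} {u : ℂ} {X : Lin}
    (hpos : ∀ (x : Boson) (n : ℕ+), X (.osc x (n : ℤ)) = V.ann x n * (P.z u ^ (n : ℕ))⁻¹)
    (hneg : ∀ (x : Boson) (n : ℕ+), X (.osc x (-(n : ℤ))) = V.cre x n * P.z u ^ (n : ℕ))
    (hzero : ∀ x : Boson, X (.osc x 0) = 0) (hq : ∀ x, X (.qz x) = V.q x)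
    (hp : ∀ x, X (.pz x) = (V.p x).1 + (V.p x).2 * P.lnz u) (hqh : X .qhat = V.qh)
    (hph : X .phat = V.ph.1 + V.ph.2 * P.lnz u) (hone : X .one = -(V.ph.1 + V.ph.2 * P.lnz u)) :
    X = V.lin P u := by
  funext g
  cases g with
  | osc x n =>
    rcases lt_trichotomy n 0 with h | h | h
    · obtain ⟨m, rfl⟩ : ∃ m : ℕ+, n = -(m : ℤ) := ⟨⟨n.natAbs, by omega⟩, by
        change n = -((n.natAbs : ℕ) : ℤ); omega⟩
      rw [hneg, Vtx.lin_osc_neg]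
    · subst h
      rw [hzero]; simp [Vtx.lin]
    · obtain ⟨m, rfl⟩ : ∃ m : ℕ+, n = (m : ℤ) := ⟨⟨n.natAbs, by omega⟩, by
        change n = ((n.natAbs : ℕ) : ℤ); omega⟩
      rw [hpos, Vtx.lin_osc_pos]
  | qz x => exact hq x
  | pz x => exact hp x
  | qhat => exact hqh
  | phat => exact hph
  | one => exact hone

end ScreeningCurrents

end

noncomputable section

namespace ScreeningCurrents

namespace Params

variable (P : Params)

/-! ### The vertex operators in the currents -/

/-- The vertex operator `S_I`. -/
def vSI : Vtx where
  ann := fun | .c, n => -(P.d1 n)⁻¹ | _, _ => 0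
  cre := fun | .c, n => (P.d1 n)⁻¹ | _, _ => 0
  q := fun | .a => 1 / 2 | .b => 1 | .c => 1
  qh := -P.rs
  p := fun | .c => (0, 1) | _ => (0, 0)
  ph := (0, 0)

/-- The two vertex operators in `S_II`. -/
def vSII (s : ℂ) : Vtx where
  ann := fun
    | .a, n => (P.qp P.h)⁻¹ ^ n / P.dk n
    | .b, n => (P.qp 1)⁻¹ ^ n / P.d1 n
    | .c, n => (P.qp s)⁻¹ ^ n / P.d1 n
  cre := fun
    | .a, n => -((P.qp P.h)⁻¹ ^ n / P.dk n)
    | .b, n => -((P.qp 1)⁻¹ ^ n / P.d1 n)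
    | .c, n => -(P.qp s ^ n / P.d1 n)
  q := fun | .a => -(1 / (P.k + 2)) | .b => -1 | .c => -1
  qh := 0
  p := fun | .a => (0, -(1 / (P.k + 2))) | .b => (0, -1) | .c => (-(s * P.lnq), -1)
  ph := (0, 0)

/-- The two vertex operators in `E`. -/
def vE (s : ℂ) : Vtx where
  ann := fun
    | .a, _ => 0
    | .b, n => P.qp 1 ^ n / P.d1 n
    | .c, n => (P.qp s)⁻¹ ^ n / P.d1 n
  cre := fun
    | .a, n => P.qp (P.r - P.h) ^ n / P.ds n
    | .b, n => -(P.br ((P.r - 2 * P.h) * n) * (P.qp 1)⁻¹ ^ n / (P.ds n * P.d1 n))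
    | .c, n => -(P.qp s ^ n / P.d1 n)
  q := fun | .a => 0 | .b => -1 | .c => -1
  qh := 2
  p := fun | .a => (0, 0) | .b => (0, -1) | .c => (-(s * P.lnq), -1)
  ph := (0, -(1 / P.rs))

/-- The two vertex operators in `F`. -/
def vF (s : ℂ) : Vtx where
  ann := fun
    | .a, n => -(P.qp (s * P.r - P.h) ^ n / P.dr n)
    | .b, n => -(P.qp (s * (2 * P.h) - 1) ^ n / P.d1 n)
        - P.qp (P.r - 2 * P.h + 1) ^ n * P.br (2 * n) / (P.dr n * P.d1 n)
    | .c, n => -(P.qp (s * (2 * P.h - 1)) ^ n / P.d1 n)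
  cre := fun
    | .a, n => -((1 + s) / 2 * P.dq * (P.qp P.h)⁻¹ ^ n)
    | .b, n => P.qp (-s * (2 * P.h) - 1) ^ n / P.d1 n
    | .c, n => P.qp (-s * (2 * P.h - 1)) ^ n / P.d1 n
  q := fun | .a => 0 | .b => 1 | .c => 1
  qh := 0
  p := fun
    | .a => (-(s * P.lnq), 1 / P.r)
    | .b => (-(s * (P.k + 2) * P.lnq), 1 + 2 / P.r)
    | .c => (-(s * (P.k + 1) * P.lnq), 1)
  ph := (0, 1 / P.r)

/-- The vertex operator `H^+`. -/
def vHP : Vtx where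
  ann := fun
    | .a, n => -(P.qp (-P.r - 1) ^ n / P.dr n)
    | .b, n => -((P.qp 1 ^ n + (P.qp 1)⁻¹ ^ n) * P.qp (-P.r - P.h) ^ n / P.dr n)
    | .c, _ => 0
  cre := fun
    | .a, n => P.qp (P.r - 1) ^ n / P.ds n
    | .b, n => (P.qp 1 ^ n + (P.qp 1)⁻¹ ^ n) * P.qp (P.r - P.h) ^ n / P.ds n
    | .c, _ => 0
  q := fun _ => 0
  qh := 2
  p := fun
    | .a => ((1 - P.k / (2 * P.r)) * P.lnq, 1 / P.r)
    | .b => ((2 - P.k / P.r) * P.lnq, 2 / P.r)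
    | .c => (0, 0)
  ph := ((P.r - P.k / 2) * (1 / P.r - 1 / P.rs) * P.lnq, 1 / P.r - 1 / P.rs)

/-- The vertex operator `H^-`. -/
def vHM : Vtx where
  ann := fun
    | .a, n => -(P.qp (P.r - 2 * P.h + 1) ^ n / P.dr n)
    | .b, n => -((P.qp 1 ^ n + (P.qp 1)⁻¹ ^ n) * P.qp (P.r - 2 * P.h - P.h + 2) ^ n /
        P.dr n)
    | .c, _ => 0
  cre := fun
    | .a, n => P.qp (2 * P.h - P.r - 2 - 1) ^ n / P.ds n
    | .b, n => (P.qp 1 ^ n + (P.qp 1)⁻¹ ^ n) * P.qp (P.h - P.r - 2) ^ n / P.ds n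
    | .c, _ => 0
  q := fun _ => 0
  qh := 2
  p := fun
    | .a => (-(1 - P.k / (2 * P.r)) * P.lnq, 1 / P.r)
    | .b => (-(2 - P.k / P.r) * P.lnq, 2 / P.r)
    | .c => (0, 0)
  ph := (-((P.r - P.k / 2) * (1 / P.r - 1 / P.rs)) * P.lnq, 1 / P.r - 1 / P.rs)

/-- The vertex operator `s̃₁`. -/
def vs1 : Vtx where
  ann := fun | .b, n => P.qp 1 ^ n / P.d1 n | _, _ => 0
  cre := fun
    | .a, n => P.qp (P.r - P.h) ^ n / P.ds n
    | .b, n => -(P.br ((P.r - 2 * P.h) * n) * (P.qp 1)⁻¹ ^ n / (P.ds n * P.d1 n))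
    | .c, _ => 0
  q := fun | .a => 1 / 2 | _ => 0
  qh := 2 - P.rs
  p := fun | .b => (0, -1) | _ => (0, 0)
  ph := (0, -(1 / P.rs))

/-- The vertex operator `s̃₂`. -/
def vs2 : Vtx where
  ann := fun
    | .a, n => P.br ((P.r - 2 * P.h) * n) * (P.qp P.h)⁻¹ ^ n /
        (P.dk n * P.dr n)
    | .b, n => -(P.qp (P.r - 2 * P.h + 1) ^ n * P.br (2 * n) / (P.dr n * P.d1 n))
    | .c, _ => 0
  cre := fun | .a, n => -(P.qp P.h ^ n / P.dk n) | _, _ => 0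
  q := fun | .a => -(1 / (P.k + 2)) | _ => 0
  qh := 0
  p := fun
    | .a => (0, 1 / P.r - 1 / (P.k + 2))
    | .b => (0, 2 / P.r)
    | .c => (0, 0)
  ph := (0, 1 / P.r)

/-- The vertex operator `s̃₃`. -/
def vs3 : Vtx where
  ann := fun
    | .a, n => (P.qp P.h)⁻¹ ^ n / P.dk n
    | .b, n => (P.qp 1)⁻¹ ^ n / P.d1 n
    | .c, _ => 0
  cre := fun
    | .a, n => -((P.qp P.h)⁻¹ ^ n / P.dk n)
    | .b, n => -((P.qp 1)⁻¹ ^ n / P.d1 n)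
    | .c, _ => 0
  q := fun | .a => 1 / 2 - 1 / (P.k + 2) | _ => 0
  qh := -P.rs
  p := fun | .a => (0, -(1 / (P.k + 2))) | .b => (0, -1) | .c => (0, 0)
  ph := (0, 0)

end Params
end ScreeningCurrents
end

/-! ### Identification of the exponents of the fields with vertex operators -/

noncomputable section

set_option linter.unusedSimpArgs false
set_option linter.unusedTactic false
set_option linter.unreachableTactic false
set_option linter.unnecessarySeqFocus false

namespace ScreeningCurrents

namespace Params

variable (P : Params)

/-- The exponent of `U^+`. -/
def eUP (u : ℂ) : Lin := P.twistM .a (u + (P.rs + P.k / 2 - 1) / 2)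
    + (P.twistM .b (u + P.rs / 2) + P.twistM .b (u + (P.rs - 2) / 2))

/-- The exponent of `U^-`. -/
def eUM (u : ℂ) : Lin := P.twistP .a (u - (P.r - P.k / 2 - 1) / 2)
      + (P.twistP .b (u + (-(P.r - P.k - 1) + 1) / 2)
        + P.twistP .b (u + (-(P.r - P.k - 1) - 1) / 2))

/-- The coefficients of U⁺ and of b combine through (q^{r*n} + q^{(r*-2)n})[n] - q^n[r*n] =
-q^{-n}[(r*-2)n], where r* - 2 = r - 2h. -/
theorem lin_vE_one (hP : P.Generic) (u : ℂ) :
    P.eUP u + (P.fieldP .b u - P.bc (u + 1 / 2))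
        + ((2 : ℂ) • Qhat - (P.lnz u / P.rs) • (Phat - One1))
      = (P.vE 1).lin P u := by
  have g1 := P.qp_ne_zero 1
  have g2 := P.qp_ne_zero P.h
  have g3 := P.qp_ne_zero P.r
  have g4 := P.z_ne_zero u
  have g5 := hP.dq_ne
  have gr := hP.r_ne
  have gs := hP.rs_ne
  have gk := hP.k_add_two_ne
  refine Vtx.lin_eq P ?_ ?_ ?_ ?_ ?_ ?_ ?_ ?_
  -- The first two goals are the coefficients of the annihilation and of the creation modes.
  iterate 2
    · intro x n
      have h1 := hP.d1_ne n
      have h2 := hP.dk_ne n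
      have h3 := hP.dr_ne n
      have h4 := hP.ds_ne n
      rcases x with _ | _ | _ <;>
      simp only [eUP, eUM, vE, bc, SIIa, Pi.add_apply, Pi.sub_apply, Pi.neg_apply, Pi.smul_apply,
        smul_eq_mul, field_pos, field_neg, fieldP_pos, fieldP_neg, fieldM_pos, fieldM_neg,
        twistP_pos, twistP_neg, twistM_pos, twistM_neg, genP_pos, genP_neg, genM_pos, genM_neg,
        Q_osc, Pm_osc, Qhat_osc, Phat_osc, One1_osc, List.map_cons, List.map_nil, List.prod_cons,
        List.prod_nil, if_true, reduceCtorEq, if_false, mul_zero, add_zero, sub_zero, zero_add,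
        zero_sub, neg_zero, zero_mul, mul_one, neg_neg, qp_zero, inv_one, one_pow, one_mul,
        br_cast_one, br_cast_two, br_cast_k, br_cast_neg_k, br_cast_r, br_cast_rs, br_cast_r_sub,
        br_cast_neg_r_sub, br_two_eq, br_r_sub_eq, z_add_half, z_sub_half, mul_pow, div_pow,
        inv_pow, half_k, half_k_add_two, neg_mul,
        z_add_h, z_sub_h]
      all_goals try simp only [k_eq, rs_eq, qp_add, qp_sub, qp_neg, qp_two_mul, qp_two, mul_pow,
        div_pow, inv_pow, inv_inv]
      all_goals try field_simp
      all_goals try simp only [d1_eq, dk_eq, dr_eq, ds_eq]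
      all_goals try field_simp
      all_goals try ring
  all_goals try intro x
  · simp [eUP, eUM, bc, SIIa, field, fieldP, fieldM, twistP, twistM, genP, genM, oscSum, Q, Pm,
      Qhat, Phat, One1]
  iterate 2
    · rcases x with _ | _ | _ <;>
      simp [eUP, eUM, vE, bc, SIIa, field, fieldP, fieldM, twistP, twistM, genP, genM, oscSum, Q,
        Pm, Qhat, Phat, One1, lnz] <;> (try field_simp) <;> (try ring)
  iterate 3
    · simp [eUP, eUM, vE, bc, SIIa, field, fieldP, fieldM, twistP, twistM, genP, genM, oscSum, Q,
        Pm, Qhat, Phat, One1, lnz] <;> (try field_simp) <;> (try ring)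

/-- The oscillators of b have the same coefficients as in the other term, since q - q⁻¹ equals (q^n
- q^{-n})/[n]; the two terms of E differ only in the boson c. -/
theorem lin_vE_neg_one (hP : P.Generic) (u : ℂ) :
    P.eUP u + (P.fieldM .b u - P.bc (u - 1 / 2))
        + ((2 : ℂ) • Qhat - (P.lnz u / P.rs) • (Phat - One1))
      = (P.vE (-1)).lin P u := by
  have g1 := P.qp_ne_zero 1
  have g2 := P.qp_ne_zero P.h
  have g3 := P.qp_ne_zero P.r
  have g4 := P.z_ne_zero u
  have g5 := hP.dq_ne
  have gr := hP.r_ne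
  have gs := hP.rs_ne
  have gk := hP.k_add_two_ne
  refine Vtx.lin_eq P ?_ ?_ ?_ ?_ ?_ ?_ ?_ ?_
  iterate 2
    · intro x n
      have h1 := hP.d1_ne n
      have h2 := hP.dk_ne n
      have h3 := hP.dr_ne n
      have h4 := hP.ds_ne n
      rcases x with _ | _ | _ <;>
      simp only [eUP, eUM, vE, bc, SIIa, Pi.add_apply, Pi.sub_apply, Pi.neg_apply, Pi.smul_apply,
        smul_eq_mul, field_pos, field_neg, fieldP_pos, fieldP_neg, fieldM_pos, fieldM_neg,
        twistP_pos, twistP_neg, twistM_pos, twistM_neg, genP_pos, genP_neg, genM_pos, genM_neg,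
        Q_osc, Pm_osc, Qhat_osc, Phat_osc, One1_osc, List.map_cons, List.map_nil, List.prod_cons,
        List.prod_nil, if_true, reduceCtorEq, if_false, mul_zero, add_zero, sub_zero, zero_add,
        zero_sub, neg_zero, zero_mul, mul_one, neg_neg, qp_zero, inv_one, one_pow, one_mul,
        br_cast_one, br_cast_two, br_cast_k, br_cast_neg_k, br_cast_r, br_cast_rs, br_cast_r_sub,
        br_cast_neg_r_sub, br_two_eq, br_r_sub_eq, z_add_half, z_sub_half, mul_pow, div_pow,
        inv_pow, half_k, half_k_add_two, neg_mul,
        z_add_h, z_sub_h]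
      all_goals try simp only [k_eq, rs_eq, qp_add, qp_sub, qp_neg, qp_two_mul, qp_two, mul_pow,
        div_pow, inv_pow, inv_inv]
      all_goals try field_simp
      all_goals try simp only [d1_eq, dk_eq, dr_eq, ds_eq]
      all_goals try field_simp
      all_goals try ring
  all_goals try intro x
  · simp [eUP, eUM, bc, SIIa, field, fieldP, fieldM, twistP, twistM, genP, genM, oscSum, Q, Pm,
      Qhat, Phat, One1]
  iterate 2
    · rcases x with _ | _ | _ <;>
      simp [eUP, eUM, vE, bc, SIIa, field, fieldP, fieldM, twistP, twistM, genP, genM, oscSum, Q,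
        Pm, Qhat, Phat, One1, lnz] <;> (try field_simp) <;> (try ring)
  iterate 3
    · simp [eUP, eUM, vE, bc, SIIa, field, fieldP, fieldM, twistP, twistM, genP, genM, oscSum, Q,
        Pm, Qhat, Phat, One1, lnz] <;> (try field_simp) <;> (try ring)

theorem lin_vF_one (hP : P.Generic) (u : ℂ) :
    P.bc (u - (P.k + 1) / 2) + P.fieldM .a (u - (P.k + 2) / 2 / 2)
        + P.fieldM .b (u - (P.k + 2) / 2) + P.eUM u
        + ((P.lnz u / P.r) • ((2 : ℂ) • Pm .b + Pm .a) + (P.lnz u / P.r) • (Phat - One1))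
      = (P.vF 1).lin P u := by
  have g1 := P.qp_ne_zero 1
  have g2 := P.qp_ne_zero P.h
  have g3 := P.qp_ne_zero P.r
  have g4 := P.z_ne_zero u
  have g5 := hP.dq_ne
  have gr := hP.r_ne
  have gs := hP.rs_ne
  have gk := hP.k_add_two_ne
  refine Vtx.lin_eq P ?_ ?_ ?_ ?_ ?_ ?_ ?_ ?_
  iterate 2
    · intro x n
      have h1 := hP.d1_ne n
      have h2 := hP.dk_ne n
      have h3 := hP.dr_ne n
      have h4 := hP.ds_ne n
      rcases x with _ | _ | _ <;>
      simp only [eUP, eUM, vF, bc, SIIa, Pi.add_apply, Pi.sub_apply, Pi.neg_apply, Pi.smul_apply,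
        smul_eq_mul, field_pos, field_neg, fieldP_pos, fieldP_neg, fieldM_pos, fieldM_neg,
        twistP_pos, twistP_neg, twistM_pos, twistM_neg, genP_pos, genP_neg, genM_pos, genM_neg,
        Q_osc, Pm_osc, Qhat_osc, Phat_osc, One1_osc, List.map_cons, List.map_nil, List.prod_cons,
        List.prod_nil, if_true, reduceCtorEq, if_false, mul_zero, add_zero, sub_zero, zero_add,
        zero_sub, neg_zero, zero_mul, mul_one, neg_neg, qp_zero, inv_one, one_pow, one_mul,
        br_cast_one, br_cast_two, br_cast_k, br_cast_neg_k, br_cast_r, br_cast_rs, br_cast_r_sub,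
        br_cast_neg_r_sub, br_two_eq, br_r_sub_eq, z_add_half, z_sub_half, mul_pow, div_pow,
        inv_pow, half_k, half_k_add_two, neg_mul,
        z_add_h, z_sub_h]
      all_goals try simp only [k_eq, rs_eq, qp_add, qp_sub, qp_neg, qp_two_mul, qp_two, mul_pow,
        div_pow, inv_pow, inv_inv]
      all_goals try field_simp
      all_goals try simp only [d1_eq, dk_eq, dr_eq, ds_eq]
      all_goals try field_simp
      all_goals try ring
  all_goals try intro x
  · simp [eUP, eUM, bc, SIIa, field, fieldP, fieldM, twistP, twistM, genP, genM, oscSum, Q, Pm,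
      Qhat, Phat, One1]
  iterate 2
    · rcases x with _ | _ | _ <;>
      simp [eUP, eUM, vF, bc, SIIa, field, fieldP, fieldM, twistP, twistM, genP, genM, oscSum, Q,
        Pm, Qhat, Phat, One1, lnz] <;> (try field_simp) <;> (try ring)
  iterate 3
    · simp [eUP, eUM, vF, bc, SIIa, field, fieldP, fieldM, twistP, twistM, genP, genM, oscSum, Q,
        Pm, Qhat, Phat, One1, lnz] <;> (try field_simp) <;> (try ring)

/-- The extra modes of a in this term turn q^{(r-h)n}/[rn] into q^{(-r-h)n}/[rn], because (q -
q⁻¹)[rn] = q^{rn} - q^{-rn}. This accounts for the exponent s·r - h in `vF`. -/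
theorem lin_vF_neg_one (hP : P.Generic) (u : ℂ) :
    P.bc (u + (P.k + 1) / 2) + P.fieldP .a (u + (P.k + 2) / 2 / 2)
        + P.fieldP .b (u + (P.k + 2) / 2) + P.eUM u
        + ((P.lnz u / P.r) • ((2 : ℂ) • Pm .b + Pm .a) + (P.lnz u / P.r) • (Phat - One1))
      = (P.vF (-1)).lin P u := by
  have g1 := P.qp_ne_zero 1
  have g2 := P.qp_ne_zero P.h
  have g3 := P.qp_ne_zero P.r
  have g4 := P.z_ne_zero u
  have g5 := hP.dq_ne
  have gr := hP.r_ne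
  have gs := hP.rs_ne
  have gk := hP.k_add_two_ne
  refine Vtx.lin_eq P ?_ ?_ ?_ ?_ ?_ ?_ ?_ ?_
  iterate 2
    · intro x n
      have h1 := hP.d1_ne n
      have h2 := hP.dk_ne n
      have h3 := hP.dr_ne n
      have h4 := hP.ds_ne n
      rcases x with _ | _ | _ <;>
      simp only [eUP, eUM, vF, bc, SIIa, Pi.add_apply, Pi.sub_apply, Pi.neg_apply, Pi.smul_apply,
        smul_eq_mul, field_pos, field_neg, fieldP_pos, fieldP_neg, fieldM_pos, fieldM_neg,
        twistP_pos, twistP_neg, twistM_pos, twistM_neg, genP_pos, genP_neg, genM_pos, genM_neg,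
        Q_osc, Pm_osc, Qhat_osc, Phat_osc, One1_osc, List.map_cons, List.map_nil, List.prod_cons,
        List.prod_nil, if_true, reduceCtorEq, if_false, mul_zero, add_zero, sub_zero, zero_add,
        zero_sub, neg_zero, zero_mul, mul_one, neg_neg, qp_zero, inv_one, one_pow, one_mul,
        br_cast_one, br_cast_two, br_cast_k, br_cast_neg_k, br_cast_r, br_cast_rs, br_cast_r_sub,
        br_cast_neg_r_sub, br_two_eq, br_r_sub_eq, z_add_half, z_sub_half, mul_pow, div_pow,
        inv_pow, half_k, half_k_add_two, neg_mul,
        z_add_h, z_sub_h]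
      all_goals try simp only [k_eq, rs_eq, qp_add, qp_sub, qp_neg, qp_two_mul, qp_two, mul_pow,
        div_pow, inv_pow, inv_inv]
      all_goals try field_simp
      all_goals try simp only [d1_eq, dk_eq, dr_eq, ds_eq]
      all_goals try field_simp
      all_goals try ring
  all_goals try intro x
  · simp [eUP, eUM, bc, SIIa, field, fieldP, fieldM, twistP, twistM, genP, genM, oscSum, Q, Pm,
      Qhat, Phat, One1]
  iterate 2
    · rcases x with _ | _ | _ <;>
      simp [eUP, eUM, vF, bc, SIIa, field, fieldP, fieldM, twistP, twistM, genP, genM, oscSum, Q,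
        Pm, Qhat, Phat, One1, lnz] <;> (try field_simp) <;> (try ring)
  iterate 3
    · simp [eUP, eUM, vF, bc, SIIa, field, fieldP, fieldM, twistP, twistM, genP, genM, oscSum, Q,
        Pm, Qhat, Phat, One1, lnz] <;> (try field_simp) <;> (try ring)

theorem lin_vHP (hP : P.Generic) (u : ℂ) :
    P.eUP (u + P.k / 2 / 2) + (P.fieldP .b (u + P.k / 2 / 2) + P.fieldP .a (u + 1 / 2)
          + P.fieldP .b (u + (P.k / 2 + 2) / 2)) + P.eUM (u - P.k / 2 / 2)
        + ((2 : ℂ) • Qhat + (P.lnz (u - P.k / 2 / 2) / P.r) • ((2 : ℂ) • Pm .b + Pm .a)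
          + (P.lnz (u + (P.r - P.k / 2) / 2) * (1 / P.r - 1 / P.rs)) • (Phat - One1))
      = (P.vHP).lin P u := by
  have g1 := P.qp_ne_zero 1
  have g2 := P.qp_ne_zero P.h
  have g3 := P.qp_ne_zero P.r
  have g4 := P.z_ne_zero u
  have g5 := hP.dq_ne
  have gr := hP.r_ne
  have gs := hP.rs_ne
  have gk := hP.k_add_two_ne
  refine Vtx.lin_eq P ?_ ?_ ?_ ?_ ?_ ?_ ?_ ?_
  iterate 2
    · intro x n
      have h1 := hP.d1_ne n
      have h2 := hP.dk_ne n
      have h3 := hP.dr_ne n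
      have h4 := hP.ds_ne n
      rcases x with _ | _ | _ <;>
      simp only [eUP, eUM, vHP, bc, SIIa, Pi.add_apply, Pi.sub_apply, Pi.neg_apply, Pi.smul_apply,
        smul_eq_mul, field_pos, field_neg, fieldP_pos, fieldP_neg, fieldM_pos, fieldM_neg,
        twistP_pos, twistP_neg, twistM_pos, twistM_neg, genP_pos, genP_neg, genM_pos, genM_neg,
        Q_osc, Pm_osc, Qhat_osc, Phat_osc, One1_osc, List.map_cons, List.map_nil, List.prod_cons,
        List.prod_nil, if_true, reduceCtorEq, if_false, mul_zero, add_zero, sub_zero, zero_add,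
        zero_sub, neg_zero, zero_mul, mul_one, neg_neg, qp_zero, inv_one, one_pow, one_mul,
        br_cast_one, br_cast_two, br_cast_k, br_cast_neg_k, br_cast_r, br_cast_rs, br_cast_r_sub,
        br_cast_neg_r_sub, br_two_eq, br_r_sub_eq, z_add_half, z_sub_half, mul_pow, div_pow,
        inv_pow, half_k, half_k_add_two, neg_mul,
        z_add_h, z_sub_h]
      all_goals try simp only [k_eq, rs_eq, qp_add, qp_sub, qp_neg, qp_two_mul, qp_two, mul_pow,
        div_pow, inv_pow, inv_inv]
      all_goals try field_simp
      all_goals try simp only [d1_eq, dk_eq, dr_eq, ds_eq]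
      all_goals try field_simp
      all_goals try ring
  all_goals try intro x
  · simp [eUP, eUM, bc, SIIa, field, fieldP, fieldM, twistP, twistM, genP, genM, oscSum, Q, Pm,
      Qhat, Phat, One1]
  iterate 2
    · rcases x with _ | _ | _ <;>
      simp [eUP, eUM, vHP, bc, SIIa, field, fieldP, fieldM, twistP, twistM, genP, genM, oscSum, Q,
        Pm, Qhat, Phat, One1, lnz] <;> (try field_simp) <;> (try ring)
  iterate 3
    · simp [eUP, eUM, vHP, bc, SIIa, field, fieldP, fieldM, twistP, twistM, genP, genM, oscSum, Q,
        Pm, Qhat, Phat, One1, lnz] <;> (try field_simp) <;> (try ring)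

theorem lin_vHM (hP : P.Generic) (u : ℂ) :
    P.eUP (u - P.k / 2 / 2) + (P.fieldM .b (u - P.k / 2 / 2) + P.fieldM .a (u - 1 / 2)
          + P.fieldM .b (u - (P.k / 2 + 2) / 2)) + P.eUM (u + P.k / 2 / 2)
        + ((2 : ℂ) • Qhat + (P.lnz (u + P.k / 2 / 2) / P.r) • ((2 : ℂ) • Pm .b + Pm .a)
          + (P.lnz (u - (P.r - P.k / 2) / 2) * (1 / P.r - 1 / P.rs)) • (Phat - One1))
      = (P.vHM).lin P u := by
  have g1 := P.qp_ne_zero 1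
  have g2 := P.qp_ne_zero P.h
  have g3 := P.qp_ne_zero P.r
  have g4 := P.z_ne_zero u
  have g5 := hP.dq_ne
  have gr := hP.r_ne
  have gs := hP.rs_ne
  have gk := hP.k_add_two_ne
  refine Vtx.lin_eq P ?_ ?_ ?_ ?_ ?_ ?_ ?_ ?_
  iterate 2
    · intro x n
      have h1 := hP.d1_ne n
      have h2 := hP.dk_ne n
      have h3 := hP.dr_ne n
      have h4 := hP.ds_ne n
      rcases x with _ | _ | _ <;>
      simp only [eUP, eUM, vHM, bc, SIIa, Pi.add_apply, Pi.sub_apply, Pi.neg_apply, Pi.smul_apply,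
        smul_eq_mul, field_pos, field_neg, fieldP_pos, fieldP_neg, fieldM_pos, fieldM_neg,
        twistP_pos, twistP_neg, twistM_pos, twistM_neg, genP_pos, genP_neg, genM_pos, genM_neg,
        Q_osc, Pm_osc, Qhat_osc, Phat_osc, One1_osc, List.map_cons, List.map_nil, List.prod_cons,
        List.prod_nil, if_true, reduceCtorEq, if_false, mul_zero, add_zero, sub_zero, zero_add,
        zero_sub, neg_zero, zero_mul, mul_one, neg_neg, qp_zero, inv_one, one_pow, one_mul,
        br_cast_one, br_cast_two, br_cast_k, br_cast_neg_k, br_cast_r, br_cast_rs, br_cast_r_sub,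
        br_cast_neg_r_sub, br_two_eq, br_r_sub_eq, z_add_half, z_sub_half, mul_pow, div_pow,
        inv_pow, half_k, half_k_add_two, neg_mul,
        z_add_h, z_sub_h]
      all_goals try simp only [k_eq, rs_eq, qp_add, qp_sub, qp_neg, qp_two_mul, qp_two, mul_pow,
        div_pow, inv_pow, inv_inv]
      all_goals try field_simp
      all_goals try simp only [d1_eq, dk_eq, dr_eq, ds_eq]
      all_goals try field_simp
      all_goals try ring
  all_goals try intro x
  · simp [eUP, eUM, bc, SIIa, field, fieldP, fieldM, twistP, twistM, genP, genM, oscSum, Q, Pm,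
      Qhat, Phat, One1]
  iterate 2
    · rcases x with _ | _ | _ <;>
      simp [eUP, eUM, vHM, bc, SIIa, field, fieldP, fieldM, twistP, twistM, genP, genM, oscSum, Q,
        Pm, Qhat, Phat, One1, lnz] <;> (try field_simp) <;> (try ring)
  iterate 3
    · simp [eUP, eUM, vHM, bc, SIIa, field, fieldP, fieldM, twistP, twistM, genP, genM, oscSum, Q,
        Pm, Qhat, Phat, One1, lnz] <;> (try field_simp) <;> (try ring)

theorem lin_vSI (hP : P.Generic) (u : ℂ) :
    P.field .c u 0 + (1 / 2 : ℂ) • Q .a + Q .b - (P.rs : ℂ) • Qhat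
      = (P.vSI).lin P u := by
  have g1 := P.qp_ne_zero 1
  have g2 := P.qp_ne_zero P.h
  have g3 := P.qp_ne_zero P.r
  have g4 := P.z_ne_zero u
  have g5 := hP.dq_ne
  have gr := hP.r_ne
  have gs := hP.rs_ne
  have gk := hP.k_add_two_ne
  refine Vtx.lin_eq P ?_ ?_ ?_ ?_ ?_ ?_ ?_ ?_
  iterate 2
    · intro x n
      have h1 := hP.d1_ne n
      have h2 := hP.dk_ne n
      have h3 := hP.dr_ne n
      have h4 := hP.ds_ne n
      rcases x with _ | _ | _ <;>
      simp only [eUP, eUM, vSI, bc, SIIa, Pi.add_apply, Pi.sub_apply, Pi.neg_apply, Pi.smul_apply,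
        smul_eq_mul, field_pos, field_neg, fieldP_pos, fieldP_neg, fieldM_pos, fieldM_neg,
        twistP_pos, twistP_neg, twistM_pos, twistM_neg, genP_pos, genP_neg, genM_pos, genM_neg,
        Q_osc, Pm_osc, Qhat_osc, Phat_osc, One1_osc, List.map_cons, List.map_nil, List.prod_cons,
        List.prod_nil, if_true, reduceCtorEq, if_false, mul_zero, add_zero, sub_zero, zero_add,
        zero_sub, neg_zero, zero_mul, mul_one, neg_neg, qp_zero, inv_one, one_pow, one_mul,
        br_cast_one, br_cast_two, br_cast_k, br_cast_neg_k, br_cast_r, br_cast_rs, br_cast_r_sub,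
        br_cast_neg_r_sub, br_two_eq, br_r_sub_eq, z_add_half, z_sub_half, mul_pow, div_pow,
        inv_pow, half_k, half_k_add_two, neg_mul,
        z_add_h, z_sub_h]
      all_goals try simp only [k_eq, rs_eq, qp_add, qp_sub, qp_neg, qp_two_mul, qp_two, mul_pow,
        div_pow, inv_pow, inv_inv]
      all_goals try field_simp
      all_goals try simp only [d1_eq, dk_eq, dr_eq, ds_eq]
      all_goals try field_simp
      all_goals try ring
  all_goals try intro x
  · simp [eUP, eUM, bc, SIIa, field, fieldP, fieldM, twistP, twistM, genP, genM, oscSum, Q, Pm,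
      Qhat, Phat, One1]
  iterate 2
    · rcases x with _ | _ | _ <;>
      simp [eUP, eUM, vSI, bc, SIIa, field, fieldP, fieldM, twistP, twistM, genP, genM, oscSum, Q,
        Pm, Qhat, Phat, One1, lnz] <;> (try field_simp) <;> (try ring)
  iterate 3
    · simp [eUP, eUM, vSI, bc, SIIa, field, fieldP, fieldM, twistP, twistM, genP, genM, oscSum, Q,
        Pm, Qhat, Phat, One1, lnz] <;> (try field_simp) <;> (try ring)

theorem lin_vSII_one (hP : P.Generic) (u : ℂ) :
    P.SIIa u + (-P.fieldM .b u - P.bc (u + 1 / 2))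
      = (P.vSII 1).lin P u := by
  have g1 := P.qp_ne_zero 1
  have g2 := P.qp_ne_zero P.h
  have g3 := P.qp_ne_zero P.r
  have g4 := P.z_ne_zero u
  have g5 := hP.dq_ne
  have gr := hP.r_ne
  have gs := hP.rs_ne
  have gk := hP.k_add_two_ne
  refine Vtx.lin_eq P ?_ ?_ ?_ ?_ ?_ ?_ ?_ ?_
  iterate 2
    · intro x n
      have h1 := hP.d1_ne n
      have h2 := hP.dk_ne n
      have h3 := hP.dr_ne n
      have h4 := hP.ds_ne n
      rcases x with _ | _ | _ <;>
      simp only [eUP, eUM, vSII, bc, SIIa, Pi.add_apply, Pi.sub_apply, Pi.neg_apply, Pi.smul_apply,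
        smul_eq_mul, field_pos, field_neg, fieldP_pos, fieldP_neg, fieldM_pos, fieldM_neg,
        twistP_pos, twistP_neg, twistM_pos, twistM_neg, genP_pos, genP_neg, genM_pos, genM_neg,
        Q_osc, Pm_osc, Qhat_osc, Phat_osc, One1_osc, List.map_cons, List.map_nil, List.prod_cons,
        List.prod_nil, if_true, reduceCtorEq, if_false, mul_zero, add_zero, sub_zero, zero_add,
        zero_sub, neg_zero, zero_mul, mul_one, neg_neg, qp_zero, inv_one, one_pow, one_mul,
        br_cast_one, br_cast_two, br_cast_k, br_cast_neg_k, br_cast_r, br_cast_rs, br_cast_r_sub,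
        br_cast_neg_r_sub, br_two_eq, br_r_sub_eq, z_add_half, z_sub_half, mul_pow, div_pow,
        inv_pow, half_k, half_k_add_two, neg_mul,
        z_add_h, z_sub_h]
      all_goals try simp only [k_eq, rs_eq, qp_add, qp_sub, qp_neg, qp_two_mul, qp_two, mul_pow,
        div_pow, inv_pow, inv_inv]
      all_goals try field_simp
      all_goals try simp only [d1_eq, dk_eq, dr_eq, ds_eq]
      all_goals try field_simp
      all_goals try ring
  all_goals try intro x
  · simp [eUP, eUM, bc, SIIa, field, fieldP, fieldM, twistP, twistM, genP, genM, oscSum, Q, Pm,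
      Qhat, Phat, One1]
  iterate 2
    · rcases x with _ | _ | _ <;>
      simp [eUP, eUM, vSII, bc, SIIa, field, fieldP, fieldM, twistP, twistM, genP, genM, oscSum, Q,
        Pm, Qhat, Phat, One1, lnz] <;> (try field_simp) <;> (try ring)
  iterate 3
    · simp [eUP, eUM, vSII, bc, SIIa, field, fieldP, fieldM, twistP, twistM, genP, genM, oscSum, Q,
        Pm, Qhat, Phat, One1, lnz] <;> (try field_simp) <;> (try ring)

theorem lin_vSII_neg_one (hP : P.Generic) (u : ℂ) :
    P.SIIa u + (-P.fieldP .b u - P.bc (u - 1 / 2))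
      = (P.vSII (-1)).lin P u := by
  have g1 := P.qp_ne_zero 1
  have g2 := P.qp_ne_zero P.h
  have g3 := P.qp_ne_zero P.r
  have g4 := P.z_ne_zero u
  have g5 := hP.dq_ne
  have gr := hP.r_ne
  have gs := hP.rs_ne
  have gk := hP.k_add_two_ne
  refine Vtx.lin_eq P ?_ ?_ ?_ ?_ ?_ ?_ ?_ ?_
  iterate 2
    · intro x n
      have h1 := hP.d1_ne n
      have h2 := hP.dk_ne n
      have h3 := hP.dr_ne n
      have h4 := hP.ds_ne n
      rcases x with _ | _ | _ <;>
      simp only [eUP, eUM, vSII, bc, SIIa, Pi.add_apply, Pi.sub_apply, Pi.neg_apply, Pi.smul_apply,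
        smul_eq_mul, field_pos, field_neg, fieldP_pos, fieldP_neg, fieldM_pos, fieldM_neg,
        twistP_pos, twistP_neg, twistM_pos, twistM_neg, genP_pos, genP_neg, genM_pos, genM_neg,
        Q_osc, Pm_osc, Qhat_osc, Phat_osc, One1_osc, List.map_cons, List.map_nil, List.prod_cons,
        List.prod_nil, if_true, reduceCtorEq, if_false, mul_zero, add_zero, sub_zero, zero_add,
        zero_sub, neg_zero, zero_mul, mul_one, neg_neg, qp_zero, inv_one, one_pow, one_mul,
        br_cast_one, br_cast_two, br_cast_k, br_cast_neg_k, br_cast_r, br_cast_rs, br_cast_r_sub,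
        br_cast_neg_r_sub, br_two_eq, br_r_sub_eq, z_add_half, z_sub_half, mul_pow, div_pow,
        inv_pow, half_k, half_k_add_two, neg_mul,
        z_add_h, z_sub_h]
      all_goals try simp only [k_eq, rs_eq, qp_add, qp_sub, qp_neg, qp_two_mul, qp_two, mul_pow,
        div_pow, inv_pow, inv_inv]
      all_goals try field_simp
      all_goals try simp only [d1_eq, dk_eq, dr_eq, ds_eq]
      all_goals try field_simp
      all_goals try ring
  all_goals try intro x
  · simp [eUP, eUM, bc, SIIa, field, fieldP, fieldM, twistP, twistM, genP, genM, oscSum, Q, Pm,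
      Qhat, Phat, One1]
  iterate 2
    · rcases x with _ | _ | _ <;>
      simp [eUP, eUM, vSII, bc, SIIa, field, fieldP, fieldM, twistP, twistM, genP, genM, oscSum, Q,
        Pm, Qhat, Phat, One1, lnz] <;> (try field_simp) <;> (try ring)
  iterate 3
    · simp [eUP, eUM, vSII, bc, SIIa, field, fieldP, fieldM, twistP, twistM, genP, genM, oscSum, Q,
        Pm, Qhat, Phat, One1, lnz] <;> (try field_simp) <;> (try ring)

theorem lin_vs1 (hP : P.Generic) (u : ℂ) :
    P.genM .a [] [P.rs] u (P.r - P.k / 2 - 1) + (1 / 2 : ℂ) • Q .a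
        + P.genM .b [-(P.r - P.k - 2)] [P.rs, 1] u (-1) - P.lnz u • Pm .b + P.genP .b [] [1] u (-1)
        + (2 - P.rs : ℂ) • Qhat - (P.lnz u / P.rs) • (Phat - One1)
      = (P.vs1).lin P u := by
  have g1 := P.qp_ne_zero 1
  have g2 := P.qp_ne_zero P.h
  have g3 := P.qp_ne_zero P.r
  have g4 := P.z_ne_zero u
  have g5 := hP.dq_ne
  have gr := hP.r_ne
  have gs := hP.rs_ne
  have gk := hP.k_add_two_ne
  refine Vtx.lin_eq P ?_ ?_ ?_ ?_ ?_ ?_ ?_ ?_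
  iterate 2
    · intro x n
      have h1 := hP.d1_ne n
      have h2 := hP.dk_ne n
      have h3 := hP.dr_ne n
      have h4 := hP.ds_ne n
      rcases x with _ | _ | _ <;>
      simp only [eUP, eUM, vs1, bc, SIIa, Pi.add_apply, Pi.sub_apply, Pi.neg_apply, Pi.smul_apply,
        smul_eq_mul, field_pos, field_neg, fieldP_pos, fieldP_neg, fieldM_pos, fieldM_neg,
        twistP_pos, twistP_neg, twistM_pos, twistM_neg, genP_pos, genP_neg, genM_pos, genM_neg,
        Q_osc, Pm_osc, Qhat_osc, Phat_osc, One1_osc, List.map_cons, List.map_nil, List.prod_cons,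
        List.prod_nil, if_true, reduceCtorEq, if_false, mul_zero, add_zero, sub_zero, zero_add,
        zero_sub, neg_zero, zero_mul, mul_one, neg_neg, qp_zero, inv_one, one_pow, one_mul,
        br_cast_one, br_cast_two, br_cast_k, br_cast_neg_k, br_cast_r, br_cast_rs, br_cast_r_sub,
        br_cast_neg_r_sub, br_two_eq, br_r_sub_eq, z_add_half, z_sub_half, mul_pow, div_pow,
        inv_pow, half_k, half_k_add_two, neg_mul,
        z_add_h, z_sub_h]
      all_goals try simp only [k_eq, rs_eq, qp_add, qp_sub, qp_neg, qp_two_mul, qp_two, mul_pow,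
        div_pow, inv_pow, inv_inv]
      all_goals try field_simp
      all_goals try simp only [d1_eq, dk_eq, dr_eq, ds_eq]
      all_goals try field_simp
      all_goals try ring
  all_goals try intro x
  · simp [eUP, eUM, bc, SIIa, field, fieldP, fieldM, twistP, twistM, genP, genM, oscSum, Q, Pm,
      Qhat, Phat, One1]
  iterate 2
    · rcases x with _ | _ | _ <;>
      simp [eUP, eUM, vs1, bc, SIIa, field, fieldP, fieldM, twistP, twistM, genP, genM, oscSum, Q,
        Pm, Qhat, Phat, One1, lnz] <;> (try field_simp) <;> (try ring)
  iterate 3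
    · simp [eUP, eUM, vs1, bc, SIIa, field, fieldP, fieldM, twistP, twistM, genP, genM, oscSum, Q,
        Pm, Qhat, Phat, One1, lnz] <;> (try field_simp) <;> (try ring)

theorem lin_vs2 (hP : P.Generic) (u : ℂ) :
    P.genM .a [] [-(P.k + 2)] u ((P.k + 2) / 2)
        + P.genP .a [P.r - P.k - 2] [P.k + 2, P.r] u ((P.k + 2) / 2)
        - (1 / (P.k + 2) : ℂ) • (Q .a + P.lnz u • Pm .a) - P.genP .b [2] [1, P.r] u (-(P.r - P.k - 1))
        + (P.lnz u / P.r) • ((2 : ℂ) • Pm .b + Pm .a + Phat - One1)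
      = (P.vs2).lin P u := by
  have g1 := P.qp_ne_zero 1
  have g2 := P.qp_ne_zero P.h
  have g3 := P.qp_ne_zero P.r
  have g4 := P.z_ne_zero u
  have g5 := hP.dq_ne
  have gr := hP.r_ne
  have gs := hP.rs_ne
  have gk := hP.k_add_two_ne
  refine Vtx.lin_eq P ?_ ?_ ?_ ?_ ?_ ?_ ?_ ?_
  iterate 2
    · intro x n
      have h1 := hP.d1_ne n
      have h2 := hP.dk_ne n
      have h3 := hP.dr_ne n
      have h4 := hP.ds_ne n
      rcases x with _ | _ | _ <;>
      simp only [eUP, eUM, vs2, bc, SIIa, Pi.add_apply, Pi.sub_apply, Pi.neg_apply, Pi.smul_apply,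
        smul_eq_mul, field_pos, field_neg, fieldP_pos, fieldP_neg, fieldM_pos, fieldM_neg,
        twistP_pos, twistP_neg, twistM_pos, twistM_neg, genP_pos, genP_neg, genM_pos, genM_neg,
        Q_osc, Pm_osc, Qhat_osc, Phat_osc, One1_osc, List.map_cons, List.map_nil, List.prod_cons,
        List.prod_nil, if_true, reduceCtorEq, if_false, mul_zero, add_zero, sub_zero, zero_add,
        zero_sub, neg_zero, zero_mul, mul_one, neg_neg, qp_zero, inv_one, one_pow, one_mul,
        br_cast_one, br_cast_two, br_cast_k, br_cast_neg_k, br_cast_r, br_cast_rs, br_cast_r_sub,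
        br_cast_neg_r_sub, br_two_eq, br_r_sub_eq, z_add_half, z_sub_half, mul_pow, div_pow,
        inv_pow, half_k, half_k_add_two, neg_mul,
        z_add_h, z_sub_h]
      all_goals try simp only [k_eq, rs_eq, qp_add, qp_sub, qp_neg, qp_two_mul, qp_two, mul_pow,
        div_pow, inv_pow, inv_inv]
      all_goals try field_simp
      all_goals try simp only [d1_eq, dk_eq, dr_eq, ds_eq]
      all_goals try field_simp
      all_goals try ring
  all_goals try intro x
  · simp [eUP, eUM, bc, SIIa, field, fieldP, fieldM, twistP, twistM, genP, genM, oscSum, Q, Pm,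
      Qhat, Phat, One1]
  iterate 2
    · rcases x with _ | _ | _ <;>
      simp [eUP, eUM, vs2, bc, SIIa, field, fieldP, fieldM, twistP, twistM, genP, genM, oscSum, Q,
        Pm, Qhat, Phat, One1, lnz] <;> (try field_simp) <;> (try ring)
  iterate 3
    · simp [eUP, eUM, vs2, bc, SIIa, field, fieldP, fieldM, twistP, twistM, genP, genM, oscSum, Q,
        Pm, Qhat, Phat, One1, lnz] <;> (try field_simp) <;> (try ring)

theorem lin_vs3 (hP : P.Generic) (u : ℂ) :
    P.genM .a [] [-(P.k + 2)] u (-((P.k + 2) / 2)) + P.genP .a [] [P.k + 2] u ((P.k + 2) / 2)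
        + (1 / (2 * (P.k + 2)) : ℂ) • ((P.k : ℂ) • Q .a - (2 * P.lnz u) • Pm .a)
        - P.field .b u 1 + Q .b - (P.rs : ℂ) • Qhat
      = (P.vs3).lin P u := by
  have g1 := P.qp_ne_zero 1
  have g2 := P.qp_ne_zero P.h
  have g3 := P.qp_ne_zero P.r
  have g4 := P.z_ne_zero u
  have g5 := hP.dq_ne
  have gr := hP.r_ne
  have gs := hP.rs_ne
  have gk := hP.k_add_two_ne
  refine Vtx.lin_eq P ?_ ?_ ?_ ?_ ?_ ?_ ?_ ?_
  iterate 2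
    · intro x n
      have h1 := hP.d1_ne n
      have h2 := hP.dk_ne n
      have h3 := hP.dr_ne n
      have h4 := hP.ds_ne n
      rcases x with _ | _ | _ <;>
      simp only [eUP, eUM, vs3, bc, SIIa, Pi.add_apply, Pi.sub_apply, Pi.neg_apply, Pi.smul_apply,
        smul_eq_mul, field_pos, field_neg, fieldP_pos, fieldP_neg, fieldM_pos, fieldM_neg,
        twistP_pos, twistP_neg, twistM_pos, twistM_neg, genP_pos, genP_neg, genM_pos, genM_neg,
        Q_osc, Pm_osc, Qhat_osc, Phat_osc, One1_osc, List.map_cons, List.map_nil, List.prod_cons,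
        List.prod_nil, if_true, reduceCtorEq, if_false, mul_zero, add_zero, sub_zero, zero_add,
        zero_sub, neg_zero, zero_mul, mul_one, neg_neg, qp_zero, inv_one, one_pow, one_mul,
        br_cast_one, br_cast_two, br_cast_k, br_cast_neg_k, br_cast_r, br_cast_rs, br_cast_r_sub,
        br_cast_neg_r_sub, br_two_eq, br_r_sub_eq, z_add_half, z_sub_half, mul_pow, div_pow,
        inv_pow, half_k, half_k_add_two, neg_mul,
        z_add_h, z_sub_h]
      all_goals try simp only [k_eq, rs_eq, qp_add, qp_sub, qp_neg, qp_two_mul, qp_two, mul_pow,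
        div_pow, inv_pow, inv_inv]
      all_goals try field_simp
      all_goals try simp only [d1_eq, dk_eq, dr_eq, ds_eq]
      all_goals try field_simp
      all_goals try ring
  all_goals try intro x
  · simp [eUP, eUM, bc, SIIa, field, fieldP, fieldM, twistP, twistM, genP, genM, oscSum, Q, Pm,
      Qhat, Phat, One1]
  iterate 2
    · rcases x with _ | _ | _ <;>
      simp [eUP, eUM, vs3, bc, SIIa, field, fieldP, fieldM, twistP, twistM, genP, genM, oscSum, Q,
        Pm, Qhat, Phat, One1, lnz] <;> (try field_simp) <;> (try ring)
  iterate 3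
    · simp [eUP, eUM, vs3, bc, SIIa, field, fieldP, fieldM, twistP, twistM, genP, genM, oscSum, Q,
        Pm, Qhat, Phat, One1, lnz] <;> (try field_simp) <;> (try ring)

end Params

end ScreeningCurrents

end

noncomputable section

namespace ScreeningCurrents

open Finset

namespace Params

variable (P : Params)

/-! ### The currents as combinations of vertex operators -/

/-- U⁺ contains creation modes only, so it contracts with nothing to its right; dually, U⁻ contains
annihilation modes only. -/
theorem noContr_eUP (u : ℂ) (Y : Lin) : NoContr (P.eUP u) Y := by
  rintro ⟨x, n⟩
  simp only [eUP, Pi.add_apply, twistM_pos, add_zero, zero_mul]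

theorem noContr_eUM (u : ℂ) (X : Lin) : NoContr X (P.eUM u) := by
  rintro ⟨x, n⟩
  simp only [eUM, Pi.add_apply, twistP_neg, add_zero, mul_zero]

theorem zeroPair_eUP (u : ℂ) (Y : Lin) : P.zeroPair (P.eUP u) Y = 0 := by
  simp [zeroPair, eUP, twistM, oscSum]

theorem zeroPair_eUM (u : ℂ) (X : Lin) : P.zeroPair X (P.eUM u) = 0 := by
  simp [zeroPair, eUM, twistP, oscSum]

/-- The signs of the two terms of `E`, `F` and `S_II`. -/
def sg : Fin 2 → ℂ := ![1, -1]

/-- The coefficients of the two terms of `E`, `F` and `S_II`. -/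
def cf (a : Fin 2) (u : ℂ) : ℂ := sg a * (-1 / (P.dq * P.z u))

theorem comb_sg (V : ℂ → Vtx) (u : ℂ) : P.comb P.cf (fun a => V (sg a)) u
    = (-1 / (P.dq * P.z u)) • (P.nexp ((V 1).lin P u) - P.nexp ((V (-1)).lin P u)) := by
  funext i j
  simp [comb, cf, Fin.sum_univ_two, sg]
  ring

theorem comb_one (V : Vtx) (u : ℂ) :
    P.comb (fun _ : Fin 1 => fun _ => 1) (fun _ => V) u = P.nexp (V.lin P u) := by
  funext i j
  simp [comb]

/-- The factors stand in normal order already: U⁺ on the left only creates, and the factor on the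
right carries only q̂, p̂ and constants, while nothing to its left contains p̂. -/
theorem E_eq (hP : P.Generic) : P.E = P.comb P.cf fun a => P.vE (sg a) := by
  funext u
  rw [comb_sg, ← P.lin_vE_one hP, ← P.lin_vE_neg_one hP]
  change opMul (opMul (P.nexp (P.eUP u)) _) _ = _
  rw [eP, P.opMul_nexp_sub _ (P.zeroPair_eUP _ _) (P.noContr_eUP _ _) (P.zeroPair_eUP _ _)
    (P.noContr_eUP _ _)]
  refine P.opMul_sub_nexp _ ?_ ?_ ?_ ?_
  · simp [zeroPair, eUP, bc, field, fieldP, twistM, oscSum, Q, Pm, Qhat, Phat, One1]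
  · rintro ⟨x, n⟩
    simp [Qhat, Phat, One1]
  · simp [zeroPair, eUP, bc, field, fieldM, twistM, oscSum, Q, Pm, Qhat, Phat, One1]
  · rintro ⟨x, n⟩
    simp [Qhat, Phat, One1]

theorem F_eq (hP : P.Generic) : P.F = P.comb P.cf fun a => P.vF (sg a) := by
  funext u
  rw [comb_sg, ← P.lin_vF_one hP, ← P.lin_vF_neg_one hP]
  change opMul (opMul _ (P.nexp (P.eUM u))) _ = _
  rw [eM, P.opMul_sub_nexp _ (P.zeroPair_eUM _ _) (P.noContr_eUM _ _) (P.zeroPair_eUM _ _)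
    (P.noContr_eUM _ _)]
  refine P.opMul_sub_nexp _ ?_ ?_ ?_ ?_
  · simp [zeroPair, eUM, bc, field, fieldM, twistP, oscSum, Q, Pm, Phat, One1]
  · rintro ⟨x, n⟩
    simp [Pm, Phat, One1]
  · simp [zeroPair, eUM, bc, field, fieldP, twistP, oscSum, Q, Pm, Phat, One1]
  · rintro ⟨x, n⟩
    simp [Pm, Phat, One1]

/-- U⁺ ψ U⁻ is normal ordered, and the last factor has no oscillators. Its shift q̂ would contract
only with p̂, which the preceding factors do not contain. -/
theorem HP_eq (hP : P.Generic) :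
    P.HP = P.comb (fun _ : Fin 1 => fun _ => 1) (fun _ => P.vHP) := by
  funext u
  rw [comb_one, ← P.lin_vHP hP]
  change opMul (opMul (opMul (P.nexp (P.eUP _)) _) (P.nexp (P.eUM _))) _ = _
  rw [psiP, P.opMul_nexp (P.zeroPair_eUP _ _) (P.noContr_eUP _ _),
    P.opMul_nexp (P.zeroPair_eUM _ _) (P.noContr_eUM _ _)]
  refine P.opMul_nexp ?_ ?_
  · simp [zeroPair, eUP, eUM, fieldP, twistP, twistM, oscSum, Pm, Qhat, Phat, One1]
  · rintro ⟨x, n⟩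
    simp [Pm, Qhat, Phat, One1]

theorem HM_eq (hP : P.Generic) :
    P.HM = P.comb (fun _ : Fin 1 => fun _ => 1) (fun _ => P.vHM) := by
  funext u
  rw [comb_one, ← P.lin_vHM hP]
  change opMul (opMul (opMul (P.nexp (P.eUP _)) _) (P.nexp (P.eUM _))) _ = _
  rw [psiM, P.opMul_nexp (P.zeroPair_eUP _ _) (P.noContr_eUP _ _),
    P.opMul_nexp (P.zeroPair_eUM _ _) (P.noContr_eUM _ _)]
  refine P.opMul_nexp ?_ ?_
  · simp [zeroPair, eUP, eUM, fieldM, twistP, twistM, oscSum, Pm, Qhat, Phat, One1]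
  · rintro ⟨x, n⟩
    simp [Pm, Qhat, Phat, One1]

theorem SI_eq (hP : P.Generic) :
    P.SI = P.comb (fun _ : Fin 1 => fun _ => 1) (fun _ => P.vSI) := by
  funext u
  rw [comb_one, ← P.lin_vSI hP]
  rfl

theorem SII_eq (hP : P.Generic) : P.SII = P.comb P.cf fun a => P.vSII (sg a) := by
  funext u
  rw [comb_sg, ← P.lin_vSII_one hP, ← P.lin_vSII_neg_one hP]
  rfl

/-! ### Growth of the coefficients -/

namespace Generic

variable {P}

theorem geoBdd_inv_d1 (hP : P.Generic) : GeoBdd fun n => (P.d1 n)⁻¹ := by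
  have := P.geoBdd_inv_br hP.lnq_re (s := 1) one_ne_zero
  rwa [Complex.ofReal_one] at this

theorem geoBdd_inv_dr (hP : P.Generic) : GeoBdd fun n => (P.dr n)⁻¹ :=
  P.geoBdd_inv_br hP.lnq_re hP.r_pos.ne'

theorem geoBdd_inv_ds (hP : P.Generic) : GeoBdd fun n => (P.ds n)⁻¹ :=
  P.geoBdd_inv_br hP.lnq_re hP.rs_pos.ne'

theorem geoBdd_inv_dk (hP : P.Generic) : GeoBdd fun n => (P.dk n)⁻¹ := by
  have := P.geoBdd_inv_br hP.lnq_re (s := P.k + 2) (fun h => hP.k_ne (by linarith))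
  rwa [Complex.ofReal_add, Complex.ofReal_ofNat] at this

theorem adm_vSI (hP : P.Generic) : P.vSI.Adm := by
  have h1 := hP.geoBdd_inv_d1
  rintro (_ | _ | _)
  exacts [⟨.const 0, .const 0⟩, ⟨.const 0, .const 0⟩, ⟨h1.neg, h1⟩]

theorem adm_vHP (hP : P.Generic) : P.vHP.Adm := by
  have h2 := hP.geoBdd_inv_dr
  have h3 := hP.geoBdd_inv_ds
  have hp := ((GeoBdd.pow_seq (P.qp 1)).add (.pow_seq (P.qp 1)⁻¹))
  rintro (_ | _ | _)
  exacts [⟨((GeoBdd.pow_seq _).div h2).neg, (GeoBdd.pow_seq _).div h3⟩,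
    ⟨((hp.mul (.pow_seq _)).div h2).neg, (hp.mul (.pow_seq _)).div h3⟩, ⟨.const 0, .const 0⟩]

theorem adm_vHM (hP : P.Generic) : P.vHM.Adm := by
  have h2 := hP.geoBdd_inv_dr
  have h3 := hP.geoBdd_inv_ds
  have hp := ((GeoBdd.pow_seq (P.qp 1)).add (.pow_seq (P.qp 1)⁻¹))
  rintro (_ | _ | _)
  exacts [⟨((GeoBdd.pow_seq _).div h2).neg, (GeoBdd.pow_seq _).div h3⟩,
    ⟨((hp.mul (.pow_seq _)).div h2).neg, (hp.mul (.pow_seq _)).div h3⟩, ⟨.const 0, .const 0⟩]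

theorem adm_vSII (hP : P.Generic) (s : ℂ) : (P.vSII s).Adm := by
  have h1 := hP.geoBdd_inv_d1
  have h4 := hP.geoBdd_inv_dk
  rintro (_ | _ | _)
  exacts [⟨(GeoBdd.pow_seq _).div h4, ((GeoBdd.pow_seq _).div h4).neg⟩,
    ⟨(GeoBdd.pow_seq _).div h1, ((GeoBdd.pow_seq _).div h1).neg⟩,
    ⟨(GeoBdd.pow_seq _).div h1, ((GeoBdd.pow_seq _).div h1).neg⟩]

theorem adm_vE (hP : P.Generic) (s : ℂ) : (P.vE s).Adm := by
  have h1 := hP.geoBdd_inv_d1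
  have h3 := hP.geoBdd_inv_ds
  rintro (_ | _ | _)
  exacts [⟨.const 0, (GeoBdd.pow_seq _).div h3⟩,
    ⟨(GeoBdd.pow_seq _).div h1,
      (((P.geoBdd_br _).mul (.pow_seq _)).div (h3.inv_mul h1)).neg⟩,
    ⟨(GeoBdd.pow_seq _).div h1, ((GeoBdd.pow_seq _).div h1).neg⟩]

theorem adm_vF (hP : P.Generic) (s : ℂ) : (P.vF s).Adm := by
  have h1 := hP.geoBdd_inv_d1
  have h2 := hP.geoBdd_inv_dr
  rintro (_ | _ | _)
  exacts [⟨((GeoBdd.pow_seq _).div h2).neg, ((GeoBdd.const _).mul (.pow_seq _)).neg⟩,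
    ⟨((GeoBdd.pow_seq _).div h1).neg.sub
      (((GeoBdd.pow_seq _).mul (P.geoBdd_br _)).div (h2.inv_mul h1)), (GeoBdd.pow_seq _).div h1⟩,
    ⟨((GeoBdd.pow_seq _).div h1).neg, (GeoBdd.pow_seq _).div h1⟩]

end Generic

/-! ### Contractions -/

theorem comm_a (n : ℕ) : P.comm .a n = P.dk n * P.br (2 * n) / n := rfl

theorem comm_b (n : ℕ) : P.comm .b n = -(P.d1 n ^ 2 / n) := rfl

theorem comm_c (n : ℕ) : P.comm .c n = P.d1 n ^ 2 / n := rfl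

theorem contr_eq (V W : Vtx) (n : ℕ) : V.contr P W n
    = V.ann .a n * (P.dk n * P.br (2 * n) / n) * W.cre .a n
      + V.ann .b n * -(P.d1 n ^ 2 / n) * W.cre .b n
      + V.ann .c n * (P.d1 n ^ 2 / n) * W.cre .c n := by
  rw [Vtx.contr, Boson.sum_univ, comm_a, comm_b, comm_c]

variable {P}

theorem contr_SI_SI (hP : P.Generic) (n : ℕ+) : P.vSI.contr P P.vSI n
    = (0 ^ (n : ℕ) - 1 ^ (n : ℕ)) / (n : ℕ) := by
  have h1 := hP.d1_ne n
  simp only [contr_eq, vSI, zero_pow n.ne_zero, one_pow]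
  field_simp
  ring

theorem contr_E_SI (hP : P.Generic) (s : ℂ) (n : ℕ+) : (P.vE s).contr P P.vSI n
    = (((P.qp s)⁻¹) ^ (n : ℕ) - 0 ^ (n : ℕ)) / (n : ℕ) := by
  have h1 := hP.d1_ne n
  simp only [contr_eq, vSI, vE, zero_pow n.ne_zero]
  field_simp
  ring

theorem contr_SI_E (hP : P.Generic) (s : ℂ) (n : ℕ+) : P.vSI.contr P (P.vE s) n
    = (P.qp s ^ (n : ℕ) - 0 ^ (n : ℕ)) / (n : ℕ) := by
  have h1 := hP.d1_ne n
  simp only [contr_eq, vSI, vE, zero_pow n.ne_zero]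
  field_simp
  ring

theorem contr_SII_SI (hP : P.Generic) (s : ℂ) (n : ℕ+) : (P.vSII s).contr P P.vSI n
    = (((P.qp s)⁻¹) ^ (n : ℕ) - 0 ^ (n : ℕ)) / (n : ℕ) := by
  have h1 := hP.d1_ne n
  simp only [contr_eq, vSI, vSII, zero_pow n.ne_zero]
  field_simp
  ring

theorem contr_SI_SII (hP : P.Generic) (s : ℂ) (n : ℕ+) : P.vSI.contr P (P.vSII s) n
    = (P.qp s ^ (n : ℕ) - 0 ^ (n : ℕ)) / (n : ℕ) := by
  have h1 := hP.d1_ne n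
  simp only [contr_eq, vSI, vSII, zero_pow n.ne_zero]
  field_simp
  ring

theorem contr_F_SI (hP : P.Generic) (s : ℂ) (n : ℕ+) : (P.vF s).contr P P.vSI n
    = (0 ^ (n : ℕ) - P.qp (s * (2 * P.h - 1)) ^ (n : ℕ)) / (n : ℕ) := by
  have h1 := hP.d1_ne n
  simp only [contr_eq, vSI, vF, zero_pow n.ne_zero]
  field_simp
  ring

theorem contr_SI_F (hP : P.Generic) (s : ℂ) (n : ℕ+) : P.vSI.contr P (P.vF s) n
    = (0 ^ (n : ℕ) - P.qp (-s * (2 * P.h - 1)) ^ (n : ℕ)) / (n : ℕ) := by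
  have h1 := hP.d1_ne n
  simp only [contr_eq, vSI, vF, zero_pow n.ne_zero]
  field_simp
  ring

theorem contr_H_SI (n : ℕ+) : P.vHP.contr P P.vSI n = 0 ∧ P.vSI.contr P P.vHP n = 0 ∧
    P.vHM.contr P P.vSI n = 0 ∧ P.vSI.contr P P.vHM n = 0 := by
  simp [contr_eq, vSI, vHP, vHM]

/-- The boson b produces the pole at z = w and the boson c the zero at z = q^{t-s} w, which removes
the pole when s = t. -/
theorem contr_E_SII (hP : P.Generic) (s t : ℂ) (n : ℕ+) : (P.vE s).contr P (P.vSII t) n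
    = (1 ^ (n : ℕ) - P.qp (t - s) ^ (n : ℕ)) / (n : ℕ) := by
  have h1 := hP.d1_ne n
  have g1 := P.qp_ne_zero 1
  have gs := P.qp_ne_zero s
  simp only [contr_eq, vE, vSII, qp_sub, div_pow, inv_pow, one_pow]
  field_simp
  ring

/-- The dependence on r* disappears because q^{(r-2h)n}[2n] + q^{-2n}[(r-2h)n] = [r*n], where r* = r
- 2h + 2; the left side collects the bosons a and b. -/
theorem contr_SII_E (hP : P.Generic) (s t : ℂ) (n : ℕ+) : (P.vSII t).contr P (P.vE s) n
    = (1 ^ (n : ℕ) - P.qp (s - t) ^ (n : ℕ)) / (n : ℕ) := by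
  have h1 := hP.d1_ne n
  have h2 := hP.dk_ne n
  have h3 := hP.dr_ne n
  have h4 := hP.ds_ne n
  have g1 := P.qp_ne_zero 1
  have g2 := P.qp_ne_zero P.h
  have g3 := P.qp_ne_zero P.r
  have g5 := hP.dq_ne
  have gs := P.qp_ne_zero t
  simp only [contr_eq, vE, vSII, qp_sub, div_pow, inv_pow, one_pow, br_two_eq, br_r_sub_eq]
  field_simp
  simp only [ds_eq]
  field_simp
  ring

/-- The contractions of a and b cancel by [2n] = (q^n + q^{-n})[n]. -/
theorem contr_H_SII (hP : P.Generic) (s : ℂ) (n : ℕ+) :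
    P.vHP.contr P (P.vSII s) n = 0 ∧ (P.vSII s).contr P P.vHP n = 0 ∧
    P.vHM.contr P (P.vSII s) n = 0 ∧ (P.vSII s).contr P P.vHM n = 0 := by
  have h1 := hP.d1_ne n
  have h2 := hP.dk_ne n
  have h3 := hP.dr_ne n
  have h4 := hP.ds_ne n
  have g1 := P.qp_ne_zero 1
  have g2 := P.qp_ne_zero P.h
  have g3 := P.qp_ne_zero P.r
  have g5 := hP.dq_ne
  refine ⟨?_, ?_, ?_, ?_⟩ <;>
  · simp only [contr_eq, vHP, vHM, vSII, qp_sub, qp_add, qp_neg, qp_two_mul, qp_two, div_pow,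
      inv_pow, mul_pow, br_two_eq]
    field_simp
    simp only [d1_eq]
    field_simp
    ring

/-- The terms with [rn] in the denominator come from a and b and combine to a multiple of [rn]; this
uses s = ±1, as `vF` encodes the two terms only at these values. For t = -s the two powers coincide
and no pole is left. -/
theorem contr_F_SII (hP : P.Generic) {s : ℂ} (hs : s = 1 ∨ s = -1) (t : ℂ) (n : ℕ+) :
    (P.vF s).contr P (P.vSII t) n
    = (P.qp (s * (2 * P.h - 1) + t) ^ (n : ℕ) - P.qp (s * (2 * P.h - 2)) ^ (n : ℕ)) / (n : ℕ) := by
  have h1 := hP.d1_ne n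
  have h2 := hP.dk_ne n
  have h3 := hP.dr_ne n
  have g1 := P.qp_ne_zero 1
  have g2 := P.qp_ne_zero P.h
  have g3 := P.qp_ne_zero P.r
  have g5 := hP.dq_ne
  rcases hs with rfl | rfl <;>
  · simp only [contr_eq, vF, vSII, one_mul, neg_mul, qp_sub, qp_add, qp_neg, qp_two_mul, qp_two,
      div_pow, inv_pow, mul_pow, br_two_eq, neg_sub]
    field_simp
    simp only [dr_eq]
    field_simp
    ring

theorem contr_SII_F (hP : P.Generic) {s : ℂ} (hs : s = 1 ∨ s = -1) (t : ℂ) (n : ℕ+) :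
    (P.vSII t).contr P (P.vF s) n
    = (P.qp (-s * (2 * P.h - 1) - t) ^ (n : ℕ) - P.qp (-s * (2 * P.h - 2)) ^ (n : ℕ)) /
      (n : ℕ) := by
  have h1 := hP.d1_ne n
  have h2 := hP.dk_ne n
  have g1 := P.qp_ne_zero 1
  have g2 := P.qp_ne_zero P.h
  have g3 := P.qp_ne_zero t
  have g5 := hP.dq_ne
  rcases hs with rfl | rfl <;>
  · simp only [contr_eq, vF, vSII, one_mul, neg_mul, neg_neg, qp_sub, qp_add, qp_neg, qp_two_mul,
      qp_two, div_pow, inv_pow, mul_pow, br_two_eq, neg_sub]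
    field_simp
    try simp only [d1_eq, dk_eq]
    try field_simp
    try ring

end Params

end ScreeningCurrents

end

/-! ### Fusion of exponents, zero-mode contractions and the relations with S_I -/

noncomputable section

namespace ScreeningCurrents

open Finset

/-- At v = u + s/2 the logarithms satisfy ln w = ln z + s ln q, so two exponents at different points
can combine into one at z. It identifies the residues with s̃₁, s̃₂ and s̃₃. -/
theorem Vtx.lin_add (P : Params) {V W S : Vtx} {s u v : ℂ} (hv : v = u + s / 2)
    (hann : ∀ (x : Boson) (n : ℕ+), V.ann x n + W.ann x n * (P.qp s)⁻¹ ^ (n : ℕ) = S.ann x n)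
    (hcre : ∀ (x : Boson) (n : ℕ+), V.cre x n + W.cre x n * P.qp s ^ (n : ℕ) = S.cre x n)
    (hq : ∀ x, V.q x + W.q x = S.q x) (hqh : V.qh + W.qh = S.qh)
    (hp : ∀ x, (V.p x).1 + (W.p x).1 + (W.p x).2 * s * P.lnq = (S.p x).1)
    (hp' : ∀ x, (V.p x).2 + (W.p x).2 = (S.p x).2)
    (hph : V.ph.1 + W.ph.1 + W.ph.2 * s * P.lnq = S.ph.1) (hph' : V.ph.2 + W.ph.2 = S.ph.2) :
    V.lin P u + W.lin P v = S.lin P u := by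
  subst hv
  have hg := P.qp_ne_zero s
  refine Vtx.lin_eq P (fun x n => ?_) (fun x n => ?_) (fun x => ?_) hq (fun x => ?_) hqh ?_ ?_
  · rw [Pi.add_apply, lin_osc_pos, lin_osc_pos, P.z_add_half, ← hann, mul_pow, inv_pow, mul_inv]
    ring
  · rw [Pi.add_apply, lin_osc_neg, lin_osc_neg, P.z_add_half, ← hcre, mul_pow]
    ring
  · simp [lin]
  · simp only [Pi.add_apply, lin, P.lnz_add_half, ← hp, ← hp']
    ring
  · simp only [Pi.add_apply, lin, P.lnz_add_half, ← hph, ← hph']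
    ring
  · simp only [Pi.add_apply, lin, P.lnz_add_half, ← hph, ← hph']
    ring

namespace Params

variable {P : Params}

/-! ### Contractions of the zero modes -/

theorem zeroContr_SI_SI (u : ℂ) :
    P.vSI.zeroContr P P.vSI u = 0 * P.lnq + (1 : ℤ) * P.lnz u := by
  simp [Vtx.zeroContr, vSI]

/-- The charge -r* of S_I with respect to q̂ cancels the exponent -(p̂ - 1)/r* of E, leaving an
integral power of z. -/
theorem zeroContr_E_SI (hP : P.Generic) (s u : ℂ) :
    (P.vE s).zeroContr P P.vSI u = -s * P.lnq + (-1 : ℤ) * P.lnz u := by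
  have gs := hP.rs_ne
  simp only [Vtx.zeroContr, vSI, vE]
  push_cast
  field_simp
  ring

theorem zeroContr_SI_E (s u : ℂ) :
    P.vSI.zeroContr P (P.vE s) u = 0 * P.lnq + (-1 : ℤ) * P.lnz u := by
  simp [Vtx.zeroContr, vSI, vE]

theorem zeroContr_SII_SI (hP : P.Generic) (s u : ℂ) :
    (P.vSII s).zeroContr P P.vSI u = -s * P.lnq + (-1 : ℤ) * P.lnz u := by
  have gk := hP.k_add_two_ne
  simp only [Vtx.zeroContr, vSI, vSII]
  push_cast
  field_simp
  ring

theorem zeroContr_SI_SII (s u : ℂ) :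
    P.vSI.zeroContr P (P.vSII s) u = 0 * P.lnq + (-1 : ℤ) * P.lnz u := by
  simp [Vtx.zeroContr, vSI, vSII]

/-- The powers with denominator r add up to (r* + (k + 2) - 2)/r = 1, from p̂, a and b respectively.
-/
theorem zeroContr_F_SI (hP : P.Generic) (s u : ℂ) :
    (P.vF s).zeroContr P P.vSI u = -(s * (2 * P.h - 1)) * P.lnq + (1 : ℤ) * P.lnz u := by
  have gr := hP.r_ne
  simp only [Vtx.zeroContr, vSI, vF, rs, k_eq, Complex.ofReal_sub]
  push_cast
  field_simp
  ring

theorem zeroContr_SI_F (s u : ℂ) :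
    P.vSI.zeroContr P (P.vF s) u = 0 * P.lnq + (1 : ℤ) * P.lnz u := by
  simp [Vtx.zeroContr, vSI, vF]

theorem zeroContr_H_SI (hP : P.Generic) (u : ℂ) :
    P.vHP.zeroContr P P.vSI u = 0 * P.lnq + (0 : ℤ) * P.lnz u ∧
    P.vSI.zeroContr P P.vHP u = 0 * P.lnq + (0 : ℤ) * P.lnz u ∧
    P.vHM.zeroContr P P.vSI u = 0 * P.lnq + (0 : ℤ) * P.lnz u ∧
    P.vSI.zeroContr P P.vHM u = 0 * P.lnq + (0 : ℤ) * P.lnz u := by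
  have gr := hP.r_ne
  have gs := hP.rs_ne
  have e : (P.rs : ℂ) = P.r - P.k := Complex.ofReal_sub _ _
  refine ⟨?_, by simp [Vtx.zeroContr, vSI, vHP], ?_, by simp [Vtx.zeroContr, vSI, vHM]⟩ <;>
  · simp only [Vtx.zeroContr, vSI, vHP, vHM]
    field_simp
    simp only [e]
    push_cast
    ring

theorem zeroContr_H_SII (hP : P.Generic) (s u : ℂ) :
    P.vHP.zeroContr P (P.vSII s) u = 0 * P.lnq + (0 : ℤ) * P.lnz u ∧
    (P.vSII s).zeroContr P P.vHP u = 0 * P.lnq + (0 : ℤ) * P.lnz u ∧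
    P.vHM.zeroContr P (P.vSII s) u = 0 * P.lnq + (0 : ℤ) * P.lnz u ∧
    (P.vSII s).zeroContr P P.vHM u = 0 * P.lnq + (0 : ℤ) * P.lnz u := by
  have gr := hP.r_ne
  have gs := hP.rs_ne
  have gk := hP.k_add_two_ne
  refine ⟨?_, ?_, ?_, ?_⟩ <;>
  · simp only [Vtx.zeroContr, vSII, vHP, vHM]
    push_cast
    field_simp
    ring

theorem zeroContr_E_SII (s t u : ℂ) :
    (P.vE s).zeroContr P (P.vSII t) u = s * P.lnq + (0 : ℤ) * P.lnz u := by
  simp [Vtx.zeroContr, vSII, vE]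

theorem zeroContr_SII_E (s t u : ℂ) :
    (P.vSII t).zeroContr P (P.vE s) u = t * P.lnq + (0 : ℤ) * P.lnz u := by
  simp [Vtx.zeroContr, vSII, vE]

theorem zeroContr_F_SII (hP : P.Generic) (s t u : ℂ) :
    (P.vF s).zeroContr P (P.vSII t) u = s * P.lnq + (0 : ℤ) * P.lnz u := by
  have gr := hP.r_ne
  have gk := hP.k_add_two_ne
  simp only [Vtx.zeroContr, vSII, vF]
  push_cast
  field_simp
  ring

theorem zeroContr_SII_F (s t u : ℂ) :
    (P.vSII t).zeroContr P (P.vF s) u = -t * P.lnq + (0 : ℤ) * P.lnz u := by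
  simp [Vtx.zeroContr, vSII, vF]

/-- The only zero-mode contraction with a power of z that is not integral in general. The
contributions of b and c to that power cancel, leaving 2/(k + 2) from a. -/
theorem zeroContr_SII_SII (hP : P.Generic) (s t u : ℂ) :
    (P.vSII s).zeroContr P (P.vSII t) u = s * P.lnq + 2 / (P.k + 2) * P.lnz u := by
  have gk := hP.k_add_two_ne
  simp only [Vtx.zeroContr, vSII]
  field_simp
  ring

theorem Generic.lnq_ne (hP : P.Generic) : P.lnq ≠ 0 := by
  intro h
  have := hP.lnq_re
  rw [h] at this
  exact lt_irrefl _ this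

/-! ### Relations with `S_I` -/

theorem regularOPE_HP_SI (hP : P.Generic) : P.RegularOPE P.HP P.SI 1 := by
  rw [HP_eq P hP, SI_eq P hP]
  refine P.regularOPE_of_factor hP.lnq_ne (k := fun _ _ _ => 1)
    (fun _ _ => Vtx.exists_factor_of_contr_eq_zero P hP.adm_vHP hP.adm_vSI
      (fun n => (contr_H_SI n).1) fun u => (zeroContr_H_SI hP u).1)
    (fun _ _ => Vtx.exists_factor_of_contr_eq_zero P hP.adm_vSI hP.adm_vHP
      (fun n => (contr_H_SI n).2.1) fun u => (zeroContr_H_SI hP u).2.1)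
    (mul_one 1) (fun _ _ => .const 1) ?_ ?_ <;> simp [qp_zero]

theorem regularOPE_HM_SI (hP : P.Generic) : P.RegularOPE P.HM P.SI 1 := by
  rw [HM_eq P hP, SI_eq P hP]
  refine P.regularOPE_of_factor hP.lnq_ne (k := fun _ _ _ => 1)
    (fun _ _ => Vtx.exists_factor_of_contr_eq_zero P hP.adm_vHM hP.adm_vSI
      (fun n => (contr_H_SI n).2.2.1) fun u => (zeroContr_H_SI hP u).2.2.1)
    (fun _ _ => Vtx.exists_factor_of_contr_eq_zero P hP.adm_vSI hP.adm_vHM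
      (fun n => (contr_H_SI n).2.2.2) fun u => (zeroContr_H_SI hP u).2.2.2)
    (mul_one 1) (fun _ _ => .const 1) ?_ ?_ <;> simp [qp_zero]

/-- The oscillators give 1 - w/z and the zero mode gives z, so the factor is z - w, which is
antisymmetric. -/
theorem regularOPE_SI_SI (hP : P.Generic) : P.RegularOPE P.SI P.SI (-1) := by
  rw [SI_eq P hP]
  have hf : ∀ _ _ : Fin 1, _ := fun _ _ => Vtx.exists_factor P hP.adm_vSI hP.adm_vSI
    (contr_SI_SI hP) zeroContr_SI_SI
  have hz₁ := Vtx.isExpPoly_z_fst P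
  have hz₂ := Vtx.isExpPoly_z_snd P
  refine P.regularOPE_of_factor hP.lnq_ne (k := fun _ _ p => P.z p.1 - P.z p.2) hf hf
    (by norm_num) (fun _ _ => by fun_prop) (fun _ _ u v => ?_) (fun _ _ u v => ?_)
  · have := P.z_ne_zero u
    simp [qp_zero]
    field_simp
  · have := P.z_ne_zero v
    simp [qp_zero]
    field_simp

theorem isExpPoly_cf (a : Fin 2) : IsExpPoly fun p => P.cf a p.1 := by
  have := Vtx.isExpPoly_inv_z_fst P
  have h : IsExpPoly fun p => sg a * (-1 * (P.dq⁻¹ * (P.z p.1)⁻¹)) := by fun_prop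
  simpa only [cf, div_eq_mul_inv, mul_inv] using h

theorem isExpPoly_cf_snd (a : Fin 2) : IsExpPoly fun p => P.cf a p.2 := by
  have := Vtx.isExpPoly_inv_z_snd P
  have h : IsExpPoly fun p => sg a * (-1 * (P.dq⁻¹ * (P.z p.2)⁻¹)) := by fun_prop
  simpa only [cf, div_eq_mul_inv, mul_inv] using h

theorem regularOPE_F_SI (hP : P.Generic) : P.RegularOPE P.F P.SI (-1) := by
  rw [SI_eq P hP, F_eq P hP]
  have hz₁ := Vtx.isExpPoly_z_fst P
  have hz₂ := Vtx.isExpPoly_z_snd P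
  refine P.regularOPE_of_factor hP.lnq_ne
    (k := fun a _ p => P.cf a p.1 * (P.qp (-(sg a * (2 * P.h - 1))) * P.z p.1 - P.z p.2))
    (fun a _ => Vtx.exists_factor P (hP.adm_vF _) hP.adm_vSI (contr_F_SI hP _)
      (zeroContr_F_SI hP _))
    (fun a _ => Vtx.exists_factor P hP.adm_vSI (hP.adm_vF _) (contr_SI_F hP _)
      (zeroContr_SI_F _))
    (by norm_num) (fun a _ => ?_) (fun a _ u v => ?_) (fun a _ u v => ?_)
  · have := isExpPoly_cf (P := P) a
    fun_prop
  · have := P.z_ne_zero u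
    have := P.qp_ne_zero (sg a * (2 * P.h - 1))
    simp only [qp_neg, zpow_one, zero_mul, sub_zero]
    field_simp
  · have := P.z_ne_zero v
    have := P.qp_ne_zero (sg a * (2 * P.h - 1))
    simp only [qp_neg, qp_zero, zpow_one, zero_mul, sub_zero, neg_mul]
    field_simp
    ring

/-- Common to E and S_II: their contractions with S_I agree. The term of sign s has the factor
q^{-s}/(z - q^{-s} w), hence a single pole at w = q^s z, and by `hres` both terms fuse there to the
same vertex operator. -/
theorem diffOPE_SI (hP : P.Generic) {V : ℂ → Vtx} {S : Vtx} (hV : ∀ s, (V s).Adm)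
    (h₁ : ∀ (s : ℂ) (n : ℕ+), (V s).contr P P.vSI n
      = (((P.qp s)⁻¹) ^ (n : ℕ) - 0 ^ (n : ℕ)) / (n : ℕ))
    (h₂ : ∀ (s : ℂ) (n : ℕ+), P.vSI.contr P (V s) n
      = (P.qp s ^ (n : ℕ) - 0 ^ (n : ℕ)) / (n : ℕ))
    (z₁ : ∀ s u, (V s).zeroContr P P.vSI u = -s * P.lnq + (-1 : ℤ) * P.lnz u)
    (z₂ : ∀ s u, P.vSI.zeroContr P (V s) u = 0 * P.lnq + (-1 : ℤ) * P.lnz u)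
    (hres : ∀ s u : ℂ, (V s).lin P u + P.vSI.lin P (u + s / 2) = S.lin P u) :
    P.DiffOPE (P.comb P.cf fun a => V (sg a)) P.SI (-1) 1 fun u => P.nexp (S.lin P u) := by
  rw [SI_eq P hP]
  have hz₁ := Vtx.isExpPoly_inv_z_fst P
  have hq := P.qp_ne_zero 1
  have hd := hP.dq_ne
  refine P.diffOPE_of_factor hP.lnq_ne
    (k₀ := fun _ _ _ => 0)
    -- The index 0 is the sign +1, with pole at w = qz, and the index 1 is the sign -1, with pole at
    -- w = q⁻¹z. The constants include the prefactor of the current.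
    (k₁ := fun a _ p => if a = 0 then 0 else P.qp 1 * P.dq⁻¹ * (P.z p.1)⁻¹)
    (k₂ := fun a _ p => if a = 0 then -((P.qp 1)⁻¹ * P.dq⁻¹ * (P.z p.1)⁻¹) else 0)
    (fun a _ => Vtx.exists_factor P (hV _) hP.adm_vSI (h₁ _) (z₁ _))
    (fun a _ => Vtx.exists_factor P hP.adm_vSI (hV _) (h₂ _) (z₂ _))
    (by norm_num) (fun _ _ => .const 0) (fun a _ => ?_) (fun a _ => ?_)
    (fun a _ u v ha hb => ?_) (fun a _ u v ha hb => ?_) (fun i j u => ?_) (fun i j u => ?_)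
  · split_ifs <;> fun_prop
  · split_ifs <;> fun_prop
  · have hz := P.z_ne_zero u
    rw [Complex.ofReal_one, qp_neg] at hb
    rw [Complex.ofReal_one] at ha
    fin_cases a
    · simp [cf, sg, qp_neg]
      field_simp
    · simp [cf, sg, qp_neg]
      field_simp
  · have hz := P.z_ne_zero u
    have hz' := P.z_ne_zero v
    rw [Complex.ofReal_one, qp_neg] at hb
    rw [Complex.ofReal_one] at ha
    fin_cases a
    · have e : P.z v - P.qp 1 * P.z u = -P.qp 1 * (P.z u - (P.qp 1)⁻¹ * P.z v) := by
        field_simp; ring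
      simp [cf, sg, qp_neg, qp_zero, e]
      field_simp
    · have e : P.z v - (P.qp 1)⁻¹ * P.z u = -(P.qp 1)⁻¹ * (P.z u - P.qp 1 * P.z v) := by
        field_simp; ring
      simp [cf, sg, qp_neg, qp_zero, e]
      field_simp
  · have := hres (-1) u
    have hz := P.z_sub_half u 1
    rw [neg_div, ← sub_eq_add_neg] at this
    rw [Complex.ofReal_one]
    generalize u - 1 / 2 = v at *
    simp [normalElt, sg, this, hz]
    exact .inl (by ring)
  · have := hres 1 u
    have hz := P.z_add_half u 1
    rw [Complex.ofReal_one]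
    generalize u + 1 / 2 = v at *
    simp [normalElt, sg, this, hz]
    exact .inl (by ring)

theorem s1_eq (hP : P.Generic) : P.s1 = fun u => P.nexp (P.vs1.lin P u) :=
  funext fun u => congrArg P.nexp (P.lin_vs1 hP u)

theorem s2_eq (hP : P.Generic) : P.s2 = fun u => P.nexp (P.vs2.lin P u) :=
  funext fun u => congrArg P.nexp (P.lin_vs2 hP u)

theorem s3_eq (hP : P.Generic) : P.s3 = fun u => P.nexp (P.vs3.lin P u) :=
  funext fun u => congrArg P.nexp (P.lin_vs3 hP u)

theorem diffOPE_E_SI (hP : P.Generic) : P.DiffOPE P.E P.SI (-1) 1 P.s1 := by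
  rw [E_eq P hP, s1_eq hP]
  refine diffOPE_SI hP hP.adm_vE (contr_E_SI hP) (contr_SI_E hP) (zeroContr_E_SI hP)
    zeroContr_SI_E fun s u => Vtx.lin_add P rfl ?_ ?_ ?_ ?_ ?_ ?_ ?_ ?_
  · rintro (_ | _ | _) n <;> simp [vE, vSI, vs1]
    ring
  · rintro (_ | _ | _) n <;> simp [vE, vSI, vs1]
    ring
  · rintro (_ | _ | _) <;> simp [vE, vSI, vs1]
  · simp [vE, vSI, vs1, sub_eq_add_neg]
  all_goals try rintro (_ | _ | _)
  all_goals simp [vE, vSI, vs1]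

theorem diffOPE_SII_SI (hP : P.Generic) : P.DiffOPE P.SII P.SI (-1) 1 P.s3 := by
  rw [SII_eq P hP, s3_eq hP]
  refine diffOPE_SI hP hP.adm_vSII (contr_SII_SI hP) (contr_SI_SII hP) (zeroContr_SII_SI hP)
    zeroContr_SI_SII fun s u => Vtx.lin_add P rfl ?_ ?_ ?_ ?_ ?_ ?_ ?_ ?_
  · rintro (_ | _ | _) n <;> simp [vSII, vSI, vs3]
    ring
  · rintro (_ | _ | _) n <;> simp [vSII, vSI, vs3]
    ring
  · rintro (_ | _ | _) <;> simp [vSII, vSI, vs3]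
    ring
  · simp [vSII, vSI, vs3]
  all_goals try rintro (_ | _ | _)
  all_goals simp [vSII, vSI, vs3]

end Params

end ScreeningCurrents

end

noncomputable section

namespace ScreeningCurrents

open Finset

namespace Params

variable {P : Params}

/-! ### Relations with `S_II` -/

theorem regularOPE_HP_SII (hP : P.Generic) : P.RegularOPE P.HP P.SII 1 := by
  rw [HP_eq P hP, SII_eq P hP]
  refine P.regularOPE_of_factor hP.lnq_ne (k := fun _ b p => P.cf b p.2)
    (fun _ b => Vtx.exists_factor_of_contr_eq_zero P hP.adm_vHP (hP.adm_vSII _)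
      (fun n => (contr_H_SII hP (sg b) n).1) fun u => (zeroContr_H_SII hP (sg b) u).1)
    (fun _ b => Vtx.exists_factor_of_contr_eq_zero P (hP.adm_vSII _) hP.adm_vHP
      (fun n => (contr_H_SII hP (sg b) n).2.1) fun u => (zeroContr_H_SII hP (sg b) u).2.1)
    (mul_one 1) (fun _ b => isExpPoly_cf_snd b) ?_ ?_ <;> simp [qp_zero]

theorem regularOPE_HM_SII (hP : P.Generic) : P.RegularOPE P.HM P.SII 1 := by
  rw [HM_eq P hP, SII_eq P hP]
  refine P.regularOPE_of_factor hP.lnq_ne (k := fun _ b p => P.cf b p.2)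
    (fun _ b => Vtx.exists_factor_of_contr_eq_zero P hP.adm_vHM (hP.adm_vSII _)
      (fun n => (contr_H_SII hP (sg b) n).2.2.1) fun u => (zeroContr_H_SII hP (sg b) u).2.2.1)
    (fun _ b => Vtx.exists_factor_of_contr_eq_zero P (hP.adm_vSII _) hP.adm_vHM
      (fun n => (contr_H_SII hP (sg b) n).2.2.2) fun u => (zeroContr_H_SII hP (sg b) u).2.2.2)
    (mul_one 1) (fun _ b => isExpPoly_cf_snd b) ?_ ?_ <;> simp [qp_zero]

/-- The signs enter the exponents only through c, where for z = w the sum is symmetric in s and t.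
Equality of z and w suffices, without equality of logarithms. -/
theorem lin_vE_add_lin_vSII {u v : ℂ} (h : P.z u = P.z v) (s t : ℂ) :
    (P.vE s).lin P u + (P.vSII t).lin P v = (P.vE t).lin P u + (P.vSII s).lin P v := by
  funext g
  rcases g with ⟨x, n⟩ | x | x | _ | _ | _
  · rcases x with _ | _ | _ <;> simp only [Pi.add_apply, Vtx.lin, vE, vSII, h]
    split_ifs <;> ring
  · rcases x with _ | _ | _ <;> simp only [Pi.add_apply, Vtx.lin, vE, vSII]
  · rcases x with _ | _ | _ <;> simp only [Pi.add_apply, Vtx.lin, vE, vSII]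
    ring
  · rfl
  · rfl
  · rfl

/-- The equal-sign terms have no pole at z = w. The two mixed terms have numerators proportional to
q(1 - q^{-2}) and q⁻¹(1 - q²), which are opposite, and equal normal ordered products by
`lin_vE_add_lin_vSII`. -/
theorem regularOPE_E_SII (hP : P.Generic) : P.RegularOPE P.E P.SII 1 := by
  rw [E_eq P hP, SII_eq P hP]
  have hz₁ := Vtx.isExpPoly_z_fst P
  have hz₂ := Vtx.isExpPoly_z_snd P
  refine P.regularOPE_of_factor_sub hP.lnq_ne
    (k := fun a b p => P.cf a p.1 * P.cf b p.2 * P.qp (sg a) *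
      (P.z p.1 - P.qp (sg b - sg a) * P.z p.2))
    (fun a b => Vtx.exists_factor P (hP.adm_vE _) (hP.adm_vSII _) (contr_E_SII hP _ _)
      (zeroContr_E_SII _ _))
    (fun a b => Vtx.exists_factor P (hP.adm_vSII _) (hP.adm_vE _) (contr_SII_E hP _ _)
      (zeroContr_SII_E _ _))
    (mul_one 1) (fun a b => ?_) (fun a b u v h => ?_) (fun a b u v h => ?_) (fun i j u v h => ?_)
  · have := isExpPoly_cf (P := P) a
    have := isExpPoly_cf_snd (P := P) b
    fun_prop
  · simp only [zpow_zero, one_mul, mul_one]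
    ring
  · have h' : P.z v - P.z u ≠ 0 := by rwa [← neg_ne_zero, neg_sub]
    have ga := P.qp_ne_zero (sg a)
    have gb := P.qp_ne_zero (sg b)
    have e : P.z v - P.z u = -(P.z u - P.z v) := by ring
    simp only [zpow_zero, one_mul, mul_one, qp_sub, e]
    field_simp
    ring
  · have hq := P.qp_ne_zero 1
    have e := lin_vE_add_lin_vSII h 1 (-1)
    have eq' : P.qp (-1 - 1) = (P.qp 1 ^ 2)⁻¹ := by rw [← qp_two, ← qp_neg]; norm_num
    simp [Fin.sum_univ_two, normalElt, sg, cf, e, h, one_add_one_eq_two, qp_two, eq', qp_neg, qp_zero]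
    field_simp
    ring

/-- The two equal-sign terms fuse to the same s̃₂, at the points w = q^{-s(k+2)} z where their
factors have poles. -/
theorem lin_vF_add_lin_vSII (hP : P.Generic) {s : ℂ} (hs : s = 1 ∨ s = -1) (u : ℂ) :
    (P.vF s).lin P u + (P.vSII s).lin P (u + -s * (P.k + 2) / 2) = P.vs2.lin P u := by
  have g1 := P.qp_ne_zero 1
  have g2 := P.qp_ne_zero P.h
  have g3 := P.qp_ne_zero P.r
  have g5 := hP.dq_ne
  have gr := hP.r_ne
  have gk := hP.k_add_two_ne
  refine Vtx.lin_add P rfl (fun x n => ?_) (fun x n => ?_) ?_ ?_ ?_ ?_ ?_ ?_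
  iterate 2
    · have h1 := hP.d1_ne n
      have h2 := hP.dk_ne n
      have h3 := hP.dr_ne n
      have ek : (P.k + 2 : ℂ) = 2 * P.h := by rw [h]; ring
      rcases hs with rfl | rfl <;> rcases x with _ | _ | _ <;>
      simp only [vF, vSII, vs2, ek, one_mul, neg_mul, neg_neg, qp_sub, qp_add, qp_neg, qp_two_mul,
        div_pow, inv_pow, mul_pow, br_r_sub_eq, br_two_eq, inv_inv, inv_div]
      all_goals try field_simp
      all_goals try simp only [dk_eq, dr_eq]
      all_goals try field_simp
      all_goals try ring
  · rintro (_ | _ | _) <;> simp [vF, vSII, vs2]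
  · simp [vF, vSII, vs2]
  all_goals try rintro (_ | _ | _)
  all_goals simp [vF, vSII, vs2]
  all_goals try field_simp
  all_goals try ring

/-- Opposite signs give a constant factor; only the diagonal terms have a pole. -/
theorem exists_factor_F_SII (hP : P.Generic) (a b : Fin 2) :
    ∃ R : ℝ, 0 < R ∧ (P.vF (sg a)).Factor P (P.vSII (sg b)) R fun p => P.qp (sg a) *
      if a = b then (P.z p.1 - P.qp (sg a * (2 * P.h - 2)) * P.z p.2) /
        (P.z p.1 - P.qp (sg a * (2 * P.h)) * P.z p.2) else 1 := by
  have hs : ∀ a, sg a = 1 ∨ sg a = -1 := by intro a; fin_cases a <;> simp [sg]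
  have hz := zeroContr_F_SII hP (sg a) (sg b)
  split_ifs with hab
  · subst hab
    have := Vtx.exists_factor P (hP.adm_vF _) (hP.adm_vSII _) (contr_F_SII hP (hs a) (sg a)) hz
    simp only [zpow_zero, mul_one] at this
    rwa [show sg a * (2 * P.h - 1) + sg a = sg a * (2 * P.h) by ring] at this
  · have hab' : sg b = -sg a := by fin_cases a <;> fin_cases b <;> simp_all [sg]
    have := Vtx.exists_factor_of_contr_eq_zero P (hP.adm_vF _) (hP.adm_vSII _) (fun n => by
      rw [contr_F_SII hP (hs a), hab',
        show sg a * (2 * P.h - 1) + -sg a = sg a * (2 * P.h - 2) by ring, sub_self, zero_div]) hz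
    simpa only [zpow_zero, mul_one] using this

theorem exists_factor_SII_F (hP : P.Generic) (a b : Fin 2) :
    ∃ R : ℝ, 0 < R ∧ (P.vSII (sg b)).Factor P (P.vF (sg a)) R fun p => P.qp (-sg b) *
      if a = b then (P.z p.1 - P.qp (-sg a * (2 * P.h - 2)) * P.z p.2) /
        (P.z p.1 - P.qp (-sg a * (2 * P.h)) * P.z p.2) else 1 := by
  have hs : ∀ a, sg a = 1 ∨ sg a = -1 := by intro a; fin_cases a <;> simp [sg]
  have hz := zeroContr_SII_F (P := P) (sg a) (sg b)
  split_ifs with hab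
  · subst hab
    have := Vtx.exists_factor P (hP.adm_vSII _) (hP.adm_vF _) (contr_SII_F hP (hs a) (sg a)) hz
    simp only [zpow_zero, mul_one] at this
    rwa [show -sg a * (2 * P.h - 1) - sg a = -sg a * (2 * P.h) by ring] at this
  · have hab' : sg b = -sg a := by fin_cases a <;> fin_cases b <;> simp_all [sg]
    have := Vtx.exists_factor_of_contr_eq_zero P (hP.adm_vSII _) (hP.adm_vF _) (fun n => by
      rw [contr_SII_F hP (hs a), hab',
        show -sg a * (2 * P.h - 1) - -sg a = -sg a * (2 * P.h - 2) by ring, sub_self, zero_div]) hz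
    simpa only [zpow_zero, mul_one] using this

theorem diffOPE_F_SII (hP : P.Generic) : P.DiffOPE P.F P.SII 1 (P.k + 2) P.s2 := by
  rw [F_eq P hP, SII_eq P hP, s2_eq hP]
  have hz₁ := Vtx.isExpPoly_z_fst P
  have hz₂ := Vtx.isExpPoly_z_snd P
  have hd := hP.dq_ne
  have g1 := P.qp_ne_zero 1
  have g2 := P.qp_ne_zero P.h
  have hn : ((P.k + 2 : ℝ) : ℂ) = 2 * P.h := by rw [h]; push_cast; ring
  have hk : ∀ (a b : Fin 2) (c d : ℂ), IsExpPoly fun p : ℂ × ℂ =>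
      P.cf a p.1 * P.cf b p.2 * c * (P.z p.1 - d * P.z p.2) := by
    intro a b c d
    have := isExpPoly_cf (P := P) a
    have := isExpPoly_cf_snd (P := P) b
    fun_prop
  refine P.diffOPE_of_factor hP.lnq_ne
    -- The mixed terms form the regular part, and each diagonal term carries one of the two poles.
    (k₀ := fun a b p => if a = b then 0 else P.cf a p.1 * P.cf b p.2 * P.qp (sg a))
    (k₁ := fun a b p => if a = 0 ∧ b = 0 then P.cf 0 p.1 * P.cf 0 p.2 * P.qp 1 *
      (P.z p.1 - P.qp (2 * P.h - 2) * P.z p.2) else 0)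
    (k₂ := fun a b p => if a = 1 ∧ b = 1 then P.cf 1 p.1 * P.cf 1 p.2 * (P.qp 1)⁻¹ *
      (P.z p.1 - P.qp (2 - 2 * P.h) * P.z p.2) else 0)
    (exists_factor_F_SII hP) (exists_factor_SII_F hP)
    (mul_one 1) (fun a b => ?_) (fun a b => ?_) (fun a b => ?_)
    (fun a b u v ha hb => ?_) (fun a b u v ha hb => ?_) (fun i j u => ?_) (fun i j u => ?_)
  · have := isExpPoly_cf (P := P) a
    have := isExpPoly_cf_snd (P := P) b
    split_ifs <;> fun_prop
  · split_ifs
    · exact hk _ _ _ _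
    · exact .const 0
  · split_ifs
    · exact hk _ _ _ _
    · exact .const 0
  · have hz := P.z_ne_zero u
    have hz' := P.z_ne_zero v
    rw [hn] at ha hb ⊢
    fin_cases a <;> fin_cases b <;> simp [sg, qp_neg] <;> ring
  · have hz := P.z_ne_zero u
    have hz' := P.z_ne_zero v
    rw [hn] at ha hb ⊢
    rw [qp_neg] at hb
    have g3 := P.qp_ne_zero (2 * P.h)
    have g4 := P.qp_ne_zero 2
    have e1 : P.z v - (P.qp (2 * P.h))⁻¹ * P.z u
        = -(P.qp (2 * P.h))⁻¹ * (P.z u - P.qp (2 * P.h) * P.z v) := by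
      field_simp; ring
    have e2 : P.z v - P.qp (2 * P.h) * P.z u
        = -P.qp (2 * P.h) * (P.z u - (P.qp (2 * P.h))⁻¹ * P.z v) := by
      field_simp; ring
    have eq := P.qp_two
    fin_cases a <;> fin_cases b <;> simp [sg, qp_neg, qp_sub, e1, e2]
    · field_simp
      rw [eq]
      ring
    · field_simp
      rw [eq]
      ring
  · have e := lin_vF_add_lin_vSII hP (.inl rfl) u
    have hz := P.z_sub_half u (2 * P.h)
    have hu := P.z_ne_zero u
    have ek : (P.k + 2 : ℂ) = 2 * P.h := by rw [h]; ring
    rw [neg_mul, one_mul, neg_div, ← sub_eq_add_neg, ek] at e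
    rw [hn]
    generalize u - 2 * P.h / 2 = v at *
    simp [Fin.sum_univ_two, normalElt, sg, e, hz, cf, qp_sub, qp_two]
    refine .inl ?_
    have g3 := P.qp_ne_zero (2 * P.h)
    have hd' := hd
    rw [dq, qp_neg] at hd'
    -- The zero of the factor leaves q(1 - q^{-2}) = q - q⁻¹ in the numerator, which cancels one of
    -- the two factors q - q⁻¹ in the prefactors of F and S_II.
    have : P.dq = P.qp 1 - (P.qp 1)⁻¹ := by rw [dq, qp_neg]
    field_simp
    rw [this]
    field_simp
  · have e := lin_vF_add_lin_vSII hP (.inr rfl) u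
    have hz := P.z_add_half u (2 * P.h)
    have hu := P.z_ne_zero u
    have ek : (P.k + 2 : ℂ) = 2 * P.h := by rw [h]; ring
    rw [neg_neg, one_mul, ek] at e
    rw [hn]
    generalize u + 2 * P.h / 2 = v at *
    simp [Fin.sum_univ_two, normalElt, sg, e, hz, cf, qp_sub, qp_two]
    rw [← neg_mul]
    congr 1
    have g3 := P.qp_ne_zero (2 * P.h)
    have : P.dq = P.qp 1 - (P.qp 1)⁻¹ := by rw [dq, qp_neg]
    field_simp
    rw [this]
    field_simp
    ring

end Params

end ScreeningCurrents

end

noncomputable section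

namespace ScreeningCurrents

open Finset

namespace Params

/-! ### Infinite products -/

section Pochhammer

variable {t : ℂ}

theorem qPoch_eq_mul (ht : ‖t‖ < 1) (x : ℂ) : qPoch x t = (1 - x) * qPoch (t * x) t := by
  have hm : ∀ y : ℂ, Multipliable fun n : ℕ => 1 - y * t ^ n := by
    intro y
    simp only [sub_eq_add_neg]
    refine multipliable_one_add_of_summable ?_
    simpa using (summable_geometric_of_lt_one (norm_nonneg _) ht).mul_left ‖y‖
  rw [qPoch, _root_.tprod_eq_zero_mul' ?_, pow_zero, mul_one, qPoch]
  · congr 2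
    funext n
    ring
  · convert hm (t * x) using 2
    ring

/-- On each ball the factors differ from 1 by a geometric series, so the product converges locally
uniformly. -/
theorem differentiable_qPoch (ht : ‖t‖ < 1) : Differentiable ℂ fun x => qPoch x t := by
  intro x
  have hx : x ∈ Metric.ball (0 : ℂ) (‖x‖ + 1) := by simp
  have hs : Summable fun n : ℕ => (‖x‖ + 1) * ‖t‖ ^ n :=
    (summable_geometric_of_lt_one (norm_nonneg _) ht).mul_left _
  have h := hs.hasProdLocallyUniformlyOn_nat_one_add
    (f := fun (n : ℕ) (y : ℂ) => -(y * t ^ n)) (K := Metric.ball (0 : ℂ) (‖x‖ + 1))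
    Metric.isOpen_ball (.of_forall fun n y hy => by
      rw [norm_neg, norm_mul, norm_pow]
      have : ‖y‖ < ‖x‖ + 1 := by simpa using hy
      gcongr) (fun n => by fun_prop)
  have hd := h.differentiableOn (.of_forall fun _ => by
    simpa [Finset.prod_fn] using DifferentiableOn.finsetProd (fun _ _ => by fun_prop))
    Metric.isOpen_ball
  exact (hd.differentiableAt (Metric.isOpen_ball.mem_nhds hx)).congr_of_eventuallyEq
    (.of_forall fun y => by simp only [qPoch, sub_eq_add_neg])

/-- Expanding 1/(1 - t^n) as a geometric series gives an absolutely convergent double series. Summed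
over m first it is the stated series, and summed over n first it is the sum of -log(1 - y t^m). -/
theorem exists_hasSum_qPoch (ht : ‖t‖ < 1) {y : ℂ} (hy : ‖y‖ < 1) :
    ∃ a, HasSum (fun n : ℕ+ => y ^ (n : ℕ) / ((n : ℕ) * (1 - t ^ (n : ℕ)))) a ∧
      Complex.exp (-a) = qPoch y t := by
  have hlt : ∀ m : ℕ, ‖y * t ^ m‖ < 1 := by
    intro m
    rw [norm_mul, norm_pow]
    exact lt_of_le_of_lt (mul_le_of_le_one_right (norm_nonneg _)
      (pow_le_one₀ (norm_nonneg _) ht.le)) hy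
  have hF : Summable fun p : ℕ × ℕ+ => (y * t ^ p.1) ^ (p.2 : ℕ) / (p.2 : ℕ) := by
    have h1 := summable_geometric_of_lt_one (norm_nonneg _) ht
    have h2 := (summable_geometric_of_lt_one (norm_nonneg _) hy).comp_injective PNat.coe_injective
    refine Summable.of_norm_bounded (h1.mul_of_nonneg h2 (fun _ => by positivity)
      (fun _ => by simp only [Function.comp_apply, Pi.zero_apply]; positivity)) fun p => ?_
    have hp : (1 : ℝ) ≤ (p.2 : ℕ) := by exact_mod_cast p.2.pos
    rw [norm_div, Complex.norm_natCast, norm_pow, norm_mul, norm_pow, mul_pow, ← pow_mul]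
    refine (div_le_self (by positivity) hp).trans ?_
    rw [Function.comp_apply, mul_comm]
    gcongr ?_ * _
    exact pow_le_pow_of_le_one (norm_nonneg _) ht.le (Nat.le_mul_of_pos_right _ p.2.pos)
  obtain ⟨a, ha⟩ := hF
  refine ⟨a, ?_, ?_⟩
  · refine ((Equiv.prodComm _ _).hasSum_iff.2 ha).prod_fiberwise fun n => ?_
    have hn : ‖t ^ (n : ℕ)‖ < 1 := by
      rw [norm_pow]
      exact pow_lt_one₀ (norm_nonneg _) ht n.ne_zero
    refine hasSum_of_eq ((hasSum_geometric_of_norm_lt_one hn).mul_left (y ^ (n : ℕ) / (n : ℕ)))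
      (fun m => ?_) ?_
    · simp only [Function.comp_apply, Equiv.prodComm_apply, Prod.swap_prod_mk, mul_pow]
      rw [← pow_mul, ← pow_mul, mul_comm m]
      ring
    · rw [div_mul_eq_div_div, div_eq_mul_inv _ (1 - _)]
  · have hl : HasSum (fun m : ℕ => -Complex.log (1 - y * t ^ m)) a :=
      ha.prod_fiberwise fun m => by
        have := Vtx.hasSum_pow_div_pnat (hlt m)
        exact this
    replace hl := hl.neg
    simp only [neg_neg] at hl
    have hne : ∀ m : ℕ, 1 - y * t ^ m ≠ 0 := by
      intro m h0
      have := hlt m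
      rw [← sub_eq_zero.1 h0, norm_one] at this
      exact lt_irrefl _ this
    exact (Complex.hasProd_of_hasSum_log hne hl).tprod_eq.symm

theorem qPoch_ne_zero (ht : ‖t‖ < 1) {y : ℂ} (hy : ‖y‖ < 1) : qPoch y t ≠ 0 := by
  obtain ⟨a, -, ha⟩ := exists_hasSum_qPoch ht hy
  rw [← ha]
  exact Complex.exp_ne_zero _

end Pochhammer

variable {P : Params}

/-! ### The exchange relation -/

/-- The boson a gives (q^{2n} - q^{-2n})/(n(1 - T^n)) with T = q^{4h} = q^{2(k+2)}, and b adds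
q^{-2n}/n, which turns q^{-2n} into (T q^{-2})^n. The last term comes from c. -/
theorem contr_SII_SII (hP : P.Generic) (s t : ℂ) (n : ℕ+) :
    (P.vSII s).contr P (P.vSII t) n
      = (P.qp 2 ^ (n : ℕ) / ((n : ℕ) * (1 - P.qp (4 * P.h) ^ (n : ℕ)))
        - (P.qp (4 * P.h) / P.qp 2) ^ (n : ℕ) / ((n : ℕ) * (1 - P.qp (4 * P.h) ^ (n : ℕ))))
        - P.qp (t - s) ^ (n : ℕ) / (n : ℕ) := by
  have h1 := hP.d1_ne n
  have h2 := hP.dk_ne n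
  have g1 := P.qp_ne_zero 1
  have g2 := P.qp_ne_zero P.h
  have gs := P.qp_ne_zero s
  have g5 := hP.dq_ne
  have e4 : P.qp (4 * P.h) = (P.qp P.h ^ 2) ^ 2 := by
    rw [← qp_two_mul, ← qp_two_mul]; congr 1; ring
  have hd : 1 - (P.qp P.h ^ (n : ℕ)) ^ 4 ≠ 0 := by
    intro h0
    refine h2 ?_
    rw [dk_eq]
    have : P.qp P.h ^ (n : ℕ) ≠ 0 := pow_ne_zero _ g2
    field_simp
    linear_combination -h0
  simp only [contr_eq, vSII, qp_sub, e4, qp_two, br_two_eq, div_pow, inv_pow]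
  simp only [pow_right_comm _ 2 (n : ℕ)]
  field_simp
  simp only [dk_eq]
  field_simp
  ring

/-- The contraction exponentiates to infinite products of base T = q^{2(k+2)}; k > -2 is what makes
|T| < 1. The signs s and t enter only the last, rational factor. -/
theorem exists_factor_SII_SII (hP : P.Generic) (hk : -2 < P.k) (s t : ℂ) :
    ∃ R : ℝ, 0 < R ∧ (P.vSII s).Factor P (P.vSII t) R fun p =>
      Complex.exp (2 / (P.k + 2) * P.lnz p.1) *
        (qPoch (P.qp (4 * P.h) / P.qp 2 * (P.z p.2 / P.z p.1)) (P.qp (4 * P.h)) /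
          qPoch (P.qp 2 * (P.z p.2 / P.z p.1)) (P.qp (4 * P.h))) *
        (P.qp s * (1 - P.qp (t - s) * (P.z p.2 / P.z p.1))) := by
  obtain ⟨R, hR, H⟩ := Vtx.exists_hasSum_mul P (hP.adm_vSII s) (hP.adm_vSII t)
  set T := P.qp (4 * P.h) with hT
  have hT1 : ‖T‖ < 1 := by
    have := P.norm_qp_lt_one hP.lnq_re (s := 2 * (P.k + 2)) (by linarith)
    rw [hT, show 4 * P.h = ((2 * (P.k + 2) : ℝ) : ℂ) by rw [h]; push_cast; ring]
    exact this
  set R' := max R (max ‖T / P.qp 2‖ (max ‖P.qp 2‖ ‖P.qp (t - s)‖)) with hR'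
  refine ⟨R', lt_max_of_lt_left hR, fun u v huv i j => ?_⟩
  have hlt : ∀ c : ℂ, ‖c‖ ≤ R' → ‖c * (P.z v / P.z u)‖ < 1 := by
    intro c hc
    rw [norm_mul, norm_div, ← mul_div_assoc, div_lt_one (norm_pos_iff.2 (P.z_ne_zero u))]
    exact lt_of_le_of_lt (mul_le_mul_of_nonneg_right hc (norm_nonneg _)) huv
  obtain ⟨a, ha, ea⟩ := exists_hasSum_qPoch hT1 (hlt (P.qp 2) (by simp [hR']))
  obtain ⟨b, hb, eb⟩ := exists_hasSum_qPoch hT1 (hlt (T / P.qp 2) (by simp [hR']))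
  have h3 := hlt (P.qp (t - s)) (by simp [hR'])
  have hc := Vtx.hasSum_pow_div_pnat h3
  have key := H u v (lt_of_le_of_lt (mul_le_mul_of_nonneg_right (le_max_left _ _)
    (norm_nonneg _)) huv) i j
  have hval : ∑' n : ℕ+, (P.vSII s).contr P (P.vSII t) n * (P.z v / P.z u) ^ (n : ℕ)
      = a - b - -Complex.log (1 - P.qp (t - s) * (P.z v / P.z u)) := by
    rw [← ((ha.sub hb).sub hc).tsum_eq]
    refine tsum_congr fun n => ?_
    rw [contr_SII_SII hP, mul_pow, mul_pow, mul_pow]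
    ring
  have hne : 1 - P.qp (t - s) * (P.z v / P.z u) ≠ 0 := by
    intro h0
    rw [← sub_eq_zero.1 h0, norm_one] at h3
    exact lt_irrefl _ h3
  rw [hval, zeroContr_SII_SII hP, sub_neg_eq_add, Complex.exp_add, Complex.exp_add,
    Complex.exp_log hne, sub_eq_add_neg a, Complex.exp_add, eb, ← neg_neg a, Complex.exp_neg (-a),
    ea] at key
  refine hasSum_of_eq key (fun _ => rfl) ?_
  simp only [qp]
  ring

/-- The numerator of the rational part of the matrix elements of `S_II(z) S_II(w)`. -/
def bracketSII (P : Params) (i j : FockIndex) (p : ℂ × ℂ) : ℂ :=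
  ∑ a, ∑ b, P.cf a p.1 * P.cf b p.2 *
    (P.qp (sg a) * (1 - P.qp (sg b - sg a) * (P.z p.2 * (P.z p.1)⁻¹))) *
    P.normalElt (P.vSII (sg a)) (P.vSII (sg b)) i j p

theorem isExpPoly_bracketSII (P : Params) (i j : FockIndex) : IsExpPoly (P.bracketSII i j) := by
  refine .sum _ fun a _ => .sum _ fun b _ => ?_
  have h₁ := isExpPoly_cf (P := P) a
  have h₂ := isExpPoly_cf_snd (P := P) b
  have h₃ := Vtx.isExpPoly_z_snd P
  have h₄ := Vtx.isExpPoly_inv_z_fst P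
  have h₅ := P.isExpPoly_normalElt (P.vSII (sg a)) (P.vSII (sg b)) i j
  fun_prop

/-- Multiplied by z, the scalar in each term is q^s z - q^t w up to the symmetric product of the
prefactors. It changes sign when (z, s) and (w, t) are exchanged. -/
theorem bracketSII_swap (P : Params) (i j : FockIndex) (u v : ℂ) :
    P.bracketSII i j (v, u) = -(P.z u / P.z v) * P.bracketSII i j (u, v) := by
  rw [bracketSII, bracketSII, sum_comm, mul_sum]
  refine sum_congr rfl fun a _ => ?_
  rw [mul_sum]
  refine sum_congr rfl fun b _ => ?_
  have e : P.normalElt (P.vSII (sg b)) (P.vSII (sg a)) i j (v, u)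
      = P.normalElt (P.vSII (sg a)) (P.vSII (sg b)) i j (u, v) := by
    simp only [normalElt, add_comm]
  have h₁ := P.z_ne_zero u
  have h₂ := P.z_ne_zero v
  have h₃ := P.qp_ne_zero (sg a)
  have h₄ := P.qp_ne_zero (sg b)
  simp only [e, qp_sub]
  field_simp
  ring

theorem analyticOnNhd_qPoch {t : ℂ} (ht : ‖t‖ < 1) {f : ℂ × ℂ → ℂ} (hf : IsExpPoly f) :
    AnalyticOnNhd ℂ (fun p => qPoch (f p) t) Set.univ := fun p _ =>
  ((differentiable_qPoch ht).analyticAt (f p)).comp_of_eq (hf.analyticOnNhd p trivial) rfl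

/-- One meromorphic function continues the left product, and the same function with its variables
swapped continues the right one. Their ratio combines the infinite products of w/z with those of
z/w, which together form theta functions. -/
theorem exchange_SII_SII (hP : P.Generic) (hk : -2 < P.k) :
    P.Exchange P.SII P.SII
      (fun u v => P.theta (P.k + 2) (u - v + 1) / P.theta (P.k + 2) (u - v - 1))
      {p | P.theta (P.k + 2) (p.1 - p.2 - 1) ≠ 0} := by
  rw [SII_eq P hP]
  obtain ⟨R, hR, H⟩ := P.hasSum_comb_mul (c := P.cf) (d := P.cf)
    (V := fun a => P.vSII (sg a)) (W := fun b => P.vSII (sg b))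
    fun a b => exists_factor_SII_SII hP hk (sg a) (sg b)
  have hkC := hP.k_add_two_ne
  have e4 : 4 * P.h = 2 * ((P.k + 2 : ℝ) : ℂ) := by rw [h]; push_cast; ring
  set T := P.qp (4 * P.h) with hT
  have hT1 : ‖T‖ < 1 := by
    have := P.norm_qp_lt_one hP.lnq_re (s := 2 * (P.k + 2)) (by linarith)
    rw [hT, e4]
    exact_mod_cast this
  have hx : IsExpPoly fun p : ℂ × ℂ => P.z p.2 * (P.z p.1)⁻¹ :=
    (Vtx.isExpPoly_z_snd P).mul (Vtx.isExpPoly_inv_z_fst P)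
  have hx' : IsExpPoly fun p : ℂ × ℂ => P.z p.1 * (P.z p.2)⁻¹ :=
    (Vtx.isExpPoly_z_fst P).mul (Vtx.isExpPoly_inv_z_snd P)
  have hden := analyticOnNhd_qPoch hT1 ((IsExpPoly.const (P.qp 2)).mul hx)
  have hnum := analyticOnNhd_qPoch hT1 ((IsExpPoly.const (T / P.qp 2)).mul hx)
  have hexp : AnalyticOnNhd ℂ (fun p : ℂ × ℂ => Complex.exp (2 / (P.k + 2) * P.lnz p.1))
      Set.univ := fun p _ => by simp only [lnz]; fun_prop
  -- At u = v = 0 the denominator is (q²; T)_∞, nonzero because |q²| < 1.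
  have hne : qPoch (P.qp 2 * (P.z 0 * (P.z 0)⁻¹)) T ≠ 0 := by
    rw [mul_inv_cancel₀ (P.z_ne_zero 0), mul_one]
    have := P.norm_qp_lt_one hP.lnq_re (s := 2) two_pos
    exact qPoch_ne_zero hT1 (by exact_mod_cast this)
  have hswap : ∀ {f : ℂ × ℂ → ℂ}, AnalyticOnNhd ℂ f Set.univ →
      AnalyticOnNhd ℂ (fun p : ℂ × ℂ => f (p.2, p.1)) Set.univ := fun hf p _ =>
    (hf (p.2, p.1) trivial).comp_of_eq (f := fun p : ℂ × ℂ => (p.2, p.1)) (by fun_prop) rfl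
  -- The radius exceeds 1, so that |w| < |z| and the denominator does not vanish in the region of
  -- convergence.
  refine ⟨R + 1, by positivity, fun i j => ?_⟩
  have hN := (hexp.mul hnum).mul (P.isExpPoly_bracketSII i j).analyticOnNhd
  let M : Mero := ⟨_, _, hN, hden, (0, 0), hne⟩
  let M' : Mero := ⟨_, _, hswap hN, hswap hden, (0, 0), hne⟩
  have hM : P.LeftProduct (P.comb P.cf fun a => P.vSII (sg a))
      (P.comb P.cf fun a => P.vSII (sg a)) (R + 1) i j M := by
    intro u v huv
    refine ⟨_, H u v (lt_of_le_of_lt (by gcongr; linarith) huv) i j, ?_⟩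
    have hlt : ‖P.z v‖ < ‖P.z u‖ := lt_of_le_of_lt (by
      nlinarith [norm_nonneg (P.z v)]) huv
    have hd : qPoch (P.qp 2 * (P.z v * (P.z u)⁻¹)) T ≠ 0 := by
      refine qPoch_ne_zero hT1 ?_
      have h2 := P.norm_qp_lt_one hP.lnq_re (s := 2) two_pos
      have h3 : ‖P.z v * (P.z u)⁻¹‖ ≤ 1 := by
        rw [norm_mul, norm_inv, ← div_eq_mul_inv]
        exact div_le_one_of_le₀ hlt.le (norm_nonneg _)
      rw [norm_mul]
      exact lt_of_le_of_lt (mul_le_of_le_one_right (norm_nonneg _) h3) (by exact_mod_cast h2)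
    change qPoch (P.qp 2 * (P.z v * (P.z u)⁻¹)) T * _
      = Complex.exp (2 / (P.k + 2) * P.lnz u) * qPoch (T / P.qp 2 * (P.z v * (P.z u)⁻¹)) T
        * P.bracketSII i j (u, v)
    simp only [bracketSII, mul_sum, div_eq_mul_inv (P.z v)]
    refine sum_congr rfl fun a _ => sum_congr rfl fun b _ => ?_
    generalize qPoch (P.qp 2 * (P.z v * (P.z u)⁻¹)) T = D at *
    field_simp
  refine ⟨M, M', hM, fun u v huv => hM v u huv, ?_⟩
  rintro ⟨u, v⟩ hθ hd hd'
  change qPoch (P.qp 2 * (P.z v * (P.z u)⁻¹)) T ≠ 0 at hd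
  change qPoch (P.qp 2 * (P.z u * (P.z v)⁻¹)) T ≠ 0 at hd'
  change P.theta (P.k + 2) (u - v - 1) ≠ 0 at hθ
  change Complex.exp (2 / (P.k + 2) * P.lnz u) * qPoch (T / P.qp 2 * (P.z v * (P.z u)⁻¹)) T
        * P.bracketSII i j (u, v) / qPoch (P.qp 2 * (P.z v * (P.z u)⁻¹)) T
      = P.theta (P.k + 2) (u - v + 1) / P.theta (P.k + 2) (u - v - 1) *
      (Complex.exp (2 / (P.k + 2) * P.lnz v) * qPoch (T / P.qp 2 * (P.z u * (P.z v)⁻¹)) T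
        * P.bracketSII i j (v, u) / qPoch (P.qp 2 * (P.z u * (P.z v)⁻¹)) T)
  -- The Gaussian prefactors of the theta functions absorb the fractional powers: their exponents
  -- differ by 4(u - v)/(k + 2) - 2, and (z/w)^{2/(k+2)} = q^{4(u-v)/(k+2)}.
  have hE : P.qp ((u - v + 1) ^ 2 / (P.k + 2 : ℝ) - (u - v + 1)) *
      Complex.exp (2 / (P.k + 2) * P.lnz v) * P.qp 2
      = P.qp ((u - v - 1) ^ 2 / (P.k + 2 : ℝ) - (u - v - 1)) *
        Complex.exp (2 / (P.k + 2) * P.lnz u) := by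
    simp only [qp, lnz, ← Complex.exp_add]
    push_cast
    congr 1
    field_simp
    ring
  have hz : ∀ w, P.z w ≠ 0 := P.z_ne_zero
  have h2 := P.qp_ne_zero 2
  have ep : P.qp (2 * (u - v + 1)) = P.qp 2 * (P.z u * (P.z v)⁻¹) := by
    rw [z, z, ← qp_neg, ← qp_add, ← qp_add]; congr 1; ring
  have em : P.qp (2 * (u - v - 1)) = (P.qp 2)⁻¹ * (P.z u * (P.z v)⁻¹) := by
    rw [z, z, ← qp_neg, ← qp_neg, ← qp_add, ← qp_add]; congr 1; ring
  have hx : P.z v * (P.z u)⁻¹ = (P.z u * (P.z v)⁻¹)⁻¹ := by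
    rw [mul_inv, inv_inv, mul_comm]
  have hy : P.z u * (P.z v)⁻¹ ≠ 0 := mul_ne_zero (hz u) (inv_ne_zero (hz v))
  have hBB := P.bracketSII_swap i j u v
  rw [div_eq_mul_inv (P.z u)] at hBB
  simp only [theta, bigTheta, ← e4, ← hT, ep, em] at hθ ⊢
  rw [hBB]
  rw [hx] at hd ⊢
  generalize P.z u * (P.z v)⁻¹ = y at *
  -- Peeling the first factor off (q²/y; T)_∞ and off (q⁻²y; T)_∞, with y = z/w, makes the remaining
  -- infinite products on the two sides match. The two peeled factors have ratio -q²/y, which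
  -- cancels against `bracketSII_swap` and the q² in `hE`.
  rw [qPoch_eq_mul hT1] at hd
  rw [qPoch_eq_mul hT1 (P.qp 2 * y⁻¹)]
  rw [qPoch_eq_mul hT1 ((P.qp 2)⁻¹ * y)] at hθ ⊢
  rw [show T * ((P.qp 2)⁻¹ * y) = T / P.qp 2 * y by ring,
    show T * ((P.qp 2)⁻¹ * y)⁻¹ = T * (P.qp 2 * y⁻¹) by rw [mul_inv, inv_inv]] at hθ ⊢
  rw [show T * (P.qp 2 * y)⁻¹ = T / P.qp 2 * y⁻¹ by rw [mul_inv]; ring]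
  generalize qPoch (T / P.qp 2 * y⁻¹) T = A at *
  generalize qPoch (P.qp 2 * y) T = C at *
  generalize qPoch (T * (P.qp 2 * y⁻¹)) T = D at *
  generalize qPoch (T / P.qp 2 * y) T = Y at *
  generalize qPoch T T = K at *
  generalize P.bracketSII i j (u, v) = B at *
  generalize P.qp ((u - v + 1) ^ 2 / (P.k + 2 : ℝ) - (u - v + 1)) = a at *
  have hb := P.qp_ne_zero ((u - v - 1) ^ 2 / (P.k + 2 : ℝ) - (u - v - 1))
  generalize P.qp ((u - v - 1) ^ 2 / (P.k + 2 : ℝ) - (u - v - 1)) = b at *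
  generalize Complex.exp (2 / (P.k + 2) * P.lnz v) = c at *
  generalize Complex.exp (2 / (P.k + 2) * P.lnz u) = d at *
  generalize P.qp 2 = g at *
  have hd1 : d = a * c * g / b := by rw [hE]; field_simp
  have hD : D ≠ 0 := right_ne_zero_of_mul hd
  have h1 : 1 - g * y⁻¹ ≠ 0 := left_ne_zero_of_mul hd
  have hK : K ≠ 0 := by rintro rfl; simp at hθ
  have hY : Y ≠ 0 := by rintro rfl; simp at hθ
  have h3 : 1 - g⁻¹ * y ≠ 0 := by intro h0; simp [h0] at hθ
  have h4 : y - g ≠ 0 := by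
    intro h0
    refine h1 ?_
    rw [← sub_eq_zero.1 h0, mul_inv_cancel₀ hy, sub_self]
  have e1 : 1 - g * y⁻¹ = (y - g) / y := by field_simp
  have e3 : 1 - g⁻¹ * y = -(y - g) / g := by field_simp; ring
  rw [hd1, e1, e3]
  field_simp

end Params

end ScreeningCurrents

end

/-! ### The theorem -/

theorem theorem2 (P : Params) (hq : P.lnq.re < 0) (hr : 0 < P.r) (hrs : 0 < P.rs)
    (hk : P.k ≠ -2) :
    -- relations of `S_I` with the currents and with itself
    P.RegularOPE P.HP P.SI 1 ∧
    P.RegularOPE P.HM P.SI 1 ∧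
    P.DiffOPE P.E P.SI (-1) 1 P.s1 ∧
    P.RegularOPE P.F P.SI (-1) ∧
    P.RegularOPE P.SI P.SI (-1) ∧
    -- relations of `S_II` with the currents and with itself
    P.RegularOPE P.HP P.SII 1 ∧
    P.RegularOPE P.HM P.SII 1 ∧
    P.RegularOPE P.E P.SII 1 ∧
    P.DiffOPE P.F P.SII 1 (P.k + 2) P.s2 ∧
    (-2 < P.k →
      P.Exchange P.SII P.SII
        (fun u v => P.theta (P.k + 2) (u - v + 1) / P.theta (P.k + 2) (u - v - 1))
        {p | P.theta (P.k + 2) (p.1 - p.2 - 1) ≠ 0}) ∧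
    -- relation between `S_II` and `S_I`
    P.DiffOPE P.SII P.SI (-1) 1 P.s3 := by
  have hP : P.Generic := ⟨hq, hr, hrs, hk⟩
  exact ⟨Params.regularOPE_HP_SI hP, Params.regularOPE_HM_SI hP, Params.diffOPE_E_SI hP,
    Params.regularOPE_F_SI hP, Params.regularOPE_SI_SI hP, Params.regularOPE_HP_SII hP,
    Params.regularOPE_HM_SII hP, Params.regularOPE_E_SII hP, Params.diffOPE_F_SII hP,
    Params.exchange_SII_SII hP, Params.diffOPE_SII_SI hP⟩
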